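/- Let $p$ be an odd prime, $n\ge 2$, and let $V$ be the self-dual quadratic $\mathbb Z_p$-lattice of rank $2n$ whose group $\mathrm{GSpin}(V_{\mathbb Q_p})$ is quasi-split but not split: in coordinates, $q=\sum_{i<n}x_iy_i+a^2-\varepsilon b^2$ with $\varepsilon\in\mathbb Z_p^\times$ a non-square. Let $G=\mathrm{GSpin}(V_{\mathbb Q_p})=\{g\in C^+(V)^\times: gVg^{-1}=V\}$, $K_p=\mathrm{GSpin}(V)(\mathbb Z_p)$. Over a field containing $\sqrt\varepsilon$ choose mutually orthogonal hyperbolic pairs $(v_i,w_i)$, $1\le i\le n$, those with $i<n$ being the standard pairs over $\mathbb Z_p$ and the last one spanning the plane of $a^2-\varepsilon b^2$. The corresponding maximal torus $T_\Delta$ has cocharacter lattice $X_*(T_\Delta)=\bigoplus_{i=0}^n\mathbb Z e_i^\vee$, where $e_0^\vee(t)=t$ is the central cocharacter and $e_i^\vee(t)=t\,v_iw_i+w_iv_i$ for $i\ge1$. Frobenius $\sigma$ sends $e_n^\vee$ to $e_0^\vee-e_n^\vee$ and fixes the other $e_i^\vee$; the maximal split torus $S\subset T_\Delta$ has $X_*(S)=\bigoplus_{i=0}^{n-1}\mathbb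 Z e_i^\vee$. The half sum of positive roots $\rho$ satisfies $\langle\rho,e_i^\vee\rangle=n-i$ for $i\ge1$ and $\langle\rho,e_0^\vee\rangle=0$. The Kuga–Satake cocharacter $\mu^{KS}$ is the cocharacter of $T_\Delta$ which lifts the cocharacter $t\mapsto\mathrm{diag}(t,1,\dots,1,t^{-1})$ of $\mathrm{SO}(V)$ ($t$ on $v_1$, $t^{-1}$ on $w_1$) and whose composite with the spinor norm is $t\mapsto t$. Let $k$ be an algebraically closed field of characteristic $0$ (for example $\overline{\mathbb Q}_\ell$). The dual group of $G$ is $\mathrm{GSO}_{2n}$; in its maximal torus $\hat T=\{\mathrm{diag}(t_1,\dots,t_n,st_n^{-1},\dots,st_1^{-1})\}$ the characters $s,t_i$ are $e_0^\vee,e_i^\vee$. Frobenius $\sigma$ acts on $\mathrm{GSO}_{2n}$ by the pinned outer automorphism (conjugation by the permutation matrix that exchanges the two basis vectors of weights $t_n$ and $st_n^{-1}$). Let $r$ be the irreducible algebraic representation of $\mathrm{GSO}_{2n}$ over $k$ with highest weight $e_1^\vee$, extended to $\mathrm{GSO}_{2n}(k)\rtimes\langle\sigma\rangle$ so that $\sigma$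 acts trivially on the highest weight line. For $\mu=e_1^\vee$ put $$H_g(X)=\det\bigl(X-p^{\langle\mu,\rho\rangle}r(g\rtimes\sigma)\bigr),\qquad \langle\mu,\rho\rangle=n-1 .$$ Then: 1. $\mu^{KS}=e_1^\vee$. 2. Such an $r$ exists. The weights of every such $r$ are exactly $e_1^\vee,\dots,e_n^\vee,\ e_0^\vee-e_1^\vee,\dots,e_0^\vee-e_n^\vee$, each with multiplicity one. 3. For $g\in\hat T$ with coordinates $(s,t_1,\dots,t_n)$, $$H_g(X)=(X^2-p^{2(n-1)}s)\prod_{i=1}^{n-1}(X-p^{n-1}t_i)(X-p^{n-1}st_i^{-1}).$$ There is exactly one polynomial $H$ with coefficients in $\mathbb Q[X_*(S)]$ (functions on the dual torus of $S$) whose value at each $g\in\hat T$ is $H_g$. In the normalization of the twisted Satake transform, that is, after applying the automorphism $h_\nu\mapsto p^{-\langle\rho,\nu\rangle}h_\nu$ of $\mathbb Q[X_*(S)]$ which carries invariants of the relative Weyl group to invariants of the dot action $w\bullet h_\nu=p^{\langle\rho,\nu-w\nu\rangle}h_{w\nu}$, it becomes the Hecke polynomial $$H_{\mu^{KS}}(X)=(X^2-p^{2(n-1)}s)\prod_{i=1}^{n-1}(X-p^{i-1}t_i)(X-p^{2n-1-i}st_i^{-1}),$$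 where now $s=h_{e_0^\vee}$, $t_i=h_{e_i^\vee}$, $st_i^{-1}=h_{e_0^\vee-e_i^\vee}$. 4. $s$ corresponds to the Hecke operator $K_p\,p\,K_p$: the twisted Satake transform $f\mapsto\bigl(\nu\mapsto\int_{U(\mathbb Q_p)}f(u\,\nu(p))\,du\bigr)$ (with $U$ the unipotent radical of the Borel subgroup stabilizing the flag $\langle v_1\rangle\subset\dots\subset\langle v_1,\dots,v_{n-1}\rangle$, and $\mathrm{vol}(U\cap K_p)=1$) of the characteristic function of $K_p\,p\,K_p$ is $h_{e_0^\vee}=s$. -/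

import Mathlib

open Polynomial

universe u v w

noncomputable section

namespace GSpinHecke

/-! ### Part 1. The group `GSpin` of a quadratic space and its cocharacters -/

section Clifford

variable {R : Type*} [CommRing R] {M : Type*} [AddCommGroup M] [Module R M]

/-- `GSpin(Q)(R) = {g ∈ C⁺(V)ˣ : g V g⁻¹ = V}`, as a subgroup of the units of the
Clifford algebra.  (A unit of the even subalgebra is a unit `g` of the Clifford algebra such
that both `g` and `g⁻¹` are even.) -/
def GSpin (Q : QuadraticForm R M) : Subgroup (CliffordAlgebra Q)ˣ where
  carrier := {g |
    ((g : CliffordAlgebra Q) ∈ CliffordAlgebra.even Q ∧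
      ((g⁻¹ : (CliffordAlgebra Q)ˣ) : CliffordAlgebra Q) ∈ CliffordAlgebra.even Q) ∧
    (∀ v : M, (g : CliffordAlgebra Q) * CliffordAlgebra.ι Q v *
      ((g⁻¹ : (CliffordAlgebra Q)ˣ) : CliffordAlgebra Q) ∈
        LinearMap.range (CliffordAlgebra.ι Q)) ∧
    (∀ v : M, ((g⁻¹ : (CliffordAlgebra Q)ˣ) : CliffordAlgebra Q) * CliffordAlgebra.ι Q v *
      (g : CliffordAlgebra Q) ∈ LinearMap.range (CliffordAlgebra.ι Q))}
  one_mem' := by simp [one_mem]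
  mul_mem' := by
    rintro a b ⟨⟨ha1, ha2⟩, ha3, ha4⟩ ⟨⟨hb1, hb2⟩, hb3, hb4⟩
    refine ⟨⟨?_, ?_⟩, fun v => ?_, fun v => ?_⟩
    · rw [Units.val_mul]
      exact mul_mem ha1 hb1
    · rw [mul_inv_rev, Units.val_mul]
      exact mul_mem hb2 ha2
    · obtain ⟨w, hw⟩ := hb3 v
      have h := ha3 w
      rw [hw] at h
      simpa [mul_inv_rev, mul_assoc] using h
    · obtain ⟨w, hw⟩ := ha4 v
      have h := hb4 w
      rw [hw] at h
      simpa [mul_inv_rev, mul_assoc] using h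
  inv_mem' := by
    rintro a ⟨⟨ha1, ha2⟩, ha3, ha4⟩
    refine ⟨⟨ha2, by simpa using ha1⟩, ha4, fun v => ?_⟩
    simpa using ha3 v

/-- The central cocharacter `𝔾ₘ → GSpin(Q)`, the kernel of `GSpin → SO`. -/
def scalar (Q : QuadraticForm R M) : Rˣ →* GSpin Q where
  toFun t := ⟨Units.map (algebraMap R (CliffordAlgebra Q)).toMonoidHom t, by
    refine ⟨⟨?_, ?_⟩, fun v => ?_, fun v => ?_⟩
    · exact Subalgebra.algebraMap_mem _ _
    · exact Subalgebra.algebraMap_mem _ _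
    · refine ⟨v, ?_⟩
      simp only [Units.coe_map, Units.coe_map_inv]
      change _ = algebraMap R _ (t : R) * _ * algebraMap R _ ((t⁻¹ : Rˣ) : R)
      rw [Algebra.commutes, mul_assoc, ← map_mul]
      simp
    · refine ⟨v, ?_⟩
      simp only [Units.coe_map, Units.coe_map_inv]
      change _ = algebraMap R _ ((t⁻¹ : Rˣ) : R) * _ * algebraMap R _ (t : R)
      rw [Algebra.commutes, mul_assoc, ← map_mul]
      simp⟩
  map_one' := by
    apply Subtype.ext
    simp
  map_mul' a b := by
    apply Subtype.ext
    simp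

/-- A hyperbolic pair: isotropic vectors `e`, `f` with `e f + f e = 1` in the Clifford algebra. -/
structure HypPair (Q : QuadraticForm R M) where
  e : M
  f : M
  isotropic_e : Q e = 0
  isotropic_f : Q f = 0
  polar_eq : QuadraticMap.polar Q e f = 1

namespace HypPair

variable {Q : QuadraticForm R M} (P : HypPair Q)

/-- The element `t • e f + f e` of the Clifford algebra. -/
def elt (t : R) : CliffordAlgebra Q :=
  t • (CliffordAlgebra.ι Q P.e * CliffordAlgebra.ι Q P.f) +
    CliffordAlgebra.ι Q P.f * CliffordAlgebra.ι Q P.e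

lemma sq_e : CliffordAlgebra.ι Q P.e * CliffordAlgebra.ι Q P.e = 0 := by
  rw [CliffordAlgebra.ι_sq_scalar, P.isotropic_e, map_zero]

lemma sq_f : CliffordAlgebra.ι Q P.f * CliffordAlgebra.ι Q P.f = 0 := by
  rw [CliffordAlgebra.ι_sq_scalar, P.isotropic_f, map_zero]

lemma anti : CliffordAlgebra.ι Q P.e * CliffordAlgebra.ι Q P.f +
    CliffordAlgebra.ι Q P.f * CliffordAlgebra.ι Q P.e = 1 := by
  rw [CliffordAlgebra.ι_mul_ι_add_swap, P.polar_eq, map_one]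

lemma efe : CliffordAlgebra.ι Q P.e * CliffordAlgebra.ι Q P.f * CliffordAlgebra.ι Q P.e =
    CliffordAlgebra.ι Q P.e := by
  have h := P.anti
  have h2 := congrArg (fun z => CliffordAlgebra.ι Q P.e * z) h
  simp only [mul_add, ← mul_assoc, P.sq_e, zero_mul, zero_add, mul_one] at h2
  exact h2

lemma fef : CliffordAlgebra.ι Q P.f * CliffordAlgebra.ι Q P.e * CliffordAlgebra.ι Q P.f =
    CliffordAlgebra.ι Q P.f := by
  have h := P.anti
  have h2 := congrArg (fun z => CliffordAlgebra.ι Q P.f * z) h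
  simp only [mul_add, ← mul_assoc, P.sq_f, zero_mul, add_zero, mul_one] at h2
  exact h2

lemma elt_one : P.elt 1 = 1 := by
  rw [elt, one_smul, P.anti]

lemma elt_mul (a b : R) : P.elt (a * b) = P.elt a * P.elt b := by
  have h1 := P.efe
  have h2 := P.fef
  have h3 := P.sq_e
  have h4 := P.sq_f
  simp only [elt]
  set x := CliffordAlgebra.ι Q P.e
  set y := CliffordAlgebra.ι Q P.f
  have k1 : x * y * (x * y) = x * y := by rw [← mul_assoc, h1]
  have k2 : y * x * (y * x) = y * x := by rw [← mul_assoc, h2]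
  have k3 : x * y * (y * x) = 0 := by rw [mul_assoc, ← mul_assoc y, h4, zero_mul, mul_zero]
  have k4 : y * x * (x * y) = 0 := by rw [mul_assoc, ← mul_assoc x, h3, zero_mul, mul_zero]
  simp only [add_mul, mul_add, smul_mul_assoc, mul_smul_comm, smul_smul, k1, k2, k3, k4,
    smul_zero, add_zero, zero_add, mul_comm b a]

lemma elt_conj {t s : R} (h : t * s = 1) (v : M) :
    P.elt t * CliffordAlgebra.ι Q v * P.elt s =
      CliffordAlgebra.ι Q (v + ((t - 1) * QuadraticMap.polar Q P.f v) • P.e +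
        ((s - 1) * QuadraticMap.polar Q P.e v) • P.f) := by
  have hm : P.elt t * P.elt s = 1 := by rw [← P.elt_mul, h, P.elt_one]
  have h1 := P.efe
  have h2 := P.fef
  have h3 := P.sq_e
  have h4 := P.sq_f
  have hα := CliffordAlgebra.ι_mul_ι_add_swap (Q := Q) P.e v
  have hβ := CliffordAlgebra.ι_mul_ι_add_swap (Q := Q) P.f v
  set α := QuadraticMap.polar Q P.e v
  set β := QuadraticMap.polar Q P.f v
  simp only [map_add, map_smul]
  rw [Algebra.algebraMap_eq_smul_one] at hα hβ
  have es : CliffordAlgebra.ι Q P.e * P.elt s = CliffordAlgebra.ι Q P.e := by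
    rw [elt, mul_add, mul_smul_comm, ← mul_assoc, h3, zero_mul, smul_zero, zero_add,
      ← mul_assoc, h1]
  have fs : CliffordAlgebra.ι Q P.f * P.elt s = s • CliffordAlgebra.ι Q P.f := by
    rw [elt, mul_add, mul_smul_comm, ← mul_assoc, h2, ← mul_assoc, h4, zero_mul, add_zero]
  have gv : P.elt t * CliffordAlgebra.ι Q v = CliffordAlgebra.ι Q v * P.elt t +
      ((t - 1) * β) • CliffordAlgebra.ι Q P.e + ((1 - t) * α) • CliffordAlgebra.ι Q P.f := by
    simp only [elt]
    set x := CliffordAlgebra.ι Q P.e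
    set y := CliffordAlgebra.ι Q P.f
    set w := CliffordAlgebra.ι Q v
    have a1 : x * w = α • 1 - w * x := eq_sub_of_add_eq hα
    have a2 : y * w = β • 1 - w * y := eq_sub_of_add_eq hβ
    have b1 : x * y * w = β • x - α • y + w * (x * y) := by
      rw [mul_assoc, a2, mul_sub, ← mul_assoc, a1, sub_mul, mul_smul_comm, mul_one,
        smul_mul_assoc, one_mul, mul_assoc]
      abel
    have b2 : y * x * w = α • y - β • x + w * (y * x) := by
      rw [mul_assoc, a1, mul_sub, ← mul_assoc, a2, sub_mul, mul_smul_comm, mul_one,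
        smul_mul_assoc, one_mul, mul_assoc]
      abel
    rw [add_mul, smul_mul_assoc, b1, b2, mul_add, mul_smul_comm]
    module
  rw [gv, add_mul, add_mul, smul_mul_assoc, smul_mul_assoc, es, fs, mul_assoc, hm, mul_one,
    smul_smul]
  have : (1 - t) * α * s = (s - 1) * α := by linear_combination (-α) * h
  rw [this]

lemma elt_mem_even (t : R) : P.elt t ∈ CliffordAlgebra.even Q :=
  add_mem (Subalgebra.smul_mem _ (CliffordAlgebra.ι_mul_ι_mem_evenOdd_zero Q _ _) t)
    (CliffordAlgebra.ι_mul_ι_mem_evenOdd_zero Q _ _)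

/-- The cocharacter `t ↦ t e f + f e` of `GSpin(Q)`. It acts on `V` by `t` on `e`, by `t⁻¹` on `f`
and trivially on the orthogonal complement. -/
def cochar : Rˣ →* GSpin Q where
  toFun t := ⟨⟨P.elt t, P.elt ((t⁻¹ : Rˣ) : R),
      by rw [← P.elt_mul, Units.mul_inv, P.elt_one],
      by rw [← P.elt_mul, Units.inv_mul, P.elt_one]⟩,
    ⟨P.elt_mem_even _, P.elt_mem_even _⟩,
    fun v => ⟨_, (P.elt_conj (Units.mul_inv t) v).symm⟩,
    fun v => ⟨_, (P.elt_conj (Units.inv_mul t) v).symm⟩⟩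
  map_one' := by
    apply Subtype.ext
    apply Units.ext
    simpa using P.elt_one
  map_mul' a b := by
    apply Subtype.ext
    apply Units.ext
    simpa using P.elt_mul a b

end HypPair

/-- The lattice `ℤ e₀ ⊕ ℤ e₁ ⊕ ⋯ ⊕ ℤ e_r`. The second component is indexed from `0`, so `e₁` is
`eVec 0`. It serves as cocharacter lattice (with basis `eᵢ^∨`) and as character lattice (with the
dual basis `eᵢ`). -/
abbrev Lat (r : ℕ) : Type := ℤ × (Fin r → ℤ)

/-- The basis vector with index zero (`e₀` or `e₀^∨`). -/
def eZero (r : ℕ) : Lat r := (1, 0)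

/-- The other basis vectors (`e_{i+1}` or `e_{i+1}^∨`). -/
def eVec {r : ℕ} (i : Fin r) : Lat r := (0, Pi.single i 1)

/-- The perfect pairing of characters and cocharacters. -/
def pairing {r : ℕ} (χ ν : Lat r) : ℤ := χ.1 * ν.1 + ∑ i, χ.2 i * ν.2 i

/-- The point `x(t)` of the cocharacter `x = x₀ e₀^∨ + ∑ xᵢ eᵢ^∨` of the torus of `GSpin(Q)` attached
to a family of (mutually orthogonal) hyperbolic pairs: `e₀^∨` is the central cocharacter and
`eᵢ^∨(t) = t eᵢ fᵢ + fᵢ eᵢ`. -/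
def torusCochar {Q : QuadraticForm R M} {r : ℕ} (P : Fin r → HypPair Q) (x : Lat r) (t : Rˣ) :
    GSpin Q :=
  scalar Q (t ^ x.1) * (List.ofFn fun i => (P i).cochar (t ^ x.2 i)).prod

end Clifford

/-! ### Part 2. The quasi-split non-split even quadratic space

The rank of the quadratic space is `2 n` with `n = m + 1`. -/

/-- Coordinates `(x, y, a, b)` on the quadratic space of rank `2 (m + 1)`. -/
abbrev Vec (m : ℕ) (R : Type*) : Type _ := (Fin m → R) × (Fin m → R) × R × R

/-- The quadratic form `∑ xᵢ yᵢ + a² - ε b²`: `m` hyperbolic planes and the norm form of `√ε`.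
For `p` odd and `ε` a non-square unit of `ℤ_p`, this is, up to isometry, the only self-dual
quadratic form of rank `2 (m + 1)` over `ℤ_p` which does not split over `ℚ_p`. -/
def form (m : ℕ) {R : Type*} [CommRing R] (ε : R) : QuadraticForm R (Vec m R) :=
  (∑ i : Fin m, QuadraticMap.linMulLin
      (LinearMap.proj i ∘ₗ LinearMap.fst R (Fin m → R) ((Fin m → R) × R × R))
      (LinearMap.proj i ∘ₗ LinearMap.fst R (Fin m → R) (R × R) ∘ₗ
        LinearMap.snd R (Fin m → R) ((Fin m → R) × R × R))) +
  QuadraticMap.linMulLin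
      (LinearMap.fst R R R ∘ₗ LinearMap.snd R (Fin m → R) (R × R) ∘ₗ
        LinearMap.snd R (Fin m → R) ((Fin m → R) × R × R))
      (LinearMap.fst R R R ∘ₗ LinearMap.snd R (Fin m → R) (R × R) ∘ₗ
        LinearMap.snd R (Fin m → R) ((Fin m → R) × R × R)) -
  ε • QuadraticMap.linMulLin
      (LinearMap.snd R R R ∘ₗ LinearMap.snd R (Fin m → R) (R × R) ∘ₗ
        LinearMap.snd R (Fin m → R) ((Fin m → R) × R × R))
      (LinearMap.snd R R R ∘ₗ LinearMap.snd R (Fin m → R) (R × R) ∘ₗ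
        LinearMap.snd R (Fin m → R) ((Fin m → R) × R × R))

lemma form_apply {m : ℕ} {R : Type*} [CommRing R] (ε : R) (v : Vec m R) :
    form m ε v = ∑ i, v.1 i * v.2.1 i + v.2.2.1 * v.2.2.1 - ε * (v.2.2.2 * v.2.2.2) := by
  simp [form]

/-- The `i`-th standard hyperbolic plane. -/
def stdPair {m : ℕ} {R : Type*} [CommRing R] (ε : R) (i : Fin m) : HypPair (form m ε) where
  e := (Pi.single i 1, 0, 0, 0)
  f := (0, Pi.single i 1, 0, 0)
  isotropic_e := by simp [form_apply]
  isotropic_f := by simp [form_apply]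
  polar_eq := by simp [QuadraticMap.polar, form_apply, Pi.single_apply]

/-- If `ε = d²`, then the norm plane is hyperbolic as well. The substitution `d ↦ -d` exchanges the
two vectors, that is, the Galois conjugate of `e_n^∨` is `e₀^∨ - e_n^∨`. -/
def lastPair (m : ℕ) {F : Type*} [Field F] [CharZero F] (ε : F) (d : Fˣ) (hd : (d : F) ^ 2 = ε) :
    HypPair (form m ε) where
  e := (0, 0, 2⁻¹, (2 * (d : F))⁻¹)
  f := (0, 0, 2⁻¹, -(2 * (d : F))⁻¹)
  isotropic_e := by
    have := d.ne_zero
    subst hd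
    simp only [form_apply]
    simp
    field_simp
    ring
  isotropic_f := by
    have := d.ne_zero
    subst hd
    simp only [form_apply]
    simp
    field_simp
    ring
  polar_eq := by
    have := d.ne_zero
    subst hd
    simp only [QuadraticMap.polar, form_apply]
    simp
    field_simp
    ring

/-- The family of hyperbolic pairs over a field containing `√ε`; the attached torus is the maximal
torus `T_Δ` of `GSpin`, with cocharacter lattice `X_*(T_Δ) = Lat (m + 1)`. -/
def splitPairs (m : ℕ) {F : Type*} [Field F] [CharZero F] (ε : F) (d : Fˣ)
    (hd : (d : F) ^ 2 = ε) : Fin (m + 1) → HypPair (form m ε) :=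
  Fin.snoc (α := fun _ => HypPair (form m ε)) (fun i => stdPair ε i) (lastPair m ε d hd)

/-- The Hodge cocharacter `μ(t) = diag(t, 1, …, 1, t⁻¹)` of `SO(V)`: `t` on `e₁`, `t⁻¹` on `f₁`. -/
def hodgeSO {m : ℕ} {F : Type*} [Field F] (i₁ : Fin m) (t : Fˣ) (v : Vec m F) : Vec m F :=
  (Function.update v.1 i₁ ((t : F) * v.1 i₁),
    Function.update v.2.1 i₁ (((t⁻¹ : Fˣ) : F) * v.2.1 i₁), v.2.2)

/-- The cocharacter `x` of `T_Δ` is the Kuga-Satake cocharacter: it lifts `μ` and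
its spinor norm is `t`. -/
def IsKugaSatake {m : ℕ} (hm : 0 < m) {F : Type*} [Field F] [CharZero F] (ε : F) (d : Fˣ)
    (hd : (d : F) ^ 2 = ε) (x : Lat (m + 1)) : Prop :=
  ∀ t : Fˣ,
    (∀ v : Vec m F,
      ((torusCochar (splitPairs m ε d hd) x t : (CliffordAlgebra (form m ε))ˣ) :
          CliffordAlgebra (form m ε)) *
        CliffordAlgebra.ι (form m ε) v *
        (((torusCochar (splitPairs m ε d hd) x t)⁻¹ : GSpin (form m ε)) :
          (CliffordAlgebra (form m ε))ˣ) =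
      CliffordAlgebra.ι (form m ε) (hodgeSO ⟨0, hm⟩ t v)) ∧
    CliffordAlgebra.reverse
        ((torusCochar (splitPairs m ε d hd) x t : (CliffordAlgebra (form m ε))ˣ) :
          CliffordAlgebra (form m ε)) *
      ((torusCochar (splitPairs m ε d hd) x t : (CliffordAlgebra (form m ε))ˣ) :
          CliffordAlgebra (form m ε)) =
      algebraMap F _ (t : F)

/-! ### Part 3. The root datum: `ρ`, the Galois action and the maximal split torus -/

/-- `ρ`, half the sum of the positive roots `eᵢ - eⱼ`, `eᵢ + eⱼ` (`i < j`). -/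
def rho (m : ℕ) : Lat (m + 1) := (0, fun i => (m : ℤ) - (i : ℤ))

lemma two_rho (m : ℕ) : (2 : ℤ) • rho m =
    ∑ i : Fin (m + 1), ∑ j ∈ Finset.Ioi i, ((eVec i - eVec j) + (eVec i + eVec j)) := by
  have h : ∀ i : Fin (m + 1), ∑ j ∈ Finset.Ioi i, ((eVec i - eVec j) + (eVec i + eVec j)) =
      (0, Pi.single i (2 * ((m : ℤ) - (i : ℤ)))) := by
    intro i
    have : ∀ j : Fin (m + 1), (eVec i - eVec j) + (eVec i + eVec j) = (2 : ℤ) • eVec i := by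
      intro j
      rw [two_smul]
      abel
    rw [Finset.sum_congr rfl fun j _ => this j, Finset.sum_const, Fin.card_Ioi]
    have hi := i.2
    simp only [eVec]
    ext k
    · simp
    · by_cases hk : k = i
      · subst hk
        simp
        rw [Nat.cast_sub (by omega)]
        ring
      · simp [hk]
  simp only [h]
  ext k
  · simp [rho, Prod.fst_sum]
  · simp [rho, Prod.snd_sum, Finset.sum_apply, Pi.single_apply]

/-- The action of the Frobenius on `X_*(T_Δ)`: `e_n^∨ ↦ e₀^∨ - e_n^∨`, and the other basis
vectors are fixed. -/
def galoisX {m : ℕ} (x : Lat (m + 1)) : Lat (m + 1) :=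
  (x.1 + x.2 (Fin.last m), Function.update x.2 (Fin.last m) (-x.2 (Fin.last m)))

/-- The Galois conjugation `√ε ↦ -√ε` acts on the cocharacters of the torus `T_Δ` of the
quasi-split group through `galoisX`. -/
lemma torusCochar_galoisX {m : ℕ} {F : Type*} [Field F] [CharZero F] (ε : F) (d : Fˣ)
    (hd : (d : F) ^ 2 = ε) (hd' : ((-d : Fˣ) : F) ^ 2 = ε) (x : Lat (m + 1)) (t : Fˣ) :
    torusCochar (splitPairs m ε (-d) hd') x t =
      torusCochar (splitPairs m ε d hd) (galoisX x) t := by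
  have key : ∀ a : Fˣ, (lastPair m ε (-d) hd').cochar a =
      scalar (form m ε) a * (lastPair m ε d hd).cochar a⁻¹ := by
    intro a
    have he : (lastPair m ε (-d) hd').e = (lastPair m ε d hd).f := by simp [lastPair]
    have hf : (lastPair m ε (-d) hd').f = (lastPair m ε d hd).e := by simp [lastPair]
    apply Subtype.ext
    apply Units.ext
    change (lastPair m ε (-d) hd').elt a =
      algebraMap F _ (a : F) * (lastPair m ε d hd).elt ((a⁻¹ : Fˣ) : F)
    rw [HypPair.elt, HypPair.elt, he, hf, ← Algebra.smul_def, smul_add, smul_smul,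
      Units.mul_inv, one_smul, add_comm]
  have hc : ∀ (a : Fˣ) (g : GSpin (form m ε)),
      scalar (form m ε) a * g = g * scalar (form m ε) a := by
    intro a g
    apply Subtype.ext
    apply Units.ext
    exact Algebra.commutes _ _
  simp only [torusCochar, splitPairs, galoisX, List.ofFn_succ', List.concat_eq_append,
    List.prod_append, List.prod_singleton, Fin.snoc_castSucc, Fin.snoc_last,
    Function.update_self, key]
  have hne : ∀ i : Fin m, Function.update x.2 (Fin.last m) (-x.2 (Fin.last m)) i.castSucc =
      x.2 i.castSucc := fun i => Function.update_of_ne (Fin.castSucc_ne_last i) _ _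
  simp only [hne, zpow_add, map_mul, zpow_neg, mul_assoc]
  congr 1
  rw [← mul_assoc, ← mul_assoc, hc]

/-- The inclusion `X_*(S) ⊆ X_*(T_Δ)`, where `S` is the maximal split torus and
`X_*(S) = Lat m` has basis `e₀^∨, …, e_{n-1}^∨`. -/
def inclS {m : ℕ} (ν : Lat m) : Lat (m + 1) := (ν.1, Fin.snoc (α := fun _ => ℤ) ν.2 0)

/-- `X_*(S)` is the lattice of Frobenius invariants in `X_*(T_Δ)`. -/
lemma galoisX_eq_iff {m : ℕ} (x : Lat (m + 1)) : galoisX x = x ↔ ∃ ν : Lat m, inclS ν = x := by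
  constructor
  · intro h
    have h1 : x.1 + x.2 (Fin.last m) = x.1 := congrArg Prod.fst h
    refine ⟨(x.1, fun i => x.2 i.castSucc), ?_⟩
    refine Prod.ext rfl ?_
    funext k
    refine Fin.lastCases ?_ (fun i => ?_) k
    · simp only [inclS, Fin.snoc_last]
      omega
    · simp only [inclS, Fin.snoc_castSucc]
  · rintro ⟨ν, rfl⟩
    refine Prod.ext ?_ ?_
    · simp [galoisX, inclS]
    · funext k
      refine Fin.lastCases ?_ (fun i => ?_) k
      · simp [galoisX, inclS]
      · simp [galoisX, inclS, Fin.castSucc_ne_last]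

/-! ### Part 4. The dual group `GSO_{2n}`, its L-group and highest weight representations -/

/-- Indices of the standard representation of `GSO_{2(m+1)}`: on the maximal torus, `inl i` has
weight `tᵢ` and `inr i` has weight `s tᵢ⁻¹`. -/
abbrev Idx (m : ℕ) : Type := Fin (m + 1) ⊕ Fin (m + 1)

/-- The Gram matrix of the symmetric form in which `inl i` and `inr i` are dual to each other. -/
def gram (m : ℕ) (k : Type*) [CommRing k] : Matrix (Idx m) (Idx m) k :=
  Matrix.fromBlocks 0 1 1 0

/-- `GSO_{2(m+1)}(k)`: similitudes of the form, with multiplier `c`, such that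
`det g = c ^ (m + 1)`. This is the dual group of the split group `GSpin_{2(m+1)}`. -/
def GSO (m : ℕ) (k : Type*) [Field k] : Subgroup (GL (Idx m) k) where
  carrier := {g | ∃ c : kˣ,
    (g : Matrix (Idx m) (Idx m) k).transpose * gram m k * (g : Matrix (Idx m) (Idx m) k) =
      (c : k) • gram m k ∧
    (g : Matrix (Idx m) (Idx m) k).det = (c : k) ^ (m + 1)}
  one_mem' := ⟨1, by simp, by simp⟩
  mul_mem' := by
    rintro a b ⟨c, hc, hc'⟩ ⟨d, hd, hd'⟩
    refine ⟨c * d, ?_, ?_⟩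
    · rw [Units.val_mul, Matrix.transpose_mul]
      calc _ = (b : Matrix (Idx m) (Idx m) k).transpose *
            ((a : Matrix (Idx m) (Idx m) k).transpose * gram m k *
              (a : Matrix (Idx m) (Idx m) k)) * (b : Matrix (Idx m) (Idx m) k) := by
            simp only [Matrix.mul_assoc]
        _ = _ := by
            rw [hc, Matrix.mul_smul, Matrix.smul_mul, hd, smul_smul, Units.val_mul]
    · rw [Units.val_mul, Matrix.det_mul, hc', hd', Units.val_mul, mul_pow]
  inv_mem' := by
    rintro a ⟨c, hc, hc'⟩
    have h1 : (a : Matrix (Idx m) (Idx m) k) * ((a⁻¹ : GL (Idx m) k) : Matrix (Idx m) (Idx m) k)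
        = 1 := by
      rw [← Units.val_mul, mul_inv_cancel, Units.val_one]
    have h2 : ((a⁻¹ : GL (Idx m) k) : Matrix (Idx m) (Idx m) k).transpose *
        (a : Matrix (Idx m) (Idx m) k).transpose = 1 := by
      rw [← Matrix.transpose_mul, h1, Matrix.transpose_one]
    refine ⟨c⁻¹, ?_, ?_⟩
    · have h3 : (c : k) • (((a⁻¹ : GL (Idx m) k) : Matrix (Idx m) (Idx m) k).transpose * gram m k *
          ((a⁻¹ : GL (Idx m) k) : Matrix (Idx m) (Idx m) k)) = gram m k := by
        rw [← Matrix.smul_mul, ← Matrix.mul_smul, ← hc]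
        calc _ = (((a⁻¹ : GL (Idx m) k) : Matrix (Idx m) (Idx m) k).transpose *
              (a : Matrix (Idx m) (Idx m) k).transpose) * gram m k *
              ((a : Matrix (Idx m) (Idx m) k) *
                ((a⁻¹ : GL (Idx m) k) : Matrix (Idx m) (Idx m) k)) := by
              simp only [Matrix.mul_assoc]
          _ = _ := by rw [h1, h2, Matrix.one_mul, Matrix.mul_one]
      conv_rhs => rw [← h3]
      rw [smul_smul, Units.inv_mul, one_smul]
    · have h4 := congrArg Matrix.det h1
      rw [Matrix.det_mul, hc', Matrix.det_one] at h4
      have h5 : (c : k) ^ (m + 1) ≠ 0 := pow_ne_zero _ c.ne_zero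
      rw [Units.val_inv_eq_inv_val, inv_pow]
      exact eq_inv_of_mul_eq_one_right h4

/-- The diagonal entries of the torus element with coordinates `(s, t₁, …, t_n)`. -/
def torusEntry {m : ℕ} {k : Type*} [Field k] (s : kˣ) (t : Fin (m + 1) → kˣ) : Idx m → kˣ :=
  Sum.elim t (fun i => s * (t i)⁻¹)

/-- The maximal torus of `GSO`: `diag(t₁, …, t_n, s t_n⁻¹, …, s t₁⁻¹)`. -/
def torus {m : ℕ} {k : Type*} [Field k] (s : kˣ) (t : Fin (m + 1) → kˣ) : GSO m k :=
  ⟨⟨Matrix.diagonal fun a => (torusEntry s t a : k),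
    Matrix.diagonal fun a => (((torusEntry s t a)⁻¹ : kˣ) : k),
    by simp [Matrix.diagonal_mul_diagonal],
    by simp [Matrix.diagonal_mul_diagonal]⟩, by
    refine ⟨s, ?_, ?_⟩
    · ext a b
      rcases a with a | a <;> rcases b with b | b <;>
        simp [gram, torusEntry, Matrix.one_apply]
      · split_ifs with hab
        · subst hab
          field_simp
        · rfl
      · split_ifs with hab
        · subst hab
          field_simp
        · rfl
    · change (Matrix.diagonal fun a => (torusEntry s t a : k)).det = _
      rw [Matrix.det_diagonal, Fintype.prod_sum_type]
      rw [← Finset.prod_mul_distrib]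
      simp [torusEntry, mul_left_comm]⟩

/-- The character of the maximal torus of `GSO` given by a cocharacter of `T_Δ`; `e₀^∨` becomes
`s` and `eᵢ^∨` becomes `tᵢ`. -/
def torusChar {m : ℕ} {k : Type*} [Field k] (x : Lat (m + 1)) (s : kˣ) (t : Fin (m + 1) → kˣ) :
    kˣ :=
  s ^ x.1 * ∏ i, t i ^ x.2 i

/-- The permutation matrix exchanging the two vectors of weights `t_n` and `s t_n⁻¹`. -/
def swapLast (m : ℕ) (k : Type*) [Field k] : GL (Idx m) k :=
  ⟨(Equiv.swap (Sum.inl (Fin.last m)) (Sum.inr (Fin.last m)) : Equiv.Perm (Idx m)).permMatrix k,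
   (Equiv.swap (Sum.inl (Fin.last m)) (Sum.inr (Fin.last m)) : Equiv.Perm (Idx m)).permMatrix k,
   by rw [← Matrix.permMatrix_mul]; simp,
   by rw [← Matrix.permMatrix_mul]; simp⟩

lemma swapLast_gram (m : ℕ) (k : Type*) [Field k] :
    (swapLast m k : Matrix (Idx m) (Idx m) k).transpose * gram m k *
      (swapLast m k : Matrix (Idx m) (Idx m) k) = gram m k := by
  change ((Equiv.swap (Sum.inl (Fin.last m)) (Sum.inr (Fin.last m)) :
      Equiv.Perm (Idx m)).permMatrix k).transpose * gram m k *
    (Equiv.swap (Sum.inl (Fin.last m)) (Sum.inr (Fin.last m)) :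
      Equiv.Perm (Idx m)).permMatrix k = gram m k
  rw [Matrix.transpose_permMatrix, Equiv.swap_inv, Equiv.Perm.permMatrix,
    PEquiv.toMatrix_toPEquiv_mul, PEquiv.mul_toMatrix_toPEquiv, Equiv.symm_swap]
  ext a b
  simp only [Matrix.submatrix_apply, id_eq, Equiv.swap_apply_def]
  rcases a with a | a <;> rcases b with b | b <;>
    by_cases ha : a = Fin.last m <;> by_cases hb : b = Fin.last m <;>
    simp [gram, Matrix.one_apply, ha, hb, eq_comm]

lemma swapLast_mul_self (m : ℕ) (k : Type*) [Field k] : swapLast m k * swapLast m k = 1 := by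
  apply Units.ext
  exact (swapLast m k).mul_inv

lemma swapLast_conj_mem (m : ℕ) (k : Type*) [Field k] {g : GL (Idx m) k} (hg : g ∈ GSO m k) :
    swapLast m k * g * swapLast m k ∈ GSO m k := by
  obtain ⟨c, hc, hc'⟩ := hg
  refine ⟨c, ?_, ?_⟩
  · simp only [Units.val_mul, Matrix.transpose_mul]
    calc _ = (swapLast m k : Matrix (Idx m) (Idx m) k).transpose *
          ((g : Matrix (Idx m) (Idx m) k).transpose *
            ((swapLast m k : Matrix (Idx m) (Idx m) k).transpose * gram m k *
              (swapLast m k : Matrix (Idx m) (Idx m) k)) * (g : Matrix (Idx m) (Idx m) k)) *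
          (swapLast m k : Matrix (Idx m) (Idx m) k) := by
          simp only [Matrix.mul_assoc]
      _ = _ := by
          rw [swapLast_gram, hc, Matrix.mul_smul, Matrix.smul_mul, swapLast_gram]
  · have h1 : (swapLast m k : Matrix (Idx m) (Idx m) k).det *
        (swapLast m k : Matrix (Idx m) (Idx m) k).det = 1 := by
      rw [← Matrix.det_mul, ← Units.val_mul, swapLast_mul_self, Units.val_one, Matrix.det_one]
    rw [Units.val_mul, Units.val_mul, Matrix.det_mul, Matrix.det_mul, hc', mul_right_comm, h1,
      one_mul]

/-- The action of the Frobenius `σ` on the dual group: the pinned outer automorphism of `GSO`,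
which is conjugation by the reflection `swapLast`. On the maximal torus it is
`t_n ↦ s t_n⁻¹`. -/
def frob (m : ℕ) (k : Type*) [Field k] : MulAut (GSO m k) where
  toFun g := ⟨swapLast m k * (g : GL (Idx m) k) * swapLast m k, swapLast_conj_mem m k g.2⟩
  invFun g := ⟨swapLast m k * (g : GL (Idx m) k) * swapLast m k, swapLast_conj_mem m k g.2⟩
  left_inv g := by
    apply Subtype.ext
    simp only [← mul_assoc, swapLast_mul_self, one_mul]
    simp only [mul_assoc, swapLast_mul_self, mul_one]
  right_inv g := by
    apply Subtype.ext
    simp only [← mul_assoc, swapLast_mul_self, one_mul]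
    simp only [mul_assoc, swapLast_mul_self, mul_one]
  map_mul' a b := by
    apply Subtype.ext
    simp only [Subgroup.coe_mul, mul_assoc]
    rw [← mul_assoc (swapLast m k) (swapLast m k), swapLast_mul_self, one_mul]

lemma frob_torus {m : ℕ} {k : Type*} [Field k] (s : kˣ) (t : Fin (m + 1) → kˣ) :
    frob m k (torus s t) =
      torus s (Function.update t (Fin.last m) (s * (t (Fin.last m))⁻¹)) := by
  apply Subtype.ext
  apply Units.ext
  change (Equiv.swap (Sum.inl (Fin.last m)) (Sum.inr (Fin.last m)) :
      Equiv.Perm (Idx m)).permMatrix k * (Matrix.diagonal fun a => (torusEntry s t a : k)) *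
    (Equiv.swap (Sum.inl (Fin.last m)) (Sum.inr (Fin.last m)) :
      Equiv.Perm (Idx m)).permMatrix k = Matrix.diagonal fun a => (torusEntry s _ a : k)
  rw [Equiv.Perm.permMatrix, PEquiv.toMatrix_toPEquiv_mul, PEquiv.mul_toMatrix_toPEquiv,
    Equiv.symm_swap]
  ext a b
  simp only [Matrix.submatrix_apply, id_eq, Equiv.swap_apply_def, torusEntry]
  rcases a with a | a <;> rcases b with b | b <;>
    by_cases ha : a = Fin.last m <;> by_cases hb : b = Fin.last m <;>
    by_cases hab : a = b <;>
    simp_all [Function.update_apply]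

/-- The unramified L-group `GSO(k) ⋊ ⟨σ⟩`, where `σ` is the Frobenius. -/
abbrev LGroup (m : ℕ) (k : Type*) [Field k] : Type _ :=
  GSO m k ⋊[zpowersHom (MulAut (GSO m k)) (frob m k)] Multiplicative ℤ

/-- The element `g ⋊ σ` of the L-group. -/
def withFrob {m : ℕ} {k : Type*} [Field k] (g : GSO m k) : LGroup m k :=
  ⟨g, Multiplicative.ofAdd 1⟩

/-- The place of a basis vector in the order `inl 0, …, inl m, inr m, …, inr 0`. -/
def place {m : ℕ} : Idx m → ℕ :=
  Sum.elim (fun i => (i : ℕ)) (fun i => 2 * m + 1 - (i : ℕ))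

/-- `g` lies in the unipotent radical of the Borel subgroup of upper triangular matrices of `GSO`.
The positive roots are `tᵢ / tⱼ` and `tᵢ tⱼ / s` for `i < j`. -/
def IsUpperUnipotent {m : ℕ} {k : Type*} [Field k] (g : GSO m k) : Prop :=
  ∀ a b : Idx m,
    (place b < place a → ((g : GL (Idx m) k) : Matrix (Idx m) (Idx m) k) a b = 0) ∧
    ((g : GL (Idx m) k) : Matrix (Idx m) (Idx m) k) a a = 1

section Rep

variable {m : ℕ} {k : Type u} [Field k] {V : Type v} [AddCommGroup V] [Module k V]

/-- `r` restricts to an algebraic representation of `GSO`: all matrix coefficients are regular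
functions, that is, polynomials in the entries of `g` and the inverse of `det g`. -/
def IsAlgebraic (r : Representation k (LGroup m k) V) : Prop :=
  ∀ (w : V) (φ : Module.Dual k V), ∃ P : MvPolynomial (Option (Idx m × Idx m)) k,
    ∀ g : GSO m k, φ (r (SemidirectProduct.inl g) w) =
      MvPolynomial.eval (fun o => o.elim
        ((((g : GL (Idx m) k) : Matrix (Idx m) (Idx m) k).det)⁻¹)
        (fun ab => ((g : GL (Idx m) k) : Matrix (Idx m) (Idx m) k) ab.1 ab.2)) P

/-- `r` is the extension to the L-group of the irreducible algebraic representation of `GSO` with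
highest weight `μ`, normalized so that `σ` acts trivially on the highest weight line. -/
structure IsHighestWeightRep (μ : Lat (m + 1)) (r : Representation k (LGroup m k) V) : Prop where
  algebraic : IsAlgebraic r
  irreducible : Representation.IsIrreducible
    (r.comp (SemidirectProduct.inl : GSO m k →* LGroup m k))
  highest : ∃ w : V, w ≠ 0 ∧
    (∀ g : GSO m k, IsUpperUnipotent g → r (SemidirectProduct.inl g) w = w) ∧
    (∀ (s : kˣ) (t : Fin (m + 1) → kˣ),
      r (SemidirectProduct.inl (torus s t)) w = (torusChar μ s t : k) • w) ∧
    r (withFrob 1) w = w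

/-- The weight space of weight `x`. -/
def weightSpace (r : Representation k (LGroup m k) V) (x : Lat (m + 1)) : Submodule k V :=
  ⨅ (s : kˣ) (t : Fin (m + 1) → kˣ),
    LinearMap.ker (r (SemidirectProduct.inl (torus s t)) - (torusChar x s t : k) • LinearMap.id)

/-- The value at `g` of the Hecke polynomial: `det (X - p^⟨μ, ρ⟩ r(g ⋊ σ))`. -/
def heckePolyAt (p : ℕ) (μ : Lat (m + 1)) (r : Representation k (LGroup m k) V)
    [Module.Finite k V] (g : GSO m k) : k[X] :=
  LinearMap.charpoly ((p : k) ^ pairing (rho m) μ • r (withFrob g))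

end Rep

/-! ### Part 5. The Hecke polynomial over `ℚ[X_*(S)]` -/

/-- The group algebra `ℚ[X_*(S)]`, that is, the Hecke algebra of the torus, or the regular functions on
the dual torus of `S`. -/
abbrev GroupAlg (m : ℕ) : Type := AddMonoidAlgebra ℚ (Lat m)

/-- The basis element `h_ν` of `ℚ[X_*(S)]`. -/
def hMon {m : ℕ} (ν : Lat m) : GroupAlg m := AddMonoidAlgebra.single ν 1

/-- Restriction of functions: the value of an element of `ℚ[X_*(S)]` at the point `(s, t)` of the
dual torus of `T_Δ`. -/
def evalTorus {m : ℕ} {k : Type*} [Field k] [CharZero k] (s : kˣ) (t : Fin (m + 1) → kˣ) :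
    GroupAlg m →ₐ[ℚ] k :=
  AddMonoidAlgebra.lift ℚ k (Lat m)
    { toFun := fun ν => (torusChar (inclS (Multiplicative.toAdd ν)) s t : k)
      map_one' := by simp [torusChar, inclS, Fin.prod_univ_castSucc]
      map_mul' := fun a b => by
        simp only [torusChar, inclS, Fin.prod_univ_castSucc, Fin.snoc_castSucc, Fin.snoc_last,
          toAdd_mul, Prod.fst_add, Prod.snd_add, Pi.add_apply, zpow_add, zpow_zero, mul_one,
          Finset.prod_mul_distrib, ← Units.val_mul]
        congr 1
        exact mul_mul_mul_comm _ _ _ _ }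

lemma pairing_rho_inclS {m : ℕ} (ν : Lat m) :
    pairing (rho m) (inclS ν) = ∑ i : Fin m, ((m : ℤ) - (i : ℤ)) * ν.2 i := by
  simp [pairing, rho, inclS, Fin.sum_univ_castSucc]

/-- The passage `h_ν ↦ p^(-⟨ρ, ν⟩) h_ν` from the ordinary action of the Weyl group on `ℚ[X_*(S)]` to
the dot action `w • h_ν = p^⟨ρ, ν - w ν⟩ h_{w ν}`, for which the image of the twisted Satake
transform is invariant. -/
def twist (p : ℕ) [Fact p.Prime] (m : ℕ) : GroupAlg m →ₐ[ℚ] GroupAlg m :=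
  AddMonoidAlgebra.lift ℚ (GroupAlg m) (Lat m)
    { toFun := fun ν => (p : ℚ) ^ (-pairing (rho m) (inclS (Multiplicative.toAdd ν))) •
        hMon (Multiplicative.toAdd ν)
      map_one' := by
        simp [pairing_rho_inclS, hMon, AddMonoidAlgebra.one_def]
      map_mul' := fun a b => by
        rw [smul_mul_smul_comm,
          ← zpow_add₀ (Nat.cast_ne_zero.mpr (Fact.out : p.Prime).ne_zero)]
        simp only [pairing_rho_inclS, hMon, AddMonoidAlgebra.single_mul_single, mul_one, toAdd_mul,
          Prod.snd_add, Pi.add_apply, mul_add, Finset.sum_add_distrib, neg_add] }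

/-- `H`, a polynomial with coefficients in `ℚ[X_*(S)]`, is the (untwisted) Hecke polynomial: it is
the restriction of `g ↦ det (X - p^⟨μ, ρ⟩ r(g ⋊ σ))` to the maximal torus. -/
def IsHeckePolynomial (p : ℕ) {m : ℕ} {k : Type u} [Field k] [CharZero k] {V : Type v}
    [AddCommGroup V] [Module k V] [Module.Finite k V] (μ : Lat (m + 1))
    (r : Representation k (LGroup m k) V) (H : (GroupAlg m)[X]) : Prop :=
  ∀ (s : kˣ) (t : Fin (m + 1) → kˣ),
    H.map (evalTorus s t : GroupAlg m →+* k) = heckePolyAt p μ r (torus s t)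

/-! ### Part 6. The Hecke algebra of `GSpin` over `ℚ_p` and the twisted Satake transform -/

section Satake

variable (p : ℕ) [Fact p.Prime] (m : ℕ) (ε : ℤ_[p]ˣ)

/-- The quadratic form over `ℤ_p`. -/
abbrev formZ : QuadraticForm ℤ_[p] (Vec m ℤ_[p]) := form m (ε : ℤ_[p])

/-- The quadratic form over `ℚ_p`. -/
abbrev formQ : QuadraticForm ℚ_[p] (Vec m ℚ_[p]) := form m ((ε : ℤ_[p]) : ℚ_[p])

/-- `GSpin(V)(ℚ_p)`. -/
abbrev GQ : Subgroup (CliffordAlgebra (formQ p m ε))ˣ := GSpin (formQ p m ε)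

/-- The inclusion of the lattice in the quadratic space. -/
def inclVec : Vec m ℤ_[p] →ₗ[ℤ_[p]] Vec m ℚ_[p] where
  toFun v := (fun i => (v.1 i : ℚ_[p]), fun i => (v.2.1 i : ℚ_[p]), (v.2.2.1 : ℚ_[p]),
    (v.2.2.2 : ℚ_[p]))
  map_add' a b := by
    ext <;> simp
  map_smul' c a := by
    ext <;> simp [Algebra.smul_def]

/-- The map `C(V_{ℤ_p}) → C(V_{ℚ_p})`. -/
def inclClifford :
    CliffordAlgebra (formZ p m ε) →ₐ[ℤ_[p]] CliffordAlgebra (formQ p m ε) :=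
  CliffordAlgebra.lift (formZ p m ε)
    ⟨(CliffordAlgebra.ι (formQ p m ε)).restrictScalars ℤ_[p] ∘ₗ inclVec p m, by
      intro v
      change CliffordAlgebra.ι (formQ p m ε) (inclVec p m v) *
        CliffordAlgebra.ι (formQ p m ε) (inclVec p m v) = _
      rw [CliffordAlgebra.ι_sq_scalar, IsScalarTower.algebraMap_apply ℤ_[p] ℚ_[p]]
      congr 1
      simp [form_apply, inclVec]⟩

/-- The hyperspecial subgroup `K_p`, the image of `GSpin(V)(ℤ_p)`. -/
def Kp : Subgroup (GQ p m ε) :=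
  ((GSpin (formZ p m ε)).map
    (Units.map (inclClifford p m ε).toRingHom.toMonoidHom)).subgroupOf (GQ p m ε)

/-- The group `U(ℚ_p)`, where `U` is the unipotent radical of the Borel subgroup stabilizing the flag
`⟨e₁⟩ ⊂ ⟨e₁, e₂⟩ ⊂ ⋯ ⊂ ⟨e₁, …, e_{n-1}⟩`. It is generated by the elements `1 + eᵢ w` with `w`
orthogonal to `e₁, …, eᵢ`. -/
def UQ : Subgroup (GQ p m ε) :=
  Subgroup.closure {g | ∃ (i : Fin m) (w : Vec m ℚ_[p]),
    (∀ j ≤ i, QuadraticMap.polar (formQ p m ε) (stdPair ((ε : ℤ_[p]) : ℚ_[p]) j).e w = 0) ∧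
    ((g : (CliffordAlgebra (formQ p m ε))ˣ) : CliffordAlgebra (formQ p m ε)) =
      1 + CliffordAlgebra.ι (formQ p m ε) (stdPair ((ε : ℤ_[p]) : ℚ_[p]) i).e *
        CliffordAlgebra.ι (formQ p m ε) w}

/-- The spherical Hecke algebra (as a `ℚ`-vector space): finitely supported functions on
`K_p \ GSpin(V)(ℚ_p) / K_p`. -/
abbrev HeckeAlg : Type :=
  DoubleCoset.Quotient (Kp p m ε : Set (GQ p m ε)) (Kp p m ε : Set (GQ p m ε)) →₀ ℚ

/-- The Hecke operator `K_p g K_p`. -/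
def heckeOp (g : GQ p m ε) : HeckeAlg p m ε :=
  Finsupp.single (DoubleCoset.mk (Kp p m ε) (Kp p m ε) g) 1

/-- The prime `p` as a unit of `ℚ_p`. -/
def pUnit : ℚ_[p]ˣ :=
  Units.mk0 (p : ℚ_[p]) (Nat.cast_ne_zero.mpr (Fact.out : p.Prime).ne_zero)

/-- The element `ν(p)` of `S(ℚ_p)`, for `ν` in `X_*(S)`. -/
def cocharAtP (ν : Lat m) : GQ p m ε :=
  torusCochar (fun i : Fin m => stdPair ((ε : ℤ_[p]) : ℚ_[p]) i) ν (pUnit p)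

/-- The twisted Satake transform `f ↦ (ν ↦ ∫_{U(ℚ_p)} f(u ν(p)) du)`, as a function on `X_*(S)`. The
measure on `U(ℚ_p)` is normalized by `vol(U ∩ K_p) = 1`. Since `f` is left invariant under `K_p`,
the integral is the sum of the values of `f` over the cosets `(U ∩ K_p) \ U`. -/
def satake (f : HeckeAlg p m ε) (ν : Lat m) : ℚ :=
  ∑ᶠ c : Quotient (QuotientGroup.rightRel ((Kp p m ε).subgroupOf (UQ p m ε))),
    Quotient.liftOn c
      (fun u => f (DoubleCoset.mk (Kp p m ε) (Kp p m ε) ((u : GQ p m ε) * cocharAtP p m ε ν)))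
      (by
        intro a b hab
        have hab' := QuotientGroup.rightRel_apply.mp hab
        rw [Subgroup.mem_subgroupOf] at hab'
        change f _ = f _
        congr 1
        refine (DoubleCoset.eq _ _ _ _).mpr ⟨_, hab', 1, one_mem _, ?_⟩
        simp [mul_assoc])

end Satake

end GSpinHecke

end

open GSpinHecke

/-!
The four parts of the theorem are independent of each other, except that the Hecke polynomial is read
off from the standard representation.

*The Kuga-Satake cocharacter.* The point `x(t)` of the torus multiplies `eᵢ` by `t ^ xᵢ`, and its spinor
norm is `t ^ (2 x₀ + ∑ xᵢ)`. Both are seen inside the Clifford algebra, whose scalars and vectors embed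
because `2` is invertible (`isKugaSatake_iff`).

*The representation.* The standard representation of `GSO`, with `σ` acting by the permutation matrix
that defines its action on `GSO`, has highest weight `e₁^∨` (`isHighestWeightRep_stdRep`). Any other
irreducible algebraic representation `V` with a highest weight vector `w` of this weight is isomorphic
to it, for the following reason. There is a nonzero functional `φ` on `V` invariant under the lower
unipotent matrices (`exists_lowerUnipotent_invariant`): it is a row of the lowest coefficient of the
matrix of a contracting one-parameter subgroup of the torus. On the big cell, which consists of products
of a lower unipotent, a diagonal and an upper unipotent element, the matrix coefficient
`g ↦ φ (g w)` is therefore equal to `φ(w) g₀₀`. The big cell is dense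
(`eval_coords_eq_zero_of_bigCell`): the proof does not use that `GSO` is irreducible as a variety, but
joins an arbitrary element to a scalar by a rational curve made of reflections. Hence
`φ (g w) = φ(w) g₀₀` for all `g`, which identifies the `GSO`-orbit of `w` with the orbit of the first
basis vector (`exists_equiv_standard`), and the action of `σ` is determined by its action on `w`
(`IsHighestWeightRep.exists_equiv_stdRep`).

*The Hecke polynomial.* On the standard representation `g ⋊ σ` is, for `g` in the torus, a block diagonal
matrix with blocks of size two, whence the determinant (`heckePolyAt_torus`). A polynomial over
`ℚ[X_*(S)]` is determined by its values on the torus because distinct characters are linearly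
independent (`eq_of_evalTorus_eq`).

*The Satake transform.* If `u ν(p) ∈ p K_p` with `u ∈ U(ℚ_p)`, then `u ν(p) p⁻¹` and its inverse preserve
the lattice; since `u` is unitriangular on the isotropic flag, the coordinates of `ν` with index at
least `1` vanish. Then the spinor norm of `u ν(p) p⁻¹` is an even power of `p` which is, together with its
inverse, integral over `ℤ_p`, because the Clifford algebra of the lattice is a finite `ℤ_p`-module. So
`ν = e₀^∨` (`eq_eZero_of_mem_Kp`), and then `u` lies in `K_p`.
-/

noncomputable section

namespace GSpinHecke

/-! ### Action and spinor norm of the torus of `GSpin` -/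

section TorusAction

variable {R : Type*} [CommRing R] {M : Type*} [AddCommGroup M] [Module R M]
  {Q : QuadraticForm R M}

lemma coe_mul_GSpin (g h : GSpin Q) :
    (((g * h : GSpin Q) : (CliffordAlgebra Q)ˣ) : CliffordAlgebra Q) =
      ((g : (CliffordAlgebra Q)ˣ) : CliffordAlgebra Q) *
        ((h : (CliffordAlgebra Q)ˣ) : CliffordAlgebra Q) := by
  rw [Subgroup.coe_mul, Units.val_mul]

/-- The element `g` of `GSpin(Q)` maps the vector `v` to `v'`, written without inverses:
`g v = v' g` in the Clifford algebra. -/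
def Maps (g : GSpin Q) (v v' : M) : Prop :=
  ((g : (CliffordAlgebra Q)ˣ) : CliffordAlgebra Q) * CliffordAlgebra.ι Q v =
    CliffordAlgebra.ι Q v' * ((g : (CliffordAlgebra Q)ˣ) : CliffordAlgebra Q)

lemma Maps.one (v : M) : Maps (1 : GSpin Q) v v := by simp [Maps]

lemma Maps.mul {g h : GSpin Q} {v v' v'' : M} (hg : Maps g v' v'') (hh : Maps h v v') :
    Maps (g * h) v v'' := by
  unfold Maps at *
  rw [coe_mul_GSpin, mul_assoc, hh, ← mul_assoc, hg, mul_assoc]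

lemma maps_iff (g : GSpin Q) (v v' : M) :
    Maps g v v' ↔ ((g : (CliffordAlgebra Q)ˣ) : CliffordAlgebra Q) * CliffordAlgebra.ι Q v *
      (((g⁻¹ : GSpin Q) : (CliffordAlgebra Q)ˣ) : CliffordAlgebra Q) =
        CliffordAlgebra.ι Q v' := by
  rw [Subgroup.coe_inv]
  exact (Units.mul_inv_eq_iff_eq_mul (g : (CliffordAlgebra Q)ˣ)).symm

lemma Maps.smul {g : GSpin Q} {v v' : M} (h : Maps g v v') (c : R) : Maps g (c • v) (c • v') := by
  unfold Maps at *
  rw [map_smul, map_smul, mul_smul_comm, smul_mul_assoc, h]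

lemma maps_scalar (t : Rˣ) (v : M) : Maps (scalar Q t) v v :=
  Algebra.commutes _ _

lemma HypPair.maps_cochar (P : HypPair Q) (t : Rˣ) (v : M) :
    Maps (P.cochar t) v (v + (((t : R) - 1) * QuadraticMap.polar Q P.f v) • P.e +
        ((((t⁻¹ : Rˣ) : R) - 1) * QuadraticMap.polar Q P.e v) • P.f) := by
  rw [maps_iff, Subgroup.coe_inv]
  exact P.elt_conj (Units.mul_inv t) v

/-- `g` has spinor norm `c`. -/
def HasSpinorNorm (g : GSpin Q) (c : R) : Prop :=
  CliffordAlgebra.reverse ((g : (CliffordAlgebra Q)ˣ) : CliffordAlgebra Q) *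
    ((g : (CliffordAlgebra Q)ˣ) : CliffordAlgebra Q) = algebraMap R _ c

lemma HasSpinorNorm.one : HasSpinorNorm (1 : GSpin Q) 1 := by simp [HasSpinorNorm]

lemma HasSpinorNorm.mul {g h : GSpin Q} {c d : R} (hg : HasSpinorNorm g c)
    (hh : HasSpinorNorm h d) : HasSpinorNorm (g * h) (c * d) := by
  unfold HasSpinorNorm at *
  rw [coe_mul_GSpin, CliffordAlgebra.reverse.map_mul, mul_assoc, ← mul_assoc (CliffordAlgebra.reverse _) _
    ((h : (CliffordAlgebra Q)ˣ) : CliffordAlgebra Q), hg, Algebra.commutes, ← mul_assoc, hh, map_mul,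
    Algebra.commutes]

lemma hasSpinorNorm_scalar (t : Rˣ) : HasSpinorNorm (scalar Q t) ((t : R) * t) := by
  change CliffordAlgebra.reverse (algebraMap R (CliffordAlgebra Q) t) *
    algebraMap R (CliffordAlgebra Q) t = _
  rw [CliffordAlgebra.reverse.commutes, map_mul]

lemma HypPair.hasSpinorNorm_cochar (P : HypPair Q) (t : Rˣ) :
    HasSpinorNorm (P.cochar t) (t : R) := by
  change CliffordAlgebra.reverse (P.elt t) * P.elt t = _
  have h1 := P.efe
  have h2 := P.fef
  have h3 := P.sq_e
  have h4 := P.sq_f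
  have h5 := P.anti
  simp only [elt, map_add, map_smul, CliffordAlgebra.reverse.map_mul, CliffordAlgebra.reverse_ι]
  rw [Algebra.algebraMap_eq_smul_one, ← h5]
  set x := CliffordAlgebra.ι Q P.e
  set y := CliffordAlgebra.ι Q P.f
  have k1 : x * y * (x * y) = x * y := by rw [← mul_assoc, h1]
  have k2 : y * x * (y * x) = y * x := by rw [← mul_assoc, h2]
  have k3 : x * y * (y * x) = 0 := by rw [mul_assoc, ← mul_assoc y, h4, zero_mul, mul_zero]
  have k4 : y * x * (x * y) = 0 := by rw [mul_assoc, ← mul_assoc x, h3, zero_mul, mul_zero]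
  simp only [add_mul, mul_add, smul_mul_assoc, mul_smul_comm, k1, k2, k3, k4,
    smul_zero, add_zero, zero_add, smul_add]

lemma HasSpinorNorm.list_prod {l : List (GSpin Q)} {c : List R}
    (h : List.Forall₂ HasSpinorNorm l c) : HasSpinorNorm l.prod c.prod := by
  induction h with
  | nil => simpa using HasSpinorNorm.one
  | cons h _ ih => simpa using h.mul ih

lemma Maps.list_prod {l : List (GSpin Q)} {c : List R} {v : M}
    (h : List.Forall₂ (fun g a => Maps g v (a • v)) l c) : Maps l.prod v (c.prod • v) := by
  induction h with
  | nil => simpa using Maps.one v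
  | @cons g a l c h _ ih =>
    have := (h.smul c.prod).mul ih
    simpa [smul_smul, mul_comm] using this

lemma forall₂_ofFn {α β : Type*} {S : α → β → Prop} {r : ℕ} (f : Fin r → α) (g : Fin r → β)
    (h : ∀ i, S (f i) (g i)) : List.Forall₂ S (List.ofFn f) (List.ofFn g) := by
  rw [List.forall₂_iff_get]
  exact ⟨by simp, fun i h1 h2 => by simpa using h _⟩

lemma hasSpinorNorm_torusCochar {r : ℕ} (P : Fin r → HypPair Q) (x : Lat r) (t : Rˣ) :
    HasSpinorNorm (torusCochar P x t) ((t ^ (2 * x.1 + ∑ i, x.2 i) : Rˣ) : R) := by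
  have h := (hasSpinorNorm_scalar (Q := Q) (t ^ x.1)).mul
    (HasSpinorNorm.list_prod (forall₂_ofFn (fun i => (P i).cochar (t ^ x.2 i))
      (fun i => ((t ^ x.2 i : Rˣ) : R)) fun i => (P i).hasSpinorNorm_cochar _))
  have e : ((t ^ (2 * x.1 + ∑ i, x.2 i) : Rˣ) : R) = ((t ^ x.1 : Rˣ) : R) * ((t ^ x.1 : Rˣ) : R) *
      (List.ofFn fun i => ((t ^ x.2 i : Rˣ) : R)).prod := by
    have h2 : t ^ (∑ i, x.2 i) = ∏ i, t ^ x.2 i := by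
      induction (Finset.univ : Finset (Fin r)) using Finset.induction_on with
      | empty => simp
      | insert a s ha ih => rw [Finset.sum_insert ha, Finset.prod_insert ha, zpow_add, ih]
    rw [List.prod_ofFn, zpow_add, two_mul, zpow_add, h2]
    simp
  rw [e]
  exact h

/-- Orthogonality of the vectors `e` of a family of hyperbolic pairs to the vectors of the other
pairs. This is the part of mutual orthogonality that the action on the vectors `e` depends on. -/
structure IsOrthogonalFamily {r : ℕ} (P : Fin r → HypPair Q) : Prop where
  ee : ∀ i j, i ≠ j → QuadraticMap.polar Q (P i).e (P j).e = 0
  fe : ∀ i j, i ≠ j → QuadraticMap.polar Q (P i).f (P j).e = 0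

lemma HypPair.maps_cochar_e (P : HypPair Q) (t : Rˣ) : Maps (P.cochar t) P.e ((t : R) • P.e) := by
  have h := P.maps_cochar t P.e
  rw [QuadraticMap.polar_comm, P.polar_eq, QuadraticMap.polar_self, P.isotropic_e] at h
  convert h using 1
  rw [smul_zero, mul_zero, zero_smul, add_zero, mul_one, sub_smul, one_smul]
  abel

lemma HypPair.maps_cochar_of_orthogonal (P : HypPair Q) (t : Rˣ) {v : M}
    (he : QuadraticMap.polar Q P.e v = 0) (hf : QuadraticMap.polar Q P.f v = 0) :
    Maps (P.cochar t) v v := by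
  have h := P.maps_cochar t v
  rw [he, hf] at h
  simpa using h

lemma maps_torusCochar_e {r : ℕ} {P : Fin r → HypPair Q} (hP : IsOrthogonalFamily P) (x : Lat r)
    (t : Rˣ) (j : Fin r) :
    Maps (torusCochar P x t) (P j).e (((t ^ x.2 j : Rˣ) : R) • (P j).e) := by
  have h := (maps_scalar (Q := Q) (t ^ x.1) _).mul
    (Maps.list_prod (v := (P j).e) (forall₂_ofFn (fun i => (P i).cochar (t ^ x.2 i))
      (fun i => if i = j then ((t ^ x.2 i : Rˣ) : R) else 1) fun i => by
        by_cases hij : i = j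
        · subst hij
          simpa only [if_true] using (P i).maps_cochar_e _
        · simpa only [hij, if_false, one_smul] using
            (P i).maps_cochar_of_orthogonal _ (hP.ee i j hij) (hP.fe i j hij)))
  rw [List.prod_ofFn, Finset.prod_ite_eq' Finset.univ j, if_pos (Finset.mem_univ j)] at h
  exact h

lemma torusCochar_eVec {r : ℕ} (P : Fin r → HypPair Q) (i : Fin r) (t : Rˣ) :
    torusCochar P (eVec i) t = (P i).cochar t := by
  have h : ∀ (l : List (Fin r)), l.Nodup →
      (l.map fun j => (P j).cochar (t ^ (eVec i).2 j)).prod =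
        if i ∈ l then (P i).cochar t else 1 := by
    intro l
    induction l with
    | nil => simp
    | cons a l ih =>
      intro hl
      rw [List.nodup_cons] at hl
      rw [List.map_cons, List.prod_cons, ih hl.2]
      by_cases ha : a = i
      · subst ha
        simp [hl.1, eVec]
      · have ha' : i ≠ a := fun h => ha h.symm
        simp [eVec, ha, ha']
  rw [torusCochar, List.ofFn_eq_map, h _ (List.nodup_finRange r)]
  simp [eVec]

end TorusAction

lemma ι_injective_of_invertible {R : Type*} [CommRing R] {M : Type*} [AddCommGroup M] [Module R M]
    (Q : QuadraticForm R M) [Invertible (2 : R)] :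
    Function.Injective (CliffordAlgebra.ι Q) := by
  intro a b h
  have := congrArg (CliffordAlgebra.equivExterior Q) h
  simp only [CliffordAlgebra.equivExterior, CliffordAlgebra.changeFormEquiv_apply,
    CliffordAlgebra.changeForm_ι] at this
  exact ExteriorAlgebra.ι_leftInverse.injective this

lemma algebraMap_injective_of_invertible {R : Type*} [CommRing R] {M : Type*} [AddCommGroup M]
    [Module R M] (Q : QuadraticForm R M) [Invertible (2 : R)] :
    Function.Injective (algebraMap R (CliffordAlgebra Q)) := by
  intro a b h
  have := congrArg (CliffordAlgebra.equivExterior Q) h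
  simp only [CliffordAlgebra.equivExterior, CliffordAlgebra.changeFormEquiv_apply,
    CliffordAlgebra.changeForm_algebraMap] at this
  exact ExteriorAlgebra.algebraMap_leftInverse M |>.injective this

/-! ### The Kuga-Satake cocharacter -/

section KugaSatake

variable {m : ℕ}

lemma polar_form {R : Type*} [CommRing R] (ε : R) (v w : Vec m R) :
    QuadraticMap.polar (form m ε) v w = ∑ i, (v.1 i * w.2.1 i + w.1 i * v.2.1 i) +
      2 * (v.2.2.1 * w.2.2.1) - 2 * ε * (v.2.2.2 * w.2.2.2) := by
  simp only [QuadraticMap.polar, form_apply, Prod.fst_add, Prod.snd_add, Pi.add_apply, add_mul,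
    mul_add, Finset.sum_add_distrib]
  ring

lemma isOrthogonalFamily_stdPair {R : Type*} [CommRing R] (ε : R) :
    IsOrthogonalFamily (fun i : Fin m => stdPair ε i) where
  ee i j hij := by simp [polar_form, stdPair]
  fe i j hij := by
    simp [polar_form, stdPair, Pi.single_apply]
    exact fun h => absurd h hij

variable {F : Type*} [Field F] [CharZero F]

lemma isOrthogonalFamily_splitPairs (ε : F) (d : Fˣ) (hd : (d : F) ^ 2 = ε) :
    IsOrthogonalFamily (splitPairs m ε d hd) where
  ee i j := by
    refine Fin.lastCases ?_ (fun i => ?_) i <;> refine Fin.lastCases ?_ (fun j => ?_) j <;>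
      simp [splitPairs, polar_form, stdPair, lastPair]
  fe i j := by
    refine Fin.lastCases ?_ (fun i => ?_) i <;> refine Fin.lastCases ?_ (fun j => ?_) j <;>
      simp [splitPairs, polar_form, stdPair, lastPair, Pi.single_apply]

lemma HypPair.e_ne_zero {R : Type*} [CommRing R] [Nontrivial R] {M : Type*} [AddCommGroup M]
    [Module R M] {Q : QuadraticForm R M} (P : HypPair Q) : P.e ≠ 0 := by
  intro h
  have := P.polar_eq
  rw [h, QuadraticMap.polar_zero_left] at this
  exact zero_ne_one this

lemma two_zpow_injective {a b : ℤ} (h : (2 : F) ^ a = 2 ^ b) : a = b := by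
  have h' : (2 : ℚ) ^ a = 2 ^ b := by exact_mod_cast (algebraMap ℚ F).injective (by simpa using h)
  exact zpow_right_injective₀ (by norm_num) (by norm_num) h'

/-- The action on the vectors `e` determines the coordinates with index `i ≥ 1`, and then the spinor
norm `t ^ (2 x₀ + ∑ xᵢ) = t` determines `x₀`. -/
theorem isKugaSatake_iff (hm : 0 < m) (ε : F) (d : Fˣ) (hd : (d : F) ^ 2 = ε)
    (x : Lat (m + 1)) : IsKugaSatake hm ε d hd x ↔ x = eVec 0 := by
  let _ : Invertible (2 : F) := invertibleOfNonzero two_ne_zero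
  have h0 : (0 : Fin (m + 1)) = Fin.castSucc ⟨0, hm⟩ := rfl
  have hP0 : splitPairs m ε d hd 0 = stdPair ε ⟨0, hm⟩ := by
    rw [h0, splitPairs, Fin.snoc_castSucc]
  constructor
  · intro h
    -- The powers of `2` are distinct in characteristic zero, so the point `t = 2` suffices.
    obtain ⟨h1, h2⟩ := h (Units.mk0 2 two_ne_zero)
    set t : Fˣ := Units.mk0 2 two_ne_zero
    have hx : ∀ j, x.2 j = if j = 0 then 1 else 0 := by
      intro j
      have a1 := (maps_iff _ _ _).mp
        (maps_torusCochar_e (isOrthogonalFamily_splitPairs (m := m) ε d hd) x t j)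
      rw [h1] at a1
      have a2 := ι_injective_of_invertible _ a1
      apply two_zpow_injective (F := F)
      have a3 : hodgeSO ⟨0, hm⟩ t (splitPairs m ε d hd j).e =
          ((2 : F) ^ (if j = 0 then (1 : ℤ) else 0)) • (splitPairs m ε d hd j).e := by
        by_cases hj : j = 0
        · subst hj
          rw [hP0]
          simp [hodgeSO, stdPair, t, Pi.single, Function.update_eq_iff, Prod.ext_iff]
          intro i hi
          simp [hi]
        · rw [if_neg hj]
          revert hj
          refine Fin.lastCases ?_ (fun j => ?_) j
          · intro _
            simp [splitPairs, hodgeSO, lastPair]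
          · intro hj
            have hj' : (⟨0, hm⟩ : Fin m) ≠ j := by
              rintro rfl
              exact hj rfl
            simp [splitPairs, hodgeSO, stdPair, hj']
      rw [a3] at a2
      have a4 := smul_left_injective F (HypPair.e_ne_zero (splitPairs m ε d hd j)) a2
      simpa [t] using a4.symm
    have hs : (2 : F) ^ (2 * x.1 + ∑ i, x.2 i) = 2 ^ (1 : ℤ) := by
      have b1 := hasSpinorNorm_torusCochar (splitPairs m ε d hd) x t
      unfold HasSpinorNorm at b1
      rw [h2] at b1
      have b2 := algebraMap_injective_of_invertible _ b1
      simpa [t] using b2.symm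
    have hs' := two_zpow_injective hs
    simp only [hx, Finset.sum_ite_eq', Finset.mem_univ, if_true] at hs'
    refine Prod.ext ?_ ?_
    · simp only [eVec]
      omega
    · ext j
      simp [hx, eVec, Pi.single_apply]
  · rintro rfl t
    rw [torusCochar_eVec]
    refine ⟨fun v => ?_, ?_⟩
    · refine (maps_iff _ _ _).mp ?_
      have h := (splitPairs m ε d hd 0).maps_cochar t v
      rw [hP0] at h ⊢
      convert h using 1
      simp only [hodgeSO, stdPair, polar_form]
      refine Prod.ext ?_ (Prod.ext ?_ ?_)
      · ext i
        by_cases hi : i = ⟨0, hm⟩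
        · subst hi
          simp [Pi.single_apply]
          ring
        · simp [hi]
      · ext i
        by_cases hi : i = ⟨0, hm⟩
        · subst hi
          simp [Pi.single_apply]
          ring
        · simp [hi]
      · exact Prod.ext (by simp) (by simp)
    · exact (splitPairs m ε d hd 0).hasSpinorNorm_cochar t

end KugaSatake

/-! ### Unipotent elements of `GSpin` and the isotropic flag -/

section Upper

variable {R : Type*} [CommRing R] {M : Type*} [AddCommGroup M] [Module R M]
  {Q : QuadraticForm R M}

lemma Maps.inv {g : GSpin Q} {v v' : M} (h : Maps g v v') : Maps g⁻¹ v' v := by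
  rw [maps_iff] at h
  unfold Maps
  rw [← h, ← mul_assoc, ← mul_assoc, Subgroup.coe_inv, Units.inv_mul, one_mul]

lemma Maps.zero (g : GSpin Q) : Maps g 0 0 := by simp [Maps]

lemma Maps.add {g : GSpin Q} {v v' w w' : M} (h : Maps g v v') (h' : Maps g w w') :
    Maps g (v + w) (v' + w') := by
  unfold Maps at *
  rw [map_add, map_add, mul_add, add_mul, h, h']

lemma Maps.sum {ι : Type*} {g : GSpin Q} {f f' : ι → M} (s : Finset ι)
    (h : ∀ i, Maps g (f i) (f' i)) : Maps g (∑ i ∈ s, f i) (∑ i ∈ s, f' i) := by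
  classical
  induction s using Finset.induction_on with
  | empty => simpa using Maps.zero g
  | insert a s ha ih =>
    rw [Finset.sum_insert ha, Finset.sum_insert ha]
    exact (h a).add ih

lemma HasSpinorNorm.inv {g : GSpin Q} {c d : R} (h : HasSpinorNorm g c) (hd : d * c = 1) :
    HasSpinorNorm g⁻¹ d := by
  unfold HasSpinorNorm at *
  have hi : (((g⁻¹ : GSpin Q) : (CliffordAlgebra Q)ˣ) : CliffordAlgebra Q) =
      d • CliffordAlgebra.reverse ((g : (CliffordAlgebra Q)ˣ) : CliffordAlgebra Q) := by
    rw [Subgroup.coe_inv]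
    refine Units.inv_eq_of_mul_eq_one_left ?_
    rw [smul_mul_assoc, h, Algebra.smul_def, ← map_mul, hd, map_one]
  have hr : CliffordAlgebra.reverse
      (((g⁻¹ : GSpin Q) : (CliffordAlgebra Q)ˣ) : CliffordAlgebra Q) =
      d • ((g : (CliffordAlgebra Q)ˣ) : CliffordAlgebra Q) := by
    rw [hi, map_smul, CliffordAlgebra.reverse_reverse]
  rw [hr, Subgroup.coe_inv, smul_mul_assoc, Units.mul_inv, Algebra.algebraMap_eq_smul_one]

/-- Two orthogonal vectors `e`, `w` with `e` isotropic: the inverse of `1 + e w` is `1 - e w`. -/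
lemma one_add_mul_one_sub {e w : M} (he : Q e = 0) (hew : QuadraticMap.polar Q e w = 0) :
    (1 + CliffordAlgebra.ι Q e * CliffordAlgebra.ι Q w) *
      (1 - CliffordAlgebra.ι Q e * CliffordAlgebra.ι Q w) = 1 := by
  have h1 := CliffordAlgebra.ι_mul_ι_add_swap (Q := Q) e w
  rw [hew, map_zero] at h1
  have h2 := CliffordAlgebra.ι_sq_scalar Q e
  rw [he, map_zero] at h2
  set x := CliffordAlgebra.ι Q e
  set y := CliffordAlgebra.ι Q w
  have h3 : x * y = -(y * x) := eq_neg_of_add_eq_zero_left h1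
  have h4 : x * y * (x * y) = 0 := by
    rw [h3, neg_mul_neg, mul_assoc, ← mul_assoc x, h3, neg_mul, mul_assoc, h2]
    simp
  rw [add_mul, one_mul, mul_sub, mul_one, h4]
  abel

/-- The action of `1 + e w` on a vector orthogonal to `e`. -/
lemma maps_one_add {g : GSpin Q} {e w : M} (he : Q e = 0)
    (hg : ((g : (CliffordAlgebra Q)ˣ) : CliffordAlgebra Q) =
      1 + CliffordAlgebra.ι Q e * CliffordAlgebra.ι Q w) {v : M}
    (hv : QuadraticMap.polar Q e v = 0) : Maps g v (v + QuadraticMap.polar Q w v • e) := by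
  unfold Maps
  rw [hg]
  have h1 := CliffordAlgebra.ι_mul_ι_add_swap (Q := Q) e v
  have h3 := CliffordAlgebra.ι_mul_ι_add_swap (Q := Q) w v
  rw [hv, map_zero] at h1
  have h2 := CliffordAlgebra.ι_sq_scalar Q e
  rw [he, map_zero] at h2
  rw [map_add, map_smul]
  rw [Algebra.algebraMap_eq_smul_one] at h3
  set x := CliffordAlgebra.ι Q e
  set y := CliffordAlgebra.ι Q w
  set z := CliffordAlgebra.ι Q v
  have a1 : y * z = QuadraticMap.polar Q w v • 1 - z * y := eq_sub_of_add_eq h3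
  have a2 : x * z = -(z * x) := eq_neg_of_add_eq_zero_left h1
  have a3 : x * y * z = QuadraticMap.polar Q w v • x + z * (x * y) := by
    rw [mul_assoc, a1, mul_sub, ← mul_assoc x z, a2, mul_smul_comm, mul_one, neg_mul,
      sub_neg_eq_add, mul_assoc]
  rw [add_mul, one_mul, a3, add_mul, mul_add, mul_add, mul_one, mul_one, smul_mul_assoc,
    ← mul_assoc x x, h2, zero_mul, smul_zero]
  abel

lemma hasSpinorNorm_one_add {g : GSpin Q} {e w : M} (he : Q e = 0)
    (hew : QuadraticMap.polar Q e w = 0)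
    (hg : ((g : (CliffordAlgebra Q)ˣ) : CliffordAlgebra Q) =
      1 + CliffordAlgebra.ι Q e * CliffordAlgebra.ι Q w) : HasSpinorNorm g 1 := by
  unfold HasSpinorNorm
  have h0 := CliffordAlgebra.ι_mul_ι_add_swap (Q := Q) e w
  rw [hew, map_zero] at h0
  have h1 := one_add_mul_one_sub he hew
  rw [hg, map_add, CliffordAlgebra.reverse.map_one, CliffordAlgebra.reverse.map_mul,
    CliffordAlgebra.reverse_ι, CliffordAlgebra.reverse_ι, map_one,
    eq_neg_of_add_eq_zero_right h0]
  have h2 : (1 + -(CliffordAlgebra.ι Q e * CliffordAlgebra.ι Q w)) *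
      (1 + CliffordAlgebra.ι Q e * CliffordAlgebra.ι Q w) =
    (1 + CliffordAlgebra.ι Q e * CliffordAlgebra.ι Q w) *
      (1 - CliffordAlgebra.ι Q e * CliffordAlgebra.ι Q w) := by noncomm_ring
  rw [h2, h1]

variable {m : ℕ} {ε : R}

/-- `g` preserves the flag spanned by the isotropic vectors `e₁, …, e_m` of the standard
hyperbolic pairs, with diagonal entries `a`. -/
def IsUpperWithDiag (g : GSpin (form m ε)) (a : Fin m → R) : Prop :=
  ∀ (j : Fin m) (x : Fin m → R), (∀ i, j < i → x i = 0) →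
    ∃ x' : Fin m → R, (∀ i, j < i → x' i = 0) ∧ x' j = a j * x j ∧
      Maps g (x, 0, 0, 0) (x', 0, 0, 0)

lemma IsUpperWithDiag.mul {g h : GSpin (form m ε)} {a b : Fin m → R}
    (hg : IsUpperWithDiag g a) (hh : IsUpperWithDiag h b) : IsUpperWithDiag (g * h) (a * b) := by
  intro j x hx
  obtain ⟨x', h1, h2, h3⟩ := hh j x hx
  obtain ⟨x'', h4, h5, h6⟩ := hg j x' h1
  exact ⟨x'', h4, by rw [h5, h2, Pi.mul_apply, mul_assoc], h6.mul h3⟩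

lemma isUpperWithDiag_of_maps {g : GSpin (form m ε)} {a : Fin m → R}
    (h : ∀ j, Maps g (stdPair ε j).e (a j • (stdPair ε j).e)) : IsUpperWithDiag g a := by
  intro j x hx
  refine ⟨a * x, fun i hi => by simp [hx i hi], rfl, ?_⟩
  have h1 := Maps.sum Finset.univ fun i => (h i).smul (x i)
  convert h1 using 1
  · refine Prod.ext ?_ (by simp [stdPair, Prod.snd_sum])
    ext i
    simp [stdPair, Prod.fst_sum, Pi.single_apply]
  · refine Prod.ext ?_ (by simp [stdPair, Prod.snd_sum])
    ext i
    simp [stdPair, Prod.fst_sum, Pi.single_apply, mul_comm]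

lemma isUpperWithDiag_one_add {g : GSpin (form m ε)} {i : Fin m} {w : Vec m R}
    (hw : ∀ j ≤ i, QuadraticMap.polar (form m ε) (stdPair ε j).e w = 0)
    (hg : ((g : (CliffordAlgebra (form m ε))ˣ) : CliffordAlgebra (form m ε)) =
      1 + CliffordAlgebra.ι (form m ε) (stdPair ε i).e * CliffordAlgebra.ι (form m ε) w) :
    IsUpperWithDiag g 1 := by
  have hw' : ∀ j ≤ i, w.2.1 j = 0 := by
    intro j hj
    have := hw j hj
    simpa [polar_form, stdPair, Pi.single_apply] using this
  intro j x hx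
  set c := QuadraticMap.polar (form m ε) w (x, 0, 0, 0) with hc
  have hc0 : j ≤ i → c = 0 := by
    intro hji
    rw [hc, polar_form]
    simp only [Pi.zero_apply, mul_zero, zero_add, add_zero, sub_zero]
    refine Finset.sum_eq_zero fun l _ => ?_
    rcases le_or_gt l i with hl | hl
    · rw [hw' l hl, mul_zero]
    · rw [hx l (lt_of_le_of_lt hji hl), zero_mul]
  refine ⟨x + c • Pi.single i 1, fun l hl => ?_, ?_, ?_⟩
  · rcases le_or_gt j i with h | h
    · simp [hc0 h, hx l hl]
    · have : l ≠ i := by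
        rintro rfl
        exact absurd h (not_lt.mpr hl.le)
      simp [this, hx l hl]
  · rcases le_or_gt j i with h | h
    · simp [hc0 h]
    · simp [h.ne']
  · have h := maps_one_add (stdPair ε i).isotropic_e hg (v := (x, 0, 0, 0))
      (by simp [polar_form, stdPair])
    convert h using 1
    simp [stdPair, hc]

end Upper

/-! ### The hyperspecial subgroup and the Satake transform of the central operator -/

section Lattice

variable {p : ℕ} [Fact p.Prime] {m : ℕ} {ε : ℤ_[p]ˣ}

/-- Elements of `U(ℚ_p)` act by upper unitriangular matrices on the isotropic flag and have spinor
norm `1`; the statement about `u⁻¹` makes the induction over the generators pass to inverses. -/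
lemma mem_UQ {u : GQ p m ε} (hu : u ∈ UQ p m ε) :
    (IsUpperWithDiag u 1 ∧ HasSpinorNorm u 1) ∧ IsUpperWithDiag u⁻¹ 1 ∧ HasSpinorNorm u⁻¹ 1 := by
  refine Subgroup.closure_induction (p := fun u _ => (IsUpperWithDiag u 1 ∧ HasSpinorNorm u 1) ∧
    IsUpperWithDiag u⁻¹ 1 ∧ HasSpinorNorm u⁻¹ 1) ?_ ?_ ?_ ?_ hu
  · rintro g ⟨i, w, hw, hg⟩
    have hn := hasSpinorNorm_one_add (stdPair _ i).isotropic_e (hw i le_rfl) hg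
    refine ⟨⟨isUpperWithDiag_one_add hw hg, hn⟩, ?_, hn.inv (one_mul 1)⟩
    refine isUpperWithDiag_one_add (i := i) (w := -w) (fun j hj => ?_) ?_
    · rw [QuadraticMap.polar_neg_right, hw j hj, neg_zero]
    · rw [Subgroup.coe_inv]
      refine Units.inv_eq_of_mul_eq_one_right ?_
      rw [hg, map_neg, mul_neg, ← sub_eq_add_neg]
      exact one_add_mul_one_sub (stdPair _ i).isotropic_e (hw i le_rfl)
  · have h : IsUpperWithDiag (1 : GQ p m ε) 1 :=
      isUpperWithDiag_of_maps fun j => by simpa using Maps.one _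
    simpa using ⟨h, HasSpinorNorm.one⟩
  · rintro x y - - ⟨⟨a1, a2⟩, a3, a4⟩ ⟨⟨b1, b2⟩, b3, b4⟩
    rw [mul_inv_rev]
    refine ⟨⟨?_, ?_⟩, ?_, ?_⟩
    · simpa using a1.mul b1
    · simpa using a2.mul b2
    · simpa using b3.mul a3
    · simpa using b4.mul a4
  · rintro x - ⟨a, b⟩
    rw [inv_inv]
    exact ⟨b, a⟩

lemma inclClifford_ι (v : Vec m ℤ_[p]) :
    inclClifford p m ε (CliffordAlgebra.ι (formZ p m ε) v) =
      CliffordAlgebra.ι (formQ p m ε) (inclVec p m v) := by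
  simp [inclClifford]

lemma inclClifford_reverse (x : CliffordAlgebra (formZ p m ε)) :
    inclClifford p m ε (CliffordAlgebra.reverse x) =
      CliffordAlgebra.reverse (inclClifford p m ε x) := by
  induction x using CliffordAlgebra.induction with
  | algebraMap r =>
    rw [CliffordAlgebra.reverse.commutes, AlgHom.commutes,
      IsScalarTower.algebraMap_apply ℤ_[p] ℚ_[p], CliffordAlgebra.reverse.commutes]
  | ι v => rw [CliffordAlgebra.reverse_ι, inclClifford_ι, CliffordAlgebra.reverse_ι]
  | mul a b ha hb =>
    rw [CliffordAlgebra.reverse.map_mul, map_mul, map_mul, CliffordAlgebra.reverse.map_mul, ha, hb]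
  | add a b ha hb => rw [map_add, map_add, map_add, map_add, ha, hb]

/-- The hyperspecial subgroup preserves the lattice. -/
lemma Kp_maps_lattice {g : GQ p m ε} (hg : g ∈ Kp p m ε) {v : Vec m ℤ_[p]} {w : Vec m ℚ_[p]}
    (h : Maps g (inclVec p m v) w) : ∃ v', inclVec p m v' = w := by
  obtain ⟨g₀, hg₀, hgg⟩ := hg
  obtain ⟨v', hv'⟩ := hg₀.2.1 v
  refine ⟨v', ?_⟩
  let _ : Invertible (2 : ℚ_[p]) := invertibleOfNonzero two_ne_zero
  apply ι_injective_of_invertible (formQ p m ε)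
  rw [maps_iff] at h
  rw [← h, ← inclClifford_ι, hv', map_mul, map_mul, inclClifford_ι, Subgroup.coe_inv]
  have hgg' : Units.map (inclClifford p m ε).toRingHom.toMonoidHom g₀ =
    (g : (CliffordAlgebra (formQ p m ε))ˣ) := hgg
  rw [← hgg', ← map_inv]
  rfl

lemma isUnit_two_padicInt (hp : p ≠ 2) : IsUnit (2 : ℤ_[p]) := by
  rw [PadicInt.isUnit_iff]
  have := (PadicInt.norm_natCast_eq_one_iff (p := p) (n := 2)).mpr
    ((Nat.coprime_primes (Fact.out : p.Prime) Nat.prime_two).mpr hp)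
  exact_mod_cast this

lemma finite_cliffordAlgebra (hp : p ≠ 2) :
    Module.Finite ℤ_[p] (CliffordAlgebra (formZ p m ε)) := by
  let _ : Invertible (2 : ℤ_[p]) := (isUnit_two_padicInt hp).invertible
  let b := Module.Free.chooseBasis ℤ_[p] (Vec m ℤ_[p])
  -- The basis of the exterior algebra needs a linearly ordered index type.
  let e := Fintype.equivFin (Module.Free.ChooseBasisIndex ℤ_[p] (Vec m ℤ_[p]))
  have : Module.Finite ℤ_[p] (ExteriorAlgebra ℤ_[p] (Vec m ℤ_[p])) :=
    Module.Finite.of_basis (b.reindex e).ExteriorAlgebra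
  exact Module.Finite.equiv (CliffordAlgebra.equivExterior (formZ p m ε)).symm

/-- Since the integral Clifford algebra is finite over `ℤ_p`, its scalars are integral. -/
lemma Kp_spinorNorm_mem (hp : p ≠ 2) {g : GQ p m ε} (hg : g ∈ Kp p m ε) {c : ℚ_[p]}
    (h : HasSpinorNorm g c) : ∃ y : ℤ_[p], (y : ℚ_[p]) = c := by
  obtain ⟨g₀, hg₀, hgg⟩ := hg
  have hgg' : Units.map (inclClifford p m ε).toRingHom.toMonoidHom g₀ =
    (g : (CliffordAlgebra (formQ p m ε))ˣ) := hgg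
  have := finite_cliffordAlgebra (m := m) (ε := ε) hp
  have h1 : IsIntegral ℤ_[p] (CliffordAlgebra.reverse (g₀ : CliffordAlgebra (formZ p m ε)) * g₀) :=
    IsIntegral.of_finite _ _
  have h2 := h1.map (inclClifford p m ε)
  rw [map_mul, inclClifford_reverse] at h2
  unfold HasSpinorNorm at h
  rw [← hgg'] at h
  change CliffordAlgebra.reverse (inclClifford p m ε g₀) * inclClifford p m ε g₀ = _ at h
  rw [h] at h2
  let _ : Invertible (2 : ℚ_[p]) := invertibleOfNonzero two_ne_zero
  have h3 : IsIntegral ℤ_[p] c := (isIntegral_algHom_iff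
    (IsScalarTower.toAlgHom ℤ_[p] ℚ_[p] (CliffordAlgebra (formQ p m ε)))
    (algebraMap_injective_of_invertible _)).mp h2
  exact IsIntegrallyClosed.isIntegral_iff.mp h3

lemma norm_pUnit_zpow (a : ℤ) : ‖((pUnit p ^ a : ℚ_[p]ˣ) : ℚ_[p])‖ = (p : ℝ) ^ (-a) := by
  simp [pUnit]

/-- `p ^ a` is integral only if `0 ≤ a`. -/
lemma nonneg_of_pUnit_zpow {a : ℤ} {y : ℤ_[p]} (h : (y : ℚ_[p]) = ((pUnit p ^ a : ℚ_[p]ˣ) : ℚ_[p])) :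
    0 ≤ a := by
  have h1 := y.2
  change ‖(y : ℚ_[p])‖ ≤ 1 at h1
  rw [h, norm_pUnit_zpow] at h1
  by_contra hneg
  have : (1 : ℝ) < (p : ℝ) ^ (-a) :=
    one_lt_zpow₀ (by exact_mod_cast (Fact.out : p.Prime).one_lt) (by omega)
  linarith

/-- The diagonal entries are coordinates of images of lattice vectors, hence integral. -/
lemma nonneg_of_mem_Kp {g : GQ p m ε} (hg : g ∈ Kp p m ε) {ν : Fin m → ℤ}
    (h : IsUpperWithDiag g fun j => ((pUnit p ^ ν j : ℚ_[p]ˣ) : ℚ_[p])) (j : Fin m) : 0 ≤ ν j := by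
  obtain ⟨x', h1, h2, h3⟩ := h j (Pi.single j 1) fun i hi => by simp [hi.ne']
  have h4 : inclVec p m (Pi.single j 1, 0, 0, 0) = (Pi.single j 1, 0, 0, 0) := by
    refine Prod.ext ?_ (Prod.ext ?_ ?_)
    · ext i
      by_cases hi : i = j
      · subst hi
        simp [inclVec]
      · simp [inclVec, hi]
    · ext i
      simp [inclVec]
    · simp [inclVec]
  rw [← h4] at h3
  obtain ⟨v', hv'⟩ := Kp_maps_lattice hg h3
  apply nonneg_of_pUnit_zpow (p := p) (y := v'.1 j)
  have h5 := congrFun (congrArg Prod.fst hv') j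
  change ((v'.1 j : ℤ_[p]) : ℚ_[p]) = x' j at h5
  rw [h5, h2]
  simp

/-- The Iwasawa decomposition is disjoint: `U(ℚ_p) ν(p)` meets `p K_p` only for `ν = e₀^∨`. -/
lemma eq_eZero_of_mem_Kp (hp : p ≠ 2) {u : GQ p m ε} (hu : u ∈ UQ p m ε) {ν : Lat m}
    (h : (scalar (formQ p m ε) (pUnit p))⁻¹ * (u * cocharAtP p m ε ν) ∈ Kp p m ε) :
    ν = eZero m := by
  obtain ⟨⟨u1, u2⟩, u3, u4⟩ := mem_UQ hu
  have hmaps := fun j => maps_torusCochar_e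
    (isOrthogonalFamily_stdPair (m := m) ((ε : ℤ_[p]) : ℚ_[p])) ν (pUnit p) j
  have ht : IsUpperWithDiag (cocharAtP p m ε ν)
      fun j => ((pUnit p ^ ν.2 j : ℚ_[p]ˣ) : ℚ_[p]) := isUpperWithDiag_of_maps hmaps
  have ht' : IsUpperWithDiag (cocharAtP p m ε ν)⁻¹
      fun j => ((pUnit p ^ (-ν.2 j) : ℚ_[p]ˣ) : ℚ_[p]) := by
    refine isUpperWithDiag_of_maps fun j => ?_
    have h1 := ((hmaps j).smul ((pUnit p ^ (-ν.2 j) : ℚ_[p]ˣ) : ℚ_[p])).inv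
    rw [smul_smul, ← Units.val_mul, ← zpow_add, neg_add_cancel, zpow_zero, Units.val_one,
      one_smul] at h1
    exact h1
  have hs : IsUpperWithDiag (scalar (formQ p m ε) (pUnit p)) 1 :=
    isUpperWithDiag_of_maps fun j => by simpa using maps_scalar _ _
  have hs' : IsUpperWithDiag (scalar (formQ p m ε) (pUnit p))⁻¹ 1 :=
    isUpperWithDiag_of_maps fun j => by simpa using (maps_scalar _ _).inv
  have hinv := inv_mem h
  rw [mul_inv_rev, mul_inv_rev, inv_inv] at hinv
  have h2 : ∀ j, ν.2 j = 0 := by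
    intro j
    have a1 := nonneg_of_mem_Kp h (ν := ν.2) (by simpa using hs'.mul (u1.mul ht)) j
    have a2 := nonneg_of_mem_Kp hinv (ν := fun j => -ν.2 j) (by simpa using (ht'.mul u3).mul hs) j
    omega
  have hn : HasSpinorNorm ((scalar (formQ p m ε) (pUnit p))⁻¹ * (u * cocharAtP p m ε ν))
      ((pUnit p ^ (2 * ν.1 - 2) : ℚ_[p]ˣ) : ℚ_[p]) := by
    have b1 := (hasSpinorNorm_scalar (Q := formQ p m ε) (pUnit p)).inv
      (d := ((pUnit p ^ (-2 : ℤ) : ℚ_[p]ˣ) : ℚ_[p])) (by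
        rw [← Units.val_mul, ← Units.val_mul, ← pow_two, ← zpow_natCast, ← zpow_add]
        simp)
    have b2 := b1.mul (u2.mul (hasSpinorNorm_torusCochar
      (fun i : Fin m => stdPair ((ε : ℤ_[p]) : ℚ_[p]) i) ν (pUnit p)))
    rw [one_mul, ← Units.val_mul, ← zpow_add, Finset.sum_eq_zero fun j _ => h2 j] at b2
    rw [show 2 * ν.1 - 2 = -2 + (2 * ν.1 + 0) by ring]
    exact b2
  have hn' := hn.inv (d := ((pUnit p ^ (2 - 2 * ν.1) : ℚ_[p]ˣ) : ℚ_[p])) (by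
    rw [← Units.val_mul, ← zpow_add]
    simp)
  rw [mul_inv_rev, mul_inv_rev, inv_inv] at hn'
  obtain ⟨y1, c1⟩ := Kp_spinorNorm_mem hp h hn
  obtain ⟨y2, c2⟩ := Kp_spinorNorm_mem hp hinv hn'
  have c3 := nonneg_of_pUnit_zpow c1
  have c4 := nonneg_of_pUnit_zpow c2
  refine Prod.ext ?_ ?_
  · simp only [eZero]
    omega
  · ext j
    simp [h2, eZero]

lemma cocharAtP_eZero : cocharAtP p m ε (eZero m) = scalar (formQ p m ε) (pUnit p) := by
  simp [cocharAtP, torusCochar, eZero, List.ofFn_const]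

lemma scalar_mul_comm {R : Type*} [CommRing R] {M : Type*} [AddCommGroup M] [Module R M]
    {Q : QuadraticForm R M} (t : Rˣ) (g : GSpin Q) : scalar Q t * g = g * scalar Q t :=
  Subtype.ext (Units.ext (Algebra.commutes _ _))

lemma mk_scalar_eq_iff (t : ℚ_[p]ˣ) (g : GQ p m ε) :
    DoubleCoset.mk (Kp p m ε) (Kp p m ε) (scalar (formQ p m ε) t) =
      DoubleCoset.mk (Kp p m ε) (Kp p m ε) g ↔
    (scalar (formQ p m ε) t)⁻¹ * g ∈ Kp p m ε := by
  rw [DoubleCoset.eq]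
  constructor
  · rintro ⟨h, hh, k, hk, rfl⟩
    rw [← scalar_mul_comm, mul_assoc, inv_mul_cancel_left]
    exact mul_mem hh hk
  · intro h
    exact ⟨1, one_mem _, _, h, by simp⟩

/-- Only the coset of `1` contributes to the integral, and only for `ν = e₀^∨`. -/
theorem satake_heckeOp_scalar (hp : p ≠ 2) (ν : Lat m) :
    satake p m ε (heckeOp p m ε (scalar (formQ p m ε) (pUnit p))) ν =
      (hMon (eZero m)).coeff ν := by
  classical
  rw [hMon, AddMonoidAlgebra.coeff_single, Finsupp.single_apply, satake, heckeOp]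
  have hval : ∀ u : GQ p m ε, (Finsupp.single (DoubleCoset.mk (Kp p m ε) (Kp p m ε)
      (scalar (formQ p m ε) (pUnit p))) (1 : ℚ)) (DoubleCoset.mk (Kp p m ε) (Kp p m ε)
        (u * cocharAtP p m ε ν)) =
      if (scalar (formQ p m ε) (pUnit p))⁻¹ * (u * cocharAtP p m ε ν) ∈ Kp p m ε
        then 1 else 0 := by
    intro u
    rw [Finsupp.single_apply]
    exact if_congr (mk_scalar_eq_iff _ _) rfl rfl
  rw [finsum_eq_single _ (Quotient.mk _ 1)]
  · rw [Quotient.liftOn_mk, hval]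
    refine if_congr ⟨fun h => (eq_eZero_of_mem_Kp hp (one_mem _) h).symm, ?_⟩ rfl rfl
    rintro rfl
    rw [cocharAtP_eZero, Subgroup.coe_one, one_mul, inv_mul_cancel]
    exact one_mem _
  · intro c
    induction c using Quotient.inductionOn with
    | h u =>
      intro hne
      rw [Quotient.liftOn_mk, hval, if_neg]
      intro h
      apply hne
      have hν := eq_eZero_of_mem_Kp hp u.2 h
      subst hν
      rw [cocharAtP_eZero, ← scalar_mul_comm, inv_mul_cancel_left] at h
      refine Quotient.sound ?_
      refine QuotientGroup.rightRel_apply.mpr ?_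
      rw [Subgroup.mem_subgroupOf]
      simpa using h

end Lattice

/-! ### The order of the basis of the standard representation -/

section Places

variable {m : ℕ}

lemma place_lt (a : Idx m) : place a < 2 * m + 2 := by
  rcases a with a | a <;> simp only [place, Sum.elim_inl, Sum.elim_inr] <;> omega

lemma place_swap (a : Idx m) : place a.swap = 2 * m + 1 - place a := by
  rcases a with a | a <;> simp only [place, Sum.swap_inl, Sum.swap_inr, Sum.elim_inl, Sum.elim_inr]
  omega

lemma place_injective : Function.Injective (place : Idx m → ℕ) := by
  rintro (a | a) (b | b) h <;> simp only [place, Sum.elim_inl, Sum.elim_inr] at h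
  · rw [Fin.ext h]
  · omega
  · omega
  · have : a = b := Fin.ext (by omega)
    rw [this]

lemma place_swap_lt_iff (a b : Idx m) : place a.swap < place b ↔ place b.swap < place a := by
  rw [place_swap, place_swap]
  have := place_lt a
  have := place_lt b
  omega

lemma swap_ne_self (a : Idx m) : a.swap ≠ a := by
  rcases a with a | a <;> simp

lemma eq_swap_comm {a b : Idx m} : a = b.swap ↔ b = a.swap := by
  constructor <;> rintro rfl <;> simp

end Places

/-! ### Isometries and reflections -/

section Bilinear

variable {m : ℕ} {k : Type*} [Field k]

/-- The symmetric bilinear form with Gram matrix `gram m k`. -/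
def bil (v w : Idx m → k) : k := ∑ a, v a * w a.swap

lemma sum_swap (f : Idx m → k) : ∑ a : Idx m, f a.swap = ∑ a, f a :=
  Equiv.sum_comp (Equiv.sumComm _ _) f

lemma bil_comm (v w : Idx m → k) : bil v w = bil w v := by
  rw [bil, ← sum_swap]
  simp [bil, mul_comm]

lemma bil_add_left (v v' w : Idx m → k) : bil (v + v') w = bil v w + bil v' w := by
  simp [bil, add_mul, Finset.sum_add_distrib]

lemma bil_smul_left (c : k) (v w : Idx m → k) : bil (c • v) w = c * bil v w := by
  simp only [bil, Finset.mul_sum, Pi.smul_apply, smul_eq_mul, mul_assoc]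

lemma bil_sub_left (v v' w : Idx m → k) : bil (v - v') w = bil v w - bil v' w := by
  simp [bil, sub_mul, Finset.sum_sub_distrib]

lemma bil_add_right (v w w' : Idx m → k) : bil v (w + w') = bil v w + bil v w' := by
  rw [bil_comm, bil_add_left, bil_comm w, bil_comm w']

lemma bil_smul_right (c : k) (v w : Idx m → k) : bil v (c • w) = c * bil v w := by
  rw [bil_comm, bil_smul_left, bil_comm w]

lemma bil_sub_right (v w w' : Idx m → k) : bil v (w - w') = bil v w - bil v w' := by
  rw [bil_comm, bil_sub_left, bil_comm w, bil_comm w']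

lemma gram_apply (a b : Idx m) : gram m k a b = if a = b.swap then 1 else 0 := by
  rcases a with a | a <;> rcases b with b | b <;> simp [gram, Matrix.one_apply]

lemma gram_mul_apply (M : Matrix (Idx m) (Idx m) k) (a b : Idx m) :
    (gram m k * M) a b = M a.swap b := by
  simp [Matrix.mul_apply, gram_apply, eq_swap_comm (a := a)]

lemma transpose_mul_gram_mul_apply (M N : Matrix (Idx m) (Idx m) k) (a b : Idx m) :
    (M.transpose * gram m k * N) a b = ∑ x, M x a * N x.swap b := by
  rw [Matrix.mul_assoc, Matrix.mul_apply]
  simp [gram_mul_apply]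

lemma transpose_mul_gram_mul_apply_eq_bil (M : Matrix (Idx m) (Idx m) k) (a b : Idx m) :
    (M.transpose * gram m k * M) a b = bil (M.mulVec (Pi.single a 1)) (M.mulVec (Pi.single b 1)) := by
  rw [transpose_mul_gram_mul_apply, bil]
  simp

lemma bil_eq_dotProduct (v w : Idx m → k) : bil v w = v ⬝ᵥ (gram m k).mulVec w := by
  simp [bil, dotProduct, Matrix.mulVec, gram_apply, eq_swap_comm (b := (_ : Idx m))]

lemma bil_single (a b : Idx m) :
    bil (Pi.single a 1 : Idx m → k) (Pi.single b 1) = if a = b.swap then 1 else 0 := by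
  rw [bil_eq_dotProduct, single_one_dotProduct, Matrix.mulVec_single_one, Matrix.col_apply,
    gram_apply]

/-- `M` preserves the bilinear form. -/
def IsIsometry (M : Matrix (Idx m) (Idx m) k) : Prop :=
  M.transpose * gram m k * M = gram m k

lemma isIsometry_iff {M : Matrix (Idx m) (Idx m) k} :
    IsIsometry M ↔ ∀ v w, bil (M.mulVec v) (M.mulVec w) = bil v w := by
  constructor
  · intro h v w
    have h' : M.transpose * gram m k * M = gram m k := h
    rw [bil_eq_dotProduct, bil_eq_dotProduct v]
    conv_rhs => rw [← h', ← Matrix.mulVec_mulVec, ← Matrix.mulVec_mulVec,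
      Matrix.dotProduct_mulVec v, Matrix.vecMul_transpose]
  · intro h
    ext a b
    rw [transpose_mul_gram_mul_apply_eq_bil, h]
    rw [bil_single, gram_apply]

lemma IsIsometry.one : IsIsometry (1 : Matrix (Idx m) (Idx m) k) := by simp [IsIsometry]

lemma IsIsometry.mul {M N : Matrix (Idx m) (Idx m) k} (hM : IsIsometry M) (hN : IsIsometry N) :
    IsIsometry (M * N) := by
  rw [isIsometry_iff] at *
  intro v w
  rw [← Matrix.mulVec_mulVec, ← Matrix.mulVec_mulVec, hM, hN]

/-- The orthogonal reflection in the vector `v`; it is the identity if `v` is isotropic, as then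
`(bil v v)⁻¹ = 0`. -/
def refl (v : Idx m → k) : Matrix (Idx m) (Idx m) k :=
  1 - Matrix.of fun a b => 2 * (bil v v)⁻¹ * (v a * v b.swap)

lemma refl_mulVec (v x : Idx m → k) :
    (refl v).mulVec x = x - (2 * (bil v v)⁻¹ * bil v x) • v := by
  rw [refl, Matrix.sub_mulVec, Matrix.one_mulVec]
  congr 1
  ext a
  rw [bil_comm v x]
  simp only [Matrix.mulVec, dotProduct, Matrix.of_apply, bil, Pi.smul_apply, smul_eq_mul,
    Finset.mul_sum, Finset.sum_mul]
  refine Finset.sum_congr rfl fun b _ => ?_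
  ring

lemma refl_mulVec_of_orthogonal {v x : Idx m → k} (h : bil v x = 0) : (refl v).mulVec x = x := by
  simp [refl_mulVec, h]

lemma refl_mulVec_self {v : Idx m → k} (h : bil v v ≠ 0) : (refl v).mulVec v = -v := by
  rw [refl_mulVec, mul_assoc, inv_mul_cancel₀ h, mul_one, two_smul]
  abel

lemma isIsometry_refl {v : Idx m → k} (h : bil v v ≠ 0) : IsIsometry (refl v) := by
  rw [isIsometry_iff]
  intro x y
  simp only [refl_mulVec, bil_sub_left, bil_sub_right, bil_smul_left, bil_smul_right, bil_comm x v]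
  field_simp
  ring

lemma refl_mul_self {v : Idx m → k} (h : bil v v ≠ 0) : refl v * refl v = 1 := by
  refine Matrix.ext_of_mulVec_single fun a => ?_
  rw [← Matrix.mulVec_mulVec, refl_mulVec, refl_mulVec, bil_sub_right, bil_smul_right,
    Matrix.one_mulVec, mul_assoc, mul_assoc]
  set c := bil v (Pi.single a 1)
  have : (bil v v)⁻¹ * (c - 2 * ((bil v v)⁻¹ * c) * bil v v) = -((bil v v)⁻¹ * c) := by
    field_simp
    ring
  rw [this]
  module

lemma det_refl {v : Idx m → k} (h : bil v v ≠ 0) : (refl v).det = -1 := by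
  have h1 : refl v = 1 - Matrix.replicateCol Unit v *
      Matrix.replicateRow Unit (fun b => 2 * (bil v v)⁻¹ * v b.swap) := by
    rw [refl]
    congr 1
    ext a b
    simp [Matrix.mul_apply]
    ring
  rw [h1, Matrix.det_one_sub_mul_comm, Matrix.det_unique]
  have h2 : ∑ x, 2 * (bil v v)⁻¹ * v x.swap * v x = 2 := by
    calc _ = 2 * (bil v v)⁻¹ * bil v v := by
          rw [bil_comm, bil, Finset.mul_sum]
          exact Finset.sum_congr rfl fun x _ => by simp; ring
      _ = 2 := by rw [mul_assoc, inv_mul_cancel₀ h, mul_one]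
  simp only [Matrix.sub_apply, Matrix.one_apply_eq, Matrix.mul_apply, Matrix.replicateRow_apply,
    Matrix.replicateCol_apply, h2]
  norm_num

lemma det_list_prod_refl {l : List (Idx m → k)} (h : ∀ v ∈ l, bil v v ≠ 0) :
    ((l.map refl).prod).det = (-1) ^ l.length := by
  induction l with
  | nil => simp
  | cons v l ih =>
    rw [List.map_cons, List.prod_cons, Matrix.det_mul, det_refl (h v (by simp)),
      ih fun w hw => h w (by simp [hw]), List.length_cons, pow_succ']

lemma isIsometry_list_prod_refl {l : List (Idx m → k)} (h : ∀ v ∈ l, bil v v ≠ 0) :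
    IsIsometry (l.map refl).prod := by
  induction l with
  | nil => simpa using IsIsometry.one
  | cons v l ih =>
    rw [List.map_cons, List.prod_cons]
    exact (isIsometry_refl (h v (by simp))).mul (ih fun w hw => h w (by simp [hw]))

/-- An orthogonal basis: the sums and differences of the dual basis vectors. -/
def orthoVec (c : Idx m) : Idx m → k :=
  Sum.elim (fun i => Pi.single (Sum.inl i) 1 + Pi.single (Sum.inr i) 1)
    (fun i => Pi.single (Sum.inl i) 1 - Pi.single (Sum.inr i) 1) c

lemma bil_orthoVec_of_ne {c d : Idx m} (h : c ≠ d) :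
    bil (orthoVec c : Idx m → k) (orthoVec d) = 0 := by
  rcases c with c | c <;> rcases d with d | d <;>
    simp only [orthoVec, Sum.elim_inl, Sum.elim_inr, bil_add_left, bil_add_right, bil_sub_left,
      bil_sub_right, bil_single, Sum.swap_inl, Sum.swap_inr] <;> simp_all

lemma bil_orthoVec_ne_zero [CharZero k] (c : Idx m) :
    bil (orthoVec c : Idx m → k) (orthoVec c) ≠ 0 := by
  rcases c with c | c <;>
    simp only [orthoVec, Sum.elim_inl, Sum.elim_inr, bil_add_left, bil_add_right, bil_sub_left,
      bil_sub_right, bil_single, Sum.swap_inl, Sum.swap_inr, reduceCtorEq, if_true, if_false] <;> norm_num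

/-- One step of the Cartan-Dieudonné argument: of two vectors `x`, `y` of the same nonzero norm,
`y - x` or `y + x` is anisotropic, and `y` is moved to `x` by one or two reflections. -/
lemma exists_reflections_map [CharZero k] {x y : Idx m → k} (hx : bil x x ≠ 0)
    (hxy : bil y y = bil x x) :
    ∃ l : List (Idx m → k), (∀ v ∈ l, bil v v ≠ 0) ∧ ((l.map refl).prod).mulVec y = x ∧
      ∀ z, bil x z = 0 → bil y z = 0 → ((l.map refl).prod).mulVec z = z := by
  by_cases h : bil (y - x) (y - x) = 0
  · have h' : bil (y + x) (y + x) = 4 * bil x x := by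
      have h2 : bil (y + x) (y + x) = 2 * bil y y + 2 * bil x x - bil (y - x) (y - x) := by
        simp only [bil_add_left, bil_add_right, bil_sub_left, bil_sub_right]
        ring
      rw [h2, h, hxy]
      ring
    have h0 : bil (y + x) (y + x) ≠ 0 := by
      rw [h']
      exact mul_ne_zero (by norm_num) hx
    refine ⟨[x, y + x], ?_, ?_, ?_⟩
    · rintro v hv
      simp only [List.mem_cons, List.not_mem_nil, or_false] at hv
      rcases hv with rfl | rfl
      · exact hx
      · exact h0
    · simp only [List.map_cons, List.map_nil, List.prod_cons, List.prod_nil, mul_one]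
      have h3 : (refl (y + x)).mulVec y = -x := by
        have h4 : bil (y + x) (y + x) = 2 * bil (y + x) y := by
          simp only [bil_add_left, bil_add_right, hxy, bil_comm y x]
          ring
        have h5 : 2 * (bil (y + x) (y + x))⁻¹ * bil (y + x) y = 1 := by
          rw [mul_right_comm, ← h4, mul_inv_cancel₀ h0]
        rw [refl_mulVec, h5, one_smul]
        abel
      rw [← Matrix.mulVec_mulVec, h3, Matrix.mulVec_neg, refl_mulVec_self hx, neg_neg]
    · intro z hz hz'
      simp only [List.map_cons, List.map_nil, List.prod_cons, List.prod_nil, mul_one]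
      rw [← Matrix.mulVec_mulVec, refl_mulVec_of_orthogonal (v := y + x), refl_mulVec_of_orthogonal hz]
      rw [bil_add_left, hz, hz', add_zero]
  · refine ⟨[y - x], by simpa using h, ?_, ?_⟩
    · simp only [List.map_cons, List.map_nil, List.prod_cons, List.prod_nil, mul_one]
      have h4 : bil (y - x) (y - x) = 2 * bil (y - x) y := by
        simp only [bil_sub_left, bil_sub_right, hxy, bil_comm y x]
        ring
      have h5 : 2 * (bil (y - x) (y - x))⁻¹ * bil (y - x) y = 1 := by
        rw [mul_right_comm, ← h4, mul_inv_cancel₀ h]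
      rw [refl_mulVec, h5, one_smul]
      abel
    · intro z hz hz'
      simp only [List.map_cons, List.map_nil, List.prod_cons, List.prod_nil, mul_one]
      rw [refl_mulVec_of_orthogonal]
      rw [bil_sub_left, hz, hz', sub_zero]

lemma list_prod_refl_reverse_mul {l : List (Idx m → k)} (h : ∀ v ∈ l, bil v v ≠ 0) :
    (l.reverse.map refl).prod * (l.map refl).prod = 1 := by
  induction l with
  | nil => simp
  | cons v l ih =>
    rw [List.reverse_cons, List.map_append, List.prod_append, List.map_cons, List.prod_cons]
    simp only [List.map_cons, List.map_nil, List.prod_cons, List.prod_nil, mul_one]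
    rw [mul_assoc, ← mul_assoc (refl v), refl_mul_self (h v (by simp)), one_mul]
    exact ih fun w hw => h w (by simp [hw])

/-- A weak form of the Cartan-Dieudonné theorem: isometries are products of reflections. -/
theorem IsIsometry.exists_reflections [CharZero k] {M : Matrix (Idx m) (Idx m) k}
    (hM : IsIsometry M) :
    ∃ l : List (Idx m → k), (∀ v ∈ l, bil v v ≠ 0) ∧ M = (l.map refl).prod := by
  have key : ∀ S : Finset (Idx m), ∃ (l : List (Idx m → k)) (N : Matrix (Idx m) (Idx m) k),
      (∀ v ∈ l, bil v v ≠ 0) ∧ IsIsometry N ∧ M = (l.map refl).prod * N ∧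
        ∀ c ∈ S, N.mulVec (orthoVec c) = orthoVec c := by
    intro S
    induction S using Finset.induction_on with
    | empty => exact ⟨[], M, by simp, hM, by simp, by simp⟩
    | insert c S hc ih =>
      obtain ⟨l, N, h1, h2, h3, h4⟩ := ih
      have hN := isIsometry_iff.mp h2
      obtain ⟨l', g1, g2, g3⟩ := exists_reflections_map (bil_orthoVec_ne_zero c)
        (hN (orthoVec c) (orthoVec c))
      refine ⟨l ++ l'.reverse, (l'.map refl).prod * N, ?_, (isIsometry_list_prod_refl g1).mul h2,
        ?_, ?_⟩
      · intro v hv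
        rw [List.mem_append, List.mem_reverse] at hv
        exact hv.elim (h1 v) (g1 v)
      · rw [List.map_append, List.prod_append, mul_assoc, ← mul_assoc (l'.reverse.map refl).prod,
          list_prod_refl_reverse_mul g1, one_mul, h3]
      · intro d hd
        rw [← Matrix.mulVec_mulVec]
        rcases Finset.mem_insert.mp hd with rfl | hd
        · exact g2
        · have hcd : c ≠ d := by
            rintro rfl
            exact hc hd
          rw [h4 d hd]
          refine g3 _ (bil_orthoVec_of_ne hcd) ?_
          rw [← h4 d hd, hN, bil_orthoVec_of_ne hcd]
  obtain ⟨l, N, h1, -, h3, h4⟩ := key Finset.univ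
  refine ⟨l, h1, ?_⟩
  have hN : N = 1 := by
    refine Matrix.ext_of_mulVec_single fun a => ?_
    rw [Matrix.one_mulVec]
    rcases a with i | i
    · have e : (Pi.single (Sum.inl i) 1 : Idx m → k) =
          (2⁻¹ : k) • (orthoVec (Sum.inl i) + orthoVec (Sum.inr i)) := by
        simp only [orthoVec, Sum.elim_inl, Sum.elim_inr, add_add_sub_cancel, ← two_smul k,
          smul_smul]
        simp
      rw [e, Matrix.mulVec_smul, Matrix.mulVec_add, h4 _ (by simp), h4 _ (by simp)]
    · have e : (Pi.single (Sum.inr i) 1 : Idx m → k) =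
          (2⁻¹ : k) • (orthoVec (Sum.inl i) - orthoVec (Sum.inr i)) := by
        simp only [orthoVec, Sum.elim_inl, Sum.elim_inr, add_sub_sub_cancel, ← two_smul k,
          smul_smul]
        simp
      rw [e, Matrix.mulVec_smul, Matrix.mulVec_sub, h4 _ (by simp), h4 _ (by simp)]
  rw [h3, hN, mul_one]

end Bilinear

/-! ### Rational functions of one variable -/

section RationalFunctions

variable {k : Type*} [Field k]

/-- `F` is given by a rational function whose denominator is a power of `D`; nothing is asked of
the values of `F` at the zeros of `D`. -/
def IsRationalOn (D : k[X]) (F : k → k) : Prop :=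
  ∃ (M : ℕ) (Q : k[X]), ∀ y, D.eval y ≠ 0 → F y * D.eval y ^ M = Q.eval y

variable {D : k[X]} {F G : k → k}

lemma isRationalOn_eval (D Q : k[X]) : IsRationalOn D fun y => Q.eval y :=
  ⟨0, Q, fun y _ => by simp⟩

lemma isRationalOn_const (D : k[X]) (c : k) : IsRationalOn D fun _ => c :=
  ⟨0, C c, fun y _ => by simp⟩

lemma IsRationalOn.add (hF : IsRationalOn D F) (hG : IsRationalOn D G) :
    IsRationalOn D fun y => F y + G y := by
  obtain ⟨M, Q, h⟩ := hF
  obtain ⟨M', Q', h'⟩ := hG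
  refine ⟨M + M', Q * D ^ M' + Q' * D ^ M, fun y hy => ?_⟩
  rw [eval_add, eval_mul, eval_mul, eval_pow, eval_pow, ← h y hy, ← h' y hy]
  ring

lemma IsRationalOn.mul (hF : IsRationalOn D F) (hG : IsRationalOn D G) :
    IsRationalOn D fun y => F y * G y := by
  obtain ⟨M, Q, h⟩ := hF
  obtain ⟨M', Q', h'⟩ := hG
  refine ⟨M + M', Q * Q', fun y hy => ?_⟩
  rw [eval_mul, ← h y hy, ← h' y hy]
  ring

lemma isRationalOn_inv {D E : k[X]} (h : E ∣ D) : IsRationalOn D fun y => (E.eval y)⁻¹ := by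
  obtain ⟨A, rfl⟩ := h
  refine ⟨1, A, fun y hy => ?_⟩
  rw [eval_mul] at hy ⊢
  rw [pow_one, inv_mul_cancel_left₀ (left_ne_zero_of_mul hy)]

lemma isRationalOn_sum {ι : Type*} (s : Finset ι) {F : ι → k → k}
    (h : ∀ i, IsRationalOn D (F i)) : IsRationalOn D fun y => ∑ i ∈ s, F i y := by
  classical
  induction s using Finset.induction_on with
  | empty => simpa using isRationalOn_const D 0
  | insert a s ha ih => simpa [Finset.sum_insert ha] using (h a).add ih

lemma isRationalOn_prod {ι : Type*} (s : Finset ι) {F : ι → k → k}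
    (h : ∀ i, IsRationalOn D (F i)) : IsRationalOn D fun y => ∏ i ∈ s, F i y := by
  classical
  induction s using Finset.induction_on with
  | empty => simpa using isRationalOn_const D 1
  | insert a s ha ih => simpa [Finset.prod_insert ha] using (h a).mul ih

lemma isRationalOn_mvPolynomial_eval {σ : Type*} {x : k → σ → k}
    (h : ∀ o, IsRationalOn D fun y => x y o) (P : MvPolynomial σ k) :
    IsRationalOn D fun y => MvPolynomial.eval (x y) P := by
  induction P using MvPolynomial.induction_on with
  | C a => simpa using isRationalOn_const D a
  | add P P' hP hP' => simpa using hP.add hP'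
  | mul_X P o hP => simpa using hP.mul (h o)

lemma isRationalOn_det {ι : Type*} [Fintype ι] [DecidableEq ι] {A : k → Matrix ι ι k}
    (h : ∀ i j, IsRationalOn D fun y => A y i j) : IsRationalOn D fun y => (A y).det := by
  simp only [Matrix.det_apply']
  exact isRationalOn_sum _ fun σ => (isRationalOn_const D _).mul (isRationalOn_prod _ fun i => h _ _)

/-- If `F` vanishes wherever the nonzero function `G` does not, then `F = 0`. -/
lemma IsRationalOn.eq_zero [Infinite k] (hF : IsRationalOn D F) (hG : IsRationalOn D G) {y₀ : k}
    (hD₀ : D.eval y₀ ≠ 0) (hG₀ : G y₀ ≠ 0)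
    (h : ∀ y, D.eval y ≠ 0 → G y ≠ 0 → F y = 0) {y : k} (hy : D.eval y ≠ 0) : F y = 0 := by
  obtain ⟨M, Q, hQ⟩ := hF
  obtain ⟨M', Q', hQ'⟩ := hG
  have h0 : Q * (D * Q') = 0 := by
    refine Polynomial.funext fun z => ?_
    rw [eval_zero, eval_mul, eval_mul]
    by_cases hz : D.eval z = 0
    · simp [hz]
    by_cases hz' : G z = 0
    · simp [← hQ' z hz, hz']
    · simp [← hQ z hz, h z hz hz']
  have hD : D ≠ 0 := by
    rintro rfl
    simp at hD₀
  have hQ0 : Q' ≠ 0 := by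
    rintro rfl
    have := hQ' y₀ hD₀
    rw [eval_zero] at this
    exact mul_ne_zero hG₀ (pow_ne_zero _ hD₀) this
  have hQz : Q = 0 := by
    rcases mul_eq_zero.mp h0 with h0 | h0
    · exact h0
    · exact absurd h0 (mul_ne_zero hD hQ0)
  have := hQ y hy
  rw [hQz, eval_zero] at this
  exact (mul_eq_zero.mp this).resolve_right (pow_ne_zero _ hy)

end RationalFunctions

/-! ### The big cell of `GSO` -/

section BigCell

variable {m : ℕ} {k : Type*} [Field k]

/-- The element of `GSO` given by a matrix of similitude factor `c`. -/
def GSO.ofMatrix (M : Matrix (Idx m) (Idx m) k) (c : kˣ)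
    (h : M.transpose * gram m k * M = (c : k) • gram m k) (hdet : M.det = (c : k) ^ (m + 1)) :
    GSO m k :=
  ⟨Matrix.GeneralLinearGroup.mkOfDetNeZero M (by rw [hdet]; exact pow_ne_zero _ c.ne_zero),
    c, h, hdet⟩

/-- The matrix of an element of `GSO`. -/
abbrev GSO.mat (g : GSO m k) : Matrix (Idx m) (Idx m) k := ((g : GL (Idx m) k) : Matrix _ _ k)

lemma GSO.mat_mul (g h : GSO m k) : GSO.mat (g * h) = GSO.mat g * GSO.mat h := rfl

lemma GSO.mat_one : GSO.mat (1 : GSO m k) = 1 := rfl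

lemma GSO.ext_mat {g h : GSO m k} (e : GSO.mat g = GSO.mat h) : g = h :=
  Subtype.ext (Units.ext e)

lemma torus_mat (s : kˣ) (t : Fin (m + 1) → kˣ) :
    GSO.mat (torus s t) = Matrix.diagonal fun a => (torusEntry s t a : k) := rfl

lemma torus_inv (s : kˣ) (t : Fin (m + 1) → kˣ) :
    GSO.mat (torus s t)⁻¹ = Matrix.diagonal fun a => (((torusEntry s t a)⁻¹ : kˣ) : k) := rfl

/-- `g` is lower triangular with ones on the diagonal. -/
def IsLowerUnipotent (g : GSO m k) : Prop :=
  ∀ a b : Idx m, (place a < place b → GSO.mat g a b = 0) ∧ GSO.mat g a a = 1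

/-- The determinant of a matrix that is unipotent upper triangular with respect to `place`. -/
lemma det_eq_one_of_upper {W : Matrix (Idx m) (Idx m) k}
    (h0 : ∀ a b, place b < place a → W a b = 0) (h1 : ∀ a, W a a = 1) : W.det = 1 := by
  let e : Idx m ≃ Fin (2 * m + 2) := Equiv.ofBijective (fun a => ⟨place a, place_lt a⟩)
    ((Fintype.bijective_iff_injective_and_card _).mpr
      ⟨fun a b h => place_injective (Fin.mk.inj h), by simp; ring⟩)
  have he : ∀ i, place (e.symm i) = (i : ℕ) := fun i => congrArg Fin.val (e.apply_symm_apply i)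
  rw [← Matrix.det_submatrix_equiv_self e.symm, Matrix.det_of_isUpperTriangular]
  · simp [h1]
  · intro i j hij
    refine h0 _ _ ?_
    rw [he, he]
    exact hij

/-- The leading minor of `M` formed from the basis vectors before `b`. -/
def leadingMinor (M : Matrix (Idx m) (Idx m) k) (b : Idx m) : k :=
  (M.toSquareBlockProp fun a => place a < place b).det

/-- Column elimination: if the leading minors are nonzero, then right multiplication by a unipotent
upper triangular matrix makes `M` lower triangular. -/
lemma exists_mul_upper_eq_lower {M : Matrix (Idx m) (Idx m) k} (h : ∀ b, leadingMinor M b ≠ 0) :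
    ∃ W : Matrix (Idx m) (Idx m) k, (∀ a b, place b < place a → W a b = 0) ∧ (∀ a, W a a = 1) ∧
      ∀ a b, place a < place b → (M * W) a b = 0 := by
  -- The column with index `b` of the unipotent matrix solves a linear system whose matrix is the
  -- leading block before `b`.
  have h1 : ∀ b : Idx m, ∃ x : Idx m → k, (∀ a, place b < place a → x a = 0) ∧ x b = 1 ∧
      ∀ a, place a < place b → M.mulVec x a = 0 := by
    intro b
    let p : Idx m → Prop := fun a => place a < place b
    have hu : IsUnit (M.toSquareBlockProp p) :=
      (Matrix.isUnit_iff_isUnit_det _).mpr (isUnit_iff_ne_zero.mpr (h b))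
    obtain ⟨z, hz⟩ := (Matrix.mulVec_surjective_iff_isUnit.mpr hu) fun a => -M a b
    refine ⟨fun a => if ha : p a then z ⟨a, ha⟩ else if a = b then 1 else 0, ?_, ?_, ?_⟩
    · intro a hab
      have hp : ¬ p a := not_lt.mpr hab.le
      have hne : a ≠ b := by
        rintro rfl
        exact lt_irrefl _ hab
      simp [hp, hne]
    · have hp : ¬ p b := lt_irrefl _
      simp [hp]
    · intro a ha
      have h2 := congrFun hz ⟨a, ha⟩
      simp only [Matrix.mulVec, dotProduct, Matrix.toSquareBlockProp_def, Matrix.of_apply] at h2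
      simp only [Matrix.mulVec, dotProduct]
      rw [← Fintype.sum_subtype_add_sum_subtype p]
      have h3 : ∑ x : {x // p x}, M a x * (if hx : p x then z ⟨x, hx⟩ else
          if (x : Idx m) = b then 1 else 0) = -M a b := by
        rw [← h2]
        refine Finset.sum_congr rfl fun x _ => ?_
        rw [dif_pos x.2]
      have h4 : ∑ x : {x // ¬ p x}, M a x * (if hx : p x then z ⟨x, hx⟩ else
          if (x : Idx m) = b then 1 else 0) = M a b := by
        have hb : ¬ p b := lt_irrefl _
        rw [Finset.sum_eq_single (⟨b, hb⟩ : {x // ¬ p x})]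
        · simp [hb]
        · intro x _ hx
          have : (x : Idx m) ≠ b := fun h => hx (Subtype.ext h)
          simp [x.2, this]
        · simp
      rw [h3, h4, neg_add_cancel]
  choose x hx1 hx2 hx3 using h1
  refine ⟨Matrix.of fun a b => x b a, fun a b => hx1 b a, hx2, fun a b hab => ?_⟩
  exact hx3 b a hab

/-- The big cell: an element of `GSO` whose leading minors are nonzero is a product `n t u⁻¹`.
Comparing the supports of `Wᵀ J W` and of `Lᵀ J L = c Wᵀ J W`, where `g W = L`, shows that the
unipotent factor `W` found by elimination is an isometry. -/
theorem exists_bigCell_factorization (g : GSO m k) (h : ∀ b, leadingMinor (GSO.mat g) b ≠ 0) :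
    ∃ (n u : GSO m k) (s : kˣ) (t : Fin (m + 1) → kˣ), IsLowerUnipotent n ∧ IsUpperUnipotent u ∧
      g * u = n * torus s t := by
  obtain ⟨W, hW0, hW1, hL0⟩ := exists_mul_upper_eq_lower h
  obtain ⟨c, hc, hcdet⟩ := g.2
  set L := GSO.mat g * W with hL
  have hLW : L.transpose * gram m k * L = (c : k) • (W.transpose * gram m k * W) := by
    rw [hL, Matrix.transpose_mul]
    calc _ = W.transpose * ((GSO.mat g).transpose * gram m k * GSO.mat g) * W := by
          simp only [Matrix.mul_assoc]
      _ = _ := by rw [hc, Matrix.mul_smul, Matrix.smul_mul]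
  -- `Wᵀ J W` vanishes on one side of the antidiagonal because `W` is upper triangular, and on the
  -- other side because `L` is lower triangular.
  have hWW : W.transpose * gram m k * W = gram m k := by
    ext a b
    rw [transpose_mul_gram_mul_apply, gram_apply]
    rcases lt_trichotomy (place a) (place b.swap) with hab | hab | hab
    · have hne : a ≠ b.swap := by
        rintro rfl
        exact lt_irrefl _ hab
      rw [if_neg hne]
      refine Finset.sum_eq_zero fun x _ => ?_
      rcases lt_or_ge (place a) (place x) with hx | hx
      · rw [hW0 x a hx, zero_mul]
      · have hx' : place b < place x.swap := by
          rw [← Sum.swap_swap b, place_swap_lt_iff, Sum.swap_swap]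
          exact lt_of_le_of_lt hx hab
        rw [hW0 _ b hx', mul_zero]
    · have hab' := place_injective hab
      rw [if_pos hab', Finset.sum_eq_single a]
      · rw [hW1, eq_swap_comm.mp hab', hW1, mul_one]
      · intro x _ hxa
        rcases lt_or_ge (place a) (place x) with hx | hx
        · rw [hW0 x a hx, zero_mul]
        · have hx1 : place x < place a :=
            lt_of_le_of_ne hx fun h => hxa (place_injective h)
          have hx' : place b < place x.swap := by
            rw [← Sum.swap_swap b, place_swap_lt_iff, Sum.swap_swap, ← hab]
            exact hx1
          rw [hW0 _ b hx', mul_zero]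
      · simp
    · have hne : a ≠ b.swap := by
        rintro rfl
        exact lt_irrefl _ hab
      rw [if_neg hne]
      have h1 := congrFun (congrFun hLW a) b
      rw [Matrix.smul_apply, transpose_mul_gram_mul_apply, transpose_mul_gram_mul_apply,
        smul_eq_mul] at h1
      refine (mul_eq_zero.mp (h1.symm.trans ?_)).resolve_left c.ne_zero
      refine Finset.sum_eq_zero fun x _ => ?_
      rcases lt_or_ge (place x) (place a) with hx | hx
      · rw [hL0 x a hx, zero_mul]
      · have hx' : place x.swap < place b := by
          rw [place_swap_lt_iff]
          exact lt_of_lt_of_le hab hx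
        rw [hL0 _ b hx', mul_zero]
  have hdiag : ∀ a : Idx m, L a a * L a.swap a.swap = c := by
    intro a
    have h1 := congrFun (congrFun hLW a) a.swap
    rw [hWW, Matrix.smul_apply, transpose_mul_gram_mul_apply, gram_apply, Sum.swap_swap, if_pos rfl,
      Finset.sum_eq_single a, smul_eq_mul, mul_one] at h1
    · exact h1
    · intro x _ hxa
      rcases lt_or_ge (place x) (place a) with hx | hx
      · rw [hL0 x a hx, zero_mul]
      · have hx1 : place a < place x :=
          lt_of_le_of_ne hx fun h => hxa (place_injective h).symm
        have hx' : place x.swap < place a.swap := by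
          rw [place_swap_lt_iff, Sum.swap_swap]
          exact hx1
        rw [hL0 _ _ hx', mul_zero]
    · simp
  have hne : ∀ a : Idx m, L a a ≠ 0 := by
    intro a h0
    have := hdiag a
    rw [h0, zero_mul] at this
    exact c.ne_zero this.symm
  let u : GSO m k := GSO.ofMatrix W 1 (by rw [hWW, Units.val_one, one_smul])
    (by rw [det_eq_one_of_upper hW0 hW1, Units.val_one, one_pow])
  have hu : GSO.mat u = W := rfl
  let t : Fin (m + 1) → kˣ := fun i => Units.mk0 (L (Sum.inl i) (Sum.inl i)) (hne _)
  have ht : ∀ a, (torusEntry c t a : k) = L a a := by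
    intro a
    rcases a with i | i
    · simp [torusEntry, t]
    · have := hdiag (Sum.inl i)
      simp only [torusEntry, Sum.elim_inr, Units.val_mul, t, Units.val_inv_eq_inv_val,
        Units.val_mk0]
      rw [← this, mul_comm, inv_mul_cancel_left₀ (hne _)]
      rfl
  refine ⟨g * u * (torus c t)⁻¹, u, c, t, ?_, ?_, by rw [inv_mul_cancel_right]⟩
  · intro a b
    have hent : ∀ a b, GSO.mat (g * u * (torus c t)⁻¹) a b = L a b * (L b b)⁻¹ := by
      intro a b
      rw [GSO.mat_mul, GSO.mat_mul, torus_inv, Matrix.mul_diagonal, Units.val_inv_eq_inv_val, ht,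
        hu, hL]
    rw [hent, hent]
    exact ⟨fun hab => by rw [hL0 a b hab, zero_mul], mul_inv_cancel₀ (hne a)⟩
  · intro a b
    exact ⟨hW0 a b, hW1 a⟩

end BigCell

/-! ### Density of the big cell -/

section Density

variable {m : ℕ} {k : Type*} [Field k]

/-- The coordinates of `g` in which regular functions on `GSO` are polynomials. -/
def coords (g : GSO m k) : Option (Idx m × Idx m) → k :=
  fun o => o.elim (((g : GL (Idx m) k) : Matrix (Idx m) (Idx m) k).det)⁻¹
    (fun ab => ((g : GL (Idx m) k) : Matrix (Idx m) (Idx m) k) ab.1 ab.2)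

/-- The line from `u` to `v`. -/
def lineVec (u v : Idx m → k) (y : k) : Idx m → k := u + y • (v - u)

/-- The norm along the line from `u` to `v`, as a polynomial. -/
def linePoly (u v : Idx m → k) : k[X] :=
  ∑ a : Idx m, (C (u a) + X * C (v a - u a)) * (C (u a.swap) + X * C (v a.swap - u a.swap))

lemma eval_linePoly (u v : Idx m → k) (y : k) :
    (linePoly u v).eval y = bil (lineVec u v y) (lineVec u v y) := by
  simp [linePoly, bil, lineVec, eval_finsetSum]

lemma isRationalOn_refl_line {D : k[X]} {u v : Idx m → k} (h : linePoly u v ∣ D) (a b : Idx m) :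
    IsRationalOn D fun y => refl (lineVec u v y) a b := by
  have h1 : ∀ a, IsRationalOn D fun y => lineVec u v y a := fun a => by
    have h0 := isRationalOn_eval D (C (u a) + X * C (v a - u a))
    simp only [eval_add, eval_mul, eval_C, eval_X] at h0
    exact h0
  have h2 := (isRationalOn_const D ((1 : Matrix (Idx m) (Idx m) k) a b)).add
    (((isRationalOn_const D (-2)).mul (isRationalOn_inv h)).mul ((h1 a).mul (h1 b.swap)))
  convert h2 using 2 with y
  rw [eval_linePoly, refl, Matrix.sub_apply, Matrix.of_apply]
  ring

lemma isRationalOn_prod_refl_line {D : k[X]} {u : Idx m → k} {l : List (Idx m → k)}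
    (h : ∀ v ∈ l, linePoly u v ∣ D) (a b : Idx m) :
    IsRationalOn D fun y => (l.map fun v => refl (lineVec u v y)).prod a b := by
  induction l generalizing a b with
  | nil => exact isRationalOn_const D _
  | cons v l ih =>
    simp only [List.map_cons, List.prod_cons, Matrix.mul_apply]
    exact isRationalOn_sum _ fun x => (isRationalOn_refl_line (h v (by simp)) a x).mul
      (ih (fun w hw => h w (by simp [hw])) x b)

/-- Every similitude in `GSO` is a scalar multiple of a product of an even number of reflections. -/
lemma GSO.exists_reflections [IsAlgClosed k] [CharZero k] (g : GSO m k) :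
    ∃ (d : kˣ) (l : List (Idx m → k)), (∀ v ∈ l, bil v v ≠ 0) ∧ Even l.length ∧
      GSO.mat g = (d : k) • (l.map refl).prod := by
  obtain ⟨c, hc, hcdet⟩ := g.2
  obtain ⟨d₀, hd₀⟩ := IsAlgClosed.exists_pow_nat_eq (c : k) (n := 2) (by norm_num)
  have hd0 : d₀ ≠ 0 := by
    rintro rfl
    exact c.ne_zero (by rw [← hd₀]; simp)
  have hM : IsIsometry (d₀⁻¹ • GSO.mat g) := by
    unfold IsIsometry
    rw [Matrix.transpose_smul, Matrix.smul_mul, Matrix.smul_mul, Matrix.mul_smul, hc, smul_smul,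
      smul_smul, ← hd₀, pow_two]
    rw [show d₀⁻¹ * d₀⁻¹ * (d₀ * d₀) = 1 by field_simp, one_smul]
  obtain ⟨l, hl, hg⟩ := hM.exists_reflections
  refine ⟨Units.mk0 d₀ hd0, l, hl, ?_, ?_⟩
  · have h1 := det_list_prod_refl hl
    rw [← hg, Matrix.det_smul, hcdet, ← hd₀, Fintype.card_sum, Fintype.card_fin, ← pow_mul,
      ← two_mul, ← mul_pow, inv_mul_cancel₀ hd0, one_pow] at h1
    exact (neg_one_pow_eq_one_iff_even (by norm_num)).mp h1.symm
  · rw [← hg, Units.val_mk0, smul_smul, mul_inv_cancel₀ hd0, one_smul]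

/-- The big cell is dense in `GSO`: an element of `GSO` is joined to a scalar by a rational curve,
along which the reflecting vectors move on lines to a common vector; the leading minors do not
vanish at the scalar, hence they do not vanish at the general point of the curve. -/
theorem eval_coords_eq_zero_of_bigCell [IsAlgClosed k] [CharZero k]
    (P : MvPolynomial (Option (Idx m × Idx m)) k)
    (hP : ∀ g : GSO m k, (∀ b, leadingMinor (GSO.mat g) b ≠ 0) →
      MvPolynomial.eval (coords g) P = 0) (g : GSO m k) :
    MvPolynomial.eval (coords g) P = 0 := by
  obtain ⟨d, l, hl, heven, hg⟩ := GSO.exists_reflections g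
  let u : Idx m → k := orthoVec (Sum.inl 0)
  have hu : bil u u ≠ 0 := bil_orthoVec_ne_zero _
  let D : k[X] := (l.map (linePoly u)).prod
  have hdvd : ∀ v ∈ l, linePoly u v ∣ D := fun v hv =>
    List.dvd_prod (List.mem_map_of_mem hv)
  have hD : ∀ y, D.eval y ≠ 0 ↔ ∀ v ∈ l, bil (lineVec u v y) (lineVec u v y) ≠ 0 := by
    intro y
    simp only [D, eval_list_prod, List.map_map, ne_eq, List.prod_eq_zero_iff, List.mem_map,
      Function.comp_apply, eval_linePoly, not_exists, not_and]
  let γ : k → Matrix (Idx m) (Idx m) k :=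
    fun y => (d : k) • (l.map fun v => refl (lineVec u v y)).prod
  have hγ : ∀ a b, IsRationalOn D fun y => γ y a b := fun a b =>
    (isRationalOn_const D (d : k)).mul (isRationalOn_prod_refl_line hdvd a b)
  have hmap : ∀ y, (l.map fun v => refl (lineVec u v y)) =
      ((l.map fun v => lineVec u v y).map refl) := fun y => by rw [List.map_map]; rfl
  have hDl : ∀ y, D.eval y ≠ 0 → ∀ w ∈ l.map fun v => lineVec u v y, bil w w ≠ 0 := by
    intro y hy w hw
    obtain ⟨v, hv, rfl⟩ := List.mem_map.mp hw
    exact (hD y).mp hy v hv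
  have hdet : ∀ y, D.eval y ≠ 0 → (γ y).det = ((d ^ 2 : kˣ) : k) ^ (m + 1) := by
    intro y hy
    simp only [γ]
    rw [Matrix.det_smul, hmap, det_list_prod_refl (hDl y hy), List.length_map, heven.neg_one_pow,
      Fintype.card_sum, Fintype.card_fin, mul_one, ← two_mul, Units.val_pow_eq_pow_val, pow_mul]
  have hsim : ∀ y, D.eval y ≠ 0 →
      (γ y).transpose * gram m k * γ y = ((d ^ 2 : kˣ) : k) • gram m k := by
    intro y hy
    simp only [γ]
    have h1 : _ = gram m k := isIsometry_list_prod_refl (hDl y hy)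
    rw [hmap, Matrix.transpose_smul, Matrix.smul_mul, Matrix.smul_mul, Matrix.mul_smul, h1,
      smul_smul, Units.val_pow_eq_pow_val, pow_two]
  let x : k → Option (Idx m × Idx m) → k := fun y o =>
    o.elim (((d ^ 2 : kˣ) : k) ^ (m + 1))⁻¹ fun ab => γ y ab.1 ab.2
  have hx : ∀ y (hy : D.eval y ≠ 0),
      coords (GSO.ofMatrix (γ y) (d ^ 2) (hsim y hy) (hdet y hy)) = x y := by
    intro y hy
    ext o
    rcases o with _ | ⟨a, b⟩
    · exact congrArg _ (hdet y hy)
    · rfl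
  have hF : IsRationalOn D fun y => MvPolynomial.eval (x y) P := by
    refine isRationalOn_mvPolynomial_eval (fun o => ?_) P
    rcases o with _ | ⟨a, b⟩
    · exact isRationalOn_const D _
    · exact hγ a b
  have hG : IsRationalOn D fun y => ∏ b : Idx m, leadingMinor (γ y) b :=
    isRationalOn_prod _ fun b => isRationalOn_det fun i j => hγ _ _
  have hγ0 : γ 0 = (d : k) • 1 := by
    simp only [γ, lineVec, zero_smul, add_zero, List.map_const', List.prod_replicate]
    obtain ⟨r, hr⟩ := heven
    rw [hr, ← two_mul, pow_mul, pow_two, refl_mul_self hu, one_pow]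
  have hγ1 : γ 1 = GSO.mat g := by
    simp only [γ, lineVec, one_smul, add_sub_cancel]
    exact hg.symm
  have hD0 : D.eval 0 ≠ 0 := (hD 0).mpr fun v _ => by simpa [lineVec] using hu
  have hD1 : D.eval 1 ≠ 0 := (hD 1).mpr fun v hv => by simpa [lineVec] using hl v hv
  have hG0 : ∏ b : Idx m, leadingMinor (γ 0) b ≠ 0 := by
    refine Finset.prod_ne_zero_iff.mpr fun b _ => ?_
    have h1 : (γ 0).toSquareBlockProp (fun a => place a < place b) = (d : k) • 1 := by
      rw [hγ0]
      ext i j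
      simp [Matrix.toSquareBlockProp_def, Matrix.one_apply, Subtype.ext_iff]
    rw [leadingMinor, h1, Matrix.det_smul, Matrix.det_one, mul_one]
    exact pow_ne_zero _ d.ne_zero
  have key := hF.eq_zero hG hD0 hG0 (fun y hy hy' => by
    rw [← hx y hy]
    exact hP _ fun b => Finset.prod_ne_zero_iff.mp hy' b (Finset.mem_univ b)) hD1
  rw [← hx 1 hD1] at key
  have hg1 : GSO.ofMatrix (γ 1) (d ^ 2) (hsim 1 hD1) (hdet 1 hD1) = g := GSO.ext_mat hγ1
  rwa [hg1] at key

end Density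

/-! ### Root elements and irreducibility of the standard representation -/

section RootElements

variable {m : ℕ} {k : Type*} [Field k]

/-- The infinitesimal action of the root vector `E_{ab} - E_{b'a'}` of `GSO` on the standard
representation, where the prime exchanges dual basis vectors. -/
def rootMap (a b : Idx m) (x : Idx m → k) : Idx m → k :=
  Pi.single a (x b) - Pi.single b.swap (x a.swap)

/-- The matrix `1 + E_{ab} - E_{b'a'}` of a root element, as a product of two transvections. -/
def rootMatrix (k : Type*) [Field k] (a b : Idx m) : Matrix (Idx m) (Idx m) k :=
  Matrix.transvection a b 1 * Matrix.transvection b.swap a.swap (-1)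

lemma rootMatrix_eq (a b : Idx m) :
    rootMatrix k a b = 1 + Matrix.single a b 1 - Matrix.single b.swap a.swap 1 := by
  have h1 : (Matrix.single a b 1 * Matrix.single b.swap a.swap (-1) : Matrix (Idx m) (Idx m) k) =
      0 := Matrix.single_mul_single_of_ne _ _ _ _ (swap_ne_self b).symm _
  rw [rootMatrix, Matrix.transvection, Matrix.transvection, mul_add, add_mul, add_mul, h1]
  simp [sub_eq_add_neg, Matrix.single_neg]

lemma rootMatrix_mulVec (a b : Idx m) (x : Idx m → k) :
    (rootMatrix k a b).mulVec x = x + rootMap a b x := by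
  rw [rootMatrix_eq, Matrix.sub_mulVec, Matrix.add_mulVec, Matrix.one_mulVec, rootMap,
    Matrix.single_mulVec, Matrix.single_mulVec]
  simp [add_sub_assoc, Pi.single]

lemma vecMul_rootMatrix (a b : Idx m) (x : Idx m → k) :
    Matrix.vecMul x (rootMatrix k a b) = x + rootMap b a x := by
  rw [← Matrix.mulVec_transpose, ← rootMatrix_mulVec, rootMatrix_eq, rootMatrix_eq]
  simp

lemma rootMatrix_isIsometry {a b : Idx m} (h : b ≠ a) :
    IsIsometry (rootMatrix k a b) := by
  rw [isIsometry_iff]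
  intro v w
  rw [rootMatrix_mulVec, rootMatrix_mulVec]
  have hs : ∀ (c : Idx m) (z : k) (y : Idx m → k), bil (Pi.single c z) y = z * y c.swap := by
    intro c z y
    rw [bil, Finset.sum_eq_single c]
    · simp
    · intro d _ hd
      simp [hd]
    · simp
  have hs' : ∀ (c : Idx m) (z : k) (y : Idx m → k), bil y (Pi.single c z) = z * y c.swap :=
    fun c z y => by rw [bil_comm, hs]
  have h2 : a.swap ≠ b.swap := fun e => h (by
    have := congrArg Sum.swap e
    simpa using this.symm)
  simp only [rootMap, bil_add_left, bil_add_right, bil_sub_left, bil_sub_right, hs, hs',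
    Sum.swap_swap]
  simp [h, h2, swap_ne_self, (swap_ne_self _).symm]
  ring

/-- The element `1 + E_{ab} - E_{b'a'}` of a root subgroup of `GSO`. -/
def rootElt (k : Type*) [Field k] {a b : Idx m} (h : b ≠ a) : GSO m k :=
  GSO.ofMatrix (rootMatrix k a b) 1
    (by
      have : (rootMatrix k a b).transpose * gram m k * rootMatrix k a b = gram m k :=
        rootMatrix_isIsometry h
      rw [this, Units.val_one, one_smul])
    (by
      have h2 : b.swap ≠ a.swap := fun e => h (by
        have := congrArg Sum.swap e
        simpa using this)
      rw [rootMatrix, Matrix.det_mul, Matrix.det_transvection_of_ne _ _ h.symm,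
        Matrix.det_transvection_of_ne _ _ h2]
      simp)

lemma rootElt_mat {a b : Idx m} (h : b ≠ a) :
    GSO.mat (rootElt k h) = rootMatrix k a b := rfl

lemma exists_ne_ne_swap (hm : 0 < m) (b : Idx m) : ∃ a : Idx m, b ≠ a ∧ b ≠ a.swap := by
  obtain ⟨i, hi⟩ : ∃ i : Fin (m + 1), ∀ j, b = Sum.inl j ∨ b = Sum.inr j → j ≠ i := by
    have : Nontrivial (Fin (m + 1)) := Fin.nontrivial_iff_two_le.mpr (by omega)
    rcases b with b | b
    · obtain ⟨i, hi⟩ := exists_ne b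
      exact ⟨i, by rintro j (h | h) <;> simp_all [eq_comm]⟩
    · obtain ⟨i, hi⟩ := exists_ne b
      exact ⟨i, by rintro j (h | h) <;> simp_all [eq_comm]⟩
  refine ⟨Sum.inl i, fun h => hi i (Or.inl h) rfl, fun h => hi i (Or.inr h) rfl⟩

lemma rootMap_single {a c : Idx m} (h' : c ≠ a.swap) :
    rootMap a c (Pi.single c (1 : k)) = Pi.single a 1 := by
  simp [rootMap, h'.symm]

/-- The standard representation has no invariant subspaces, even for the Lie algebra spanned by the
root vectors. -/
lemma eq_top_of_rootMap_mem (hm : 0 < m) {W : Submodule k (Idx m → k)}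
    (h : ∀ a b : Idx m, b ≠ a → b ≠ a.swap → ∀ x ∈ W, rootMap a b x ∈ W)
    {x : Idx m → k} (hx : x ∈ W) (hx0 : x ≠ 0) : W = ⊤ := by
  obtain ⟨b, hb⟩ := Function.ne_iff.mp hx0
  -- Two root vectors in succession isolate the coordinate of `x` with index `b`.
  have h1 : Pi.single b.swap (1 : k) ∈ W := by
    obtain ⟨a, ha, ha'⟩ := exists_ne_ne_swap hm b
    have hab : a ≠ b.swap := fun e => ha' (eq_swap_comm.mp e)
    have h2 := h b.swap a hab (by simpa using ha.symm) _ (h a b ha ha' x hx)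
    have h3 : rootMap b.swap a (rootMap a b x) = x b • Pi.single b.swap (1 : k) := by
      ext c
      simp [rootMap, hab, ha, (swap_ne_self _).symm, Pi.single_apply]
    rw [h3] at h2
    exact (Submodule.smul_mem_iff _ hb).mp h2
  have h4 : ∀ c d : Idx m, Pi.single c (1 : k) ∈ W → c ≠ d → c ≠ d.swap →
      Pi.single d (1 : k) ∈ W := by
    intro c d hc hd hd'
    rw [← rootMap_single hd']
    exact h d c hd hd' _ hc
  have h5 : ∀ d : Idx m, Pi.single d (1 : k) ∈ W := by
    intro d
    by_cases hd : b.swap = d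
    · rw [← hd]
      exact h1
    by_cases hd' : b.swap = d.swap
    · obtain ⟨a, ha, ha'⟩ := exists_ne_ne_swap hm b.swap
      have hda : d = b := by
        have := congrArg Sum.swap hd'
        simpa using this.symm
      subst hda
      refine h4 a d (h4 _ a h1 ha ha') ?_ fun e => ha e.symm
      rintro rfl
      exact ha' rfl
    · exact h4 _ d h1 hd hd'
  rw [eq_top_iff]
  intro y _
  rw [pi_eq_sum_univ' y]
  refine Submodule.sum_mem _ fun c _ => W.smul_mem _ ?_
  convert h5 c using 1

lemma eq_top_of_mulVec_mem (hm : 0 < m) {W : Submodule k (Idx m → k)}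
    (h : ∀ g : GSO m k, ∀ x ∈ W, (GSO.mat g).mulVec x ∈ W)
    {x : Idx m → k} (hx : x ∈ W) (hx0 : x ≠ 0) : W = ⊤ := by
  refine eq_top_of_rootMap_mem hm (fun a b hab _ y hy => ?_) hx hx0
  have h1 := h (rootElt k hab) y hy
  rw [rootElt_mat, rootMatrix_mulVec] at h1
  exact (W.add_mem_iff_right hy).mp h1

lemma eq_top_of_vecMul_mem (hm : 0 < m) {W : Submodule k (Idx m → k)}
    (h : ∀ g : GSO m k, ∀ x ∈ W, Matrix.vecMul x (GSO.mat g) ∈ W)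
    {x : Idx m → k} (hx : x ∈ W) (hx0 : x ≠ 0) : W = ⊤ := by
  refine eq_top_of_rootMap_mem hm (fun a b hab _ y hy => ?_) hx hx0
  have h1 := h (rootElt k hab.symm) y hy
  rw [rootElt_mat, vecMul_rootMatrix] at h1
  exact (W.add_mem_iff_right hy).mp h1

end RootElements

/-! ### The standard representation of the L-group -/

section StandardRepresentation

variable (m : ℕ) (k : Type*) [Field k]

lemma frob_zpow_coe (n : ℤ) (g : GSO m k) :
    (((frob m k ^ n) g : GSO m k) : GL (Idx m) k) =
      swapLast m k ^ n * (g : GL (Idx m) k) * (swapLast m k ^ n)⁻¹ := by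
  have hinv : (swapLast m k)⁻¹ = swapLast m k := inv_eq_of_mul_eq_one_right (swapLast_mul_self m k)
  have h1 : ∀ g : GSO m k, ((frob m k g : GSO m k) : GL (Idx m) k) =
      swapLast m k * g * (swapLast m k)⁻¹ := by
    intro g
    rw [hinv]
    rfl
  have h2 : ∀ g : GSO m k, (((frob m k)⁻¹ g : GSO m k) : GL (Idx m) k) =
      (swapLast m k)⁻¹ * g * swapLast m k := by
    intro g
    rw [hinv]
    rfl
  induction n generalizing g with
  | zero => simp
  | succ n ih =>
    rw [zpow_add_one, MulAut.mul_apply, ih, h1, zpow_add_one]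
    simp only [mul_assoc, mul_inv_rev]
  | pred n ih =>
    rw [zpow_sub_one, MulAut.mul_apply, ih, h2, zpow_sub_one]
    simp only [mul_assoc, mul_inv_rev, inv_inv]

/-- The standard representation as a homomorphism to the general linear group; `σ` acts by the
permutation matrix `swapLast`. -/
def stdHom : LGroup m k →* GL (Idx m) k :=
  SemidirectProduct.lift (GSO m k).subtype (zpowersHom (GL (Idx m) k) (swapLast m k)) (by
    intro n
    ext1 g
    have h := frob_zpow_coe m k (Multiplicative.toAdd n) g
    rw [← MulAut.conj_apply, map_zpow] at h
    simpa [zpowersHom_apply] using h)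

/-- The standard representation of the L-group on `k ^ (2 n)`. -/
def stdRep : Representation k (LGroup m k) (Idx m → k) :=
  (Matrix.toLinAlgEquiv' : Matrix (Idx m) (Idx m) k ≃ₐ[k] _).toAlgHom.toRingHom.toMonoidHom.comp
    ((Units.coeHom _).comp (stdHom m k))

variable {m k}

lemma stdRep_inl (g : GSO m k) (x : Idx m → k) :
    stdRep m k (SemidirectProduct.inl g) x = (GSO.mat g).mulVec x := by
  simp [stdRep, stdHom]

lemma stdRep_withFrob_one (x : Idx m → k) :
    stdRep m k (withFrob 1) x = (swapLast m k : Matrix (Idx m) (Idx m) k).mulVec x := by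
  have : (withFrob 1 : LGroup m k) = SemidirectProduct.inr (Multiplicative.ofAdd 1) := rfl
  rw [this]
  simp [stdRep, stdHom, zpowersHom_apply]

lemma swapLast_mulVec (x : Idx m → k) (a : Idx m) :
    (swapLast m k : Matrix (Idx m) (Idx m) k).mulVec x a =
      x (Equiv.swap (Sum.inl (Fin.last m)) (Sum.inr (Fin.last m)) a) :=
  congrFun (Matrix.permMatrix_mulVec _) a

lemma torusChar_eVec (i : Fin (m + 1)) (s : kˣ) (t : Fin (m + 1) → kˣ) :
    torusChar (eVec i) s t = t i := by
  simp [torusChar, eVec, Pi.single_apply, Finset.prod_ite_eq', apply_ite]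

lemma mulVec_single_zero_of_upper {g : GSO m k} (hg : IsUpperUnipotent g) :
    (GSO.mat g).mulVec (Pi.single (Sum.inl 0) 1) = Pi.single (Sum.inl 0) 1 := by
  ext a
  rw [Matrix.mulVec_single_one, Matrix.col_apply]
  by_cases ha : a = Sum.inl 0
  · subst ha
    simpa using (hg (Sum.inl 0) (Sum.inl 0)).2
  · rw [Pi.single_eq_of_ne ha]
    refine (hg a _).1 ?_
    have h1 : place a ≠ place (Sum.inl 0 : Idx m) := fun h => ha (place_injective h)
    have h2 : place (Sum.inl 0 : Idx m) = 0 := rfl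
    omega

/-- The standard representation has highest weight `e₁^∨`. -/
theorem isHighestWeightRep_stdRep (hm : 0 < m) : IsHighestWeightRep (eVec 0) (stdRep m k) where
  algebraic := by
    intro w φ
    refine ⟨∑ a, ∑ b, MvPolynomial.C (φ (Pi.single a 1) * w b) *
      MvPolynomial.X (some (a, b)), fun g => ?_⟩
    rw [stdRep_inl, pi_eq_sum_univ' ((GSO.mat g).mulVec w), map_sum, map_sum]
    refine Finset.sum_congr rfl fun a _ => ?_
    rw [map_smul, map_sum, Matrix.mulVec, dotProduct, smul_eq_mul, Finset.sum_mul]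
    refine Finset.sum_congr rfl fun b _ => ?_
    simp
    ring
  irreducible :=
    { exists_pair_ne := by
        refine ⟨⊥, ⊤, fun h => ?_⟩
        have h1 : (Pi.single (Sum.inl 0) 1 : Idx m → k) ∈
            (⊥ : Subrepresentation ((stdRep m k).comp SemidirectProduct.inl)) := by
          rw [h]
          exact Submodule.mem_top
        have h2 : (Pi.single (Sum.inl 0) 1 : Idx m → k) = 0 := h1
        simpa using congrFun h2 (Sum.inl 0)
      eq_bot_or_eq_top := by
        intro W
        by_cases h : W.toSubmodule = ⊥
        · exact Or.inl (Subrepresentation.toSubmodule_injective h)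
        · obtain ⟨x, hx, hx0⟩ := Submodule.exists_mem_ne_zero_of_ne_bot h
          refine Or.inr (Subrepresentation.toSubmodule_injective
            (eq_top_of_mulVec_mem hm (fun g y hy => ?_) hx hx0))
          have h1 := W.apply_mem_toSubmodule g hy
          rw [← stdRep_inl]
          exact h1 }
  highest := by
    refine ⟨Pi.single (Sum.inl 0) 1, by simp, fun g hg => ?_, fun s t => ?_, ?_⟩
    · rw [stdRep_inl, mulVec_single_zero_of_upper hg]
    · rw [stdRep_inl, torus_mat, torusChar_eVec]
      ext a
      rw [Matrix.mulVec_diagonal]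
      by_cases ha : a = Sum.inl 0
      · subst ha
        simp [torusEntry]
      · simp [ha]
    · rw [stdRep_withFrob_one]
      ext a
      rw [swapLast_mulVec]
      have h1 : (Fin.last m) ≠ 0 := by
        rw [Ne, Fin.ext_iff]
        simp
        omega
      rcases a with a | a <;> by_cases ha : a = Fin.last m <;>
        simp [Equiv.swap_apply_def, Pi.single_apply, ha, h1]

end StandardRepresentation

/-! ### A functional invariant under lower unipotent elements -/

section LowestWeight

variable {m : ℕ} {k : Type*} [Field k]

lemma eval_aeval_polynomial {σ : Type*} (f : σ → k[X]) (P : MvPolynomial σ k) (y : k) :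
    (MvPolynomial.aeval f P).eval y = MvPolynomial.eval (fun o => (f o).eval y) P := by
  induction P using MvPolynomial.induction_on with
  | C a => simp
  | add P Q hP hQ => simp [hP, hQ]
  | mul_X P o hP => simp [hP]

/-- The common power of `X` in the entries of a nonzero polynomial matrix can be divided out. -/
lemma exists_eq_X_pow_mul {ι : Type*} (Q : ι → k[X]) (h : ∃ i, Q i ≠ 0) :
    ∃ (e : ℕ) (Q' : ι → k[X]), (∀ i, Q i = X ^ e * Q' i) ∧ ∃ i, (Q' i).eval 0 ≠ 0 := by
  obtain ⟨i₀, h⟩ := h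
  induction hn : (Q i₀).natDegree using Nat.strong_induction_on generalizing Q with
  | _ n ih =>
    by_cases h0 : ∃ i, (Q i).eval 0 ≠ 0
    · exact ⟨0, Q, fun i => by simp, h0⟩
    · push Not at h0
      have h1 : ∀ i, ∃ A, Q i = X * A := fun i =>
        X_dvd_iff.mpr (by rw [coeff_zero_eq_eval_zero, h0])
      choose A hA using h1
      have hA0 : A i₀ ≠ 0 := by
        intro h2
        exact h (by rw [hA, h2, mul_zero])
      obtain ⟨e, Q', h3, h4⟩ := ih (A i₀).natDegree (by
        rw [← hn, hA i₀, natDegree_X_mul hA0]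
        omega) A hA0 rfl
      exact ⟨e + 1, Q', fun i => by rw [hA, h3, pow_succ', mul_assoc], h4⟩

lemma eq_zero_of_eval_ne_zero [Infinite k] {Q : k[X]} (h : ∀ y, y ≠ 0 → Q.eval y = 0) : Q = 0 := by
  have h1 : X * Q = 0 := Polynomial.funext fun y => by
    by_cases hy : y = 0
    · simp [hy]
    · simp [h y hy]
  exact (mul_eq_zero.mp h1).resolve_left X_ne_zero

/-- The element `diag (y ^ place a)` of the torus. -/
def placeTorus (m : ℕ) {k : Type*} [Field k] (y : kˣ) : GSO m k :=
  torus (y ^ (2 * m + 1)) fun i => y ^ (i : ℕ)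

lemma torusEntry_placeTorus (y : kˣ) (a : Idx m) :
    torusEntry (y ^ (2 * m + 1)) (fun i => y ^ (i : ℕ)) a = y ^ place a := by
  rcases a with i | i
  · rfl
  · simp only [torusEntry, Sum.elim_inr, place]
    rw [mul_inv_eq_iff_eq_mul, ← pow_add, Nat.sub_add_cancel (by omega)]

lemma placeTorus_mat (y : kˣ) :
    GSO.mat (placeTorus m y) = Matrix.diagonal fun a => (y : k) ^ place a := by
  rw [placeTorus, torus_mat]
  simp only [torusEntry_placeTorus, Units.val_pow_eq_pow_val]

lemma placeTorus_inv_mat (y : kˣ) :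
    GSO.mat (placeTorus m y)⁻¹ = Matrix.diagonal fun a => ((y : k) ^ place a)⁻¹ := by
  rw [placeTorus, torus_inv]
  simp only [torusEntry_placeTorus, Units.val_inv_eq_inv_val, Units.val_pow_eq_pow_val]

lemma det_placeTorus (y : kˣ) :
    (GSO.mat (placeTorus m y)).det = ((y : k) ^ (2 * m + 1)) ^ (m + 1) := by
  rw [placeTorus_mat, Matrix.det_diagonal, Fintype.prod_sum_type, ← Finset.prod_mul_distrib]
  have h : ∀ i : Fin (m + 1), (y : k) ^ place (Sum.inl i : Idx m) *
      (y : k) ^ place (Sum.inr i : Idx m) = (y : k) ^ (2 * m + 1) := by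
    intro i
    rw [← pow_add]
    congr 1
    simp only [place, Sum.elim_inl, Sum.elim_inr]
    omega
  simp [h]

lemma det_isLowerUnipotent {n : GSO m k} (hn : IsLowerUnipotent n) : (GSO.mat n).det = 1 := by
  rw [← Matrix.det_transpose]
  exact det_eq_one_of_upper (fun a b hab => (hn b a).1 hab) fun a => (hn a a).2

/-- The curve `y ↦ a n a⁻¹`, for `a = diag (y ^ place a)` and `n` lower unipotent. It is a polynomial
curve, which passes through `1` for `y = 0`. -/
def contraction (n : GSO m k) (o : Option (Idx m × Idx m)) : k[X] :=
  o.elim 1 fun ab => C (GSO.mat n ab.1 ab.2) * X ^ (place ab.1 - place ab.2)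

lemma contraction_eval_zero {n : GSO m k} (hn : IsLowerUnipotent n)
    (o : Option (Idx m × Idx m)) : (contraction n o).eval 0 = coords (1 : GSO m k) o := by
  rcases o with _ | ⟨a, b⟩
  · simp [contraction, coords]
  · simp only [contraction, coords, Option.elim_some]
    change _ = (1 : Matrix (Idx m) (Idx m) k) a b
    rcases lt_trichotomy (place a) (place b) with h | h | h
    · have hne : a ≠ b := by
        rintro rfl
        exact lt_irrefl _ h
      rw [(hn a b).1 h, Matrix.one_apply_ne hne]
      simp
    · obtain rfl := place_injective h
      rw [(hn a a).2]
      simp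
    · have hne : a ≠ b := by
        rintro rfl
        exact lt_irrefl _ h
      have : place a - place b ≠ 0 := by omega
      simp [hne, this]

lemma contraction_eval {n : GSO m k} (hn : IsLowerUnipotent n) (y : kˣ)
    (o : Option (Idx m × Idx m)) :
    (contraction n o).eval (y : k) = coords (placeTorus m y * n * (placeTorus m y)⁻¹) o := by
  rcases o with _ | ⟨a, b⟩
  · simp only [contraction, coords, Option.elim_none, eval_one]
    change 1 = (GSO.mat (placeTorus m y * n * (placeTorus m y)⁻¹)).det⁻¹
    have h1 : (GSO.mat (placeTorus m y)).det * (GSO.mat (placeTorus m y)⁻¹).det = 1 := by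
      rw [← Matrix.det_mul, ← GSO.mat_mul, mul_inv_cancel, GSO.mat_one, Matrix.det_one]
    rw [GSO.mat_mul, GSO.mat_mul, Matrix.det_mul, Matrix.det_mul, det_isLowerUnipotent hn, mul_one,
      h1, inv_one]
  · simp only [contraction, coords, Option.elim_some]
    change _ = GSO.mat (placeTorus m y * n * (placeTorus m y)⁻¹) a b
    rw [GSO.mat_mul, GSO.mat_mul, placeTorus_inv_mat, placeTorus_mat, Matrix.mul_diagonal,
      Matrix.diagonal_mul]
    rcases lt_or_ge (place a) (place b) with h | h
    · rw [(hn a b).1 h]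
      simp
    · rw [eval_mul, eval_C, eval_pow, eval_X, pow_sub₀ _ y.ne_zero h]
      ring

variable {V : Type*} [AddCommGroup V] [Module k V]

/-- The matrix coefficients of `ρ` are regular functions. -/
def HasRegularCoefficients (ρ : Representation k (GSO m k) V) : Prop :=
  ∀ (w : V) (φ : Module.Dual k V), ∃ P : MvPolynomial (Option (Idx m × Idx m)) k,
    ∀ g : GSO m k, φ (ρ g w) = MvPolynomial.eval (coords g) P

/-- A lowest weight functional. The matrix of `diag (y ^ place a)` is, up to a power of `y`, a
polynomial matrix `A` with `A(0) ≠ 0`. As `y → 0`, conjugation by `diag (y ^ place a)` contracts the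
lower unipotent matrices to `1`, hence `A(0) ρ(n) = A(0)`, and the rows of `A(0)` are invariant. -/
theorem exists_lowerUnipotent_invariant [Infinite k] [Module.Finite k V] [Nontrivial V]
    {ρ : Representation k (GSO m k) V} (hρ : HasRegularCoefficients ρ) :
    ∃ φ : Module.Dual k V, φ ≠ 0 ∧ ∀ n : GSO m k, IsLowerUnipotent n → ∀ v, φ (ρ n v) = φ v := by
  let b := Module.finBasis k V
  let A : GSO m k → Matrix (Fin (Module.finrank k V)) (Fin (Module.finrank k V)) k :=
    fun g => LinearMap.toMatrix b b (ρ g)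
  have hAmul : ∀ g h, A (g * h) = A g * A h := fun g h => by
    simp only [A, map_mul, Module.End.mul_eq_comp]
    rw [LinearMap.toMatrix_comp b b b]
  have hA1 : A 1 = 1 := by simp only [A, map_one]; exact LinearMap.toMatrix_one b
  have hreg : ∀ i j, ∃ P : MvPolynomial (Option (Idx m × Idx m)) k, ∀ g : GSO m k,
      A g i j = MvPolynomial.eval (coords g) P := by
    intro i j
    obtain ⟨P, hP⟩ := hρ (b j) (b.coord i)
    exact ⟨P, fun g => by rw [← hP]; exact LinearMap.toMatrix_apply b b (ρ g) i j⟩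
  choose P hP using hreg
  have hpoly : ∀ i j, ∃ (M : ℕ) (Q : k[X]), ∀ y : kˣ,
      A (placeTorus m y) i j * (y : k) ^ M = Q.eval (y : k) := by
    intro i j
    have h1 : IsRationalOn X fun y : k => MvPolynomial.eval
        (fun o : Option (Idx m × Idx m) => o.elim (y⁻¹ ^ ((2 * m + 1) * (m + 1)))
          fun ab => if ab.1 = ab.2 then y ^ place ab.1 else 0) (P i j) := by
      refine isRationalOn_mvPolynomial_eval (fun o => ?_) _
      rcases o with _ | ⟨a, b⟩
      · have h2 := isRationalOn_prod (Finset.range ((2 * m + 1) * (m + 1)))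
          fun _ : ℕ => isRationalOn_inv (dvd_refl (X : k[X]))
        simpa using h2
      · by_cases hab : a = b
        · simpa [hab] using isRationalOn_eval (X : k[X]) (X ^ place b)
        · simpa [hab] using isRationalOn_const (X : k[X]) 0
    obtain ⟨M, Q, h⟩ := h1
    refine ⟨M, Q, fun y => ?_⟩
    have h2 := h y (by simp)
    rw [eval_X] at h2
    rw [← h2, hP]
    congr 1
    refine congrArg (fun x => MvPolynomial.eval x (P i j)) (funext fun o => ?_)
    rcases o with _ | ⟨a, b⟩
    · change (GSO.mat (placeTorus m y)).det⁻¹ = _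
      rw [det_placeTorus, ← pow_mul]
      simp
    · change GSO.mat (placeTorus m y) a b = _
      rw [placeTorus_mat, Matrix.diagonal_apply]
      rfl
  choose M Q hQ using hpoly
  -- A common exponent for all matrix entries.
  let N : ℕ := ∑ i, ∑ j, M i j
  have hMN : ∀ i j, M i j ≤ N := fun i j =>
    (Finset.single_le_sum (f := fun j => M i j) (fun _ _ => Nat.zero_le _)
      (Finset.mem_univ j)).trans (Finset.single_le_sum (f := fun i => ∑ j, M i j)
        (fun _ _ => Nat.zero_le _) (Finset.mem_univ i))
  have hQ' : ∀ i j (y : kˣ), A (placeTorus m y) i j * (y : k) ^ N =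
      (Q i j * X ^ (N - M i j)).eval (y : k) := by
    intro i j y
    rw [eval_mul, ← hQ, eval_pow, eval_X, mul_assoc, ← pow_add, Nat.add_sub_cancel' (hMN i j)]
  have hone : placeTorus m (1 : kˣ) = 1 := GSO.ext_mat (by rw [placeTorus_mat, GSO.mat_one]; simp)
  have hpos : 0 < Module.finrank k V := Module.finrank_pos
  obtain ⟨e, B, hB, ⟨i₀, j₀⟩, hB0⟩ := exists_eq_X_pow_mul
    (fun ij : Fin (Module.finrank k V) × Fin (Module.finrank k V) =>
      Q ij.1 ij.2 * X ^ (N - M ij.1 ij.2)) ⟨(⟨0, hpos⟩, ⟨0, hpos⟩), by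
        intro h0
        have h1 := hQ' ⟨0, hpos⟩ ⟨0, hpos⟩ 1
        rw [h0, hone, hA1] at h1
        simp at h1⟩
  have hAB : ∀ i j (y : kˣ), A (placeTorus m y) i j * (y : k) ^ N =
      (y : k) ^ e * (B (i, j)).eval (y : k) := by
    intro i j y
    rw [hQ', hB (i, j)]
    simp
  have hinv : ∀ n : GSO m k, IsLowerUnipotent n → ∀ j,
      ∑ l, (B (i₀, l)).eval 0 * A n l j = (B (i₀, j)).eval 0 := by
    intro n hn j
    let S : Fin (Module.finrank k V) → k[X] := fun l => MvPolynomial.aeval (contraction n) (P i₀ l)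
    have hS : ∀ (y : kˣ) l, (S l).eval (y : k) =
        A (placeTorus m y * n * (placeTorus m y)⁻¹) i₀ l := by
      intro y l
      simp only [S]
      rw [eval_aeval_polynomial, hP]
      simp only [contraction_eval hn]
    have hS0 : ∀ l, (S l).eval 0 = if i₀ = l then 1 else 0 := by
      intro l
      simp only [S]
      rw [eval_aeval_polynomial]
      simp only [contraction_eval_zero hn]
      change MvPolynomial.eval (coords 1) (P i₀ l) = _
      rw [← hP, hA1, Matrix.one_apply]
    have hpol : ∑ l, B (i₀, l) * C (A n l j) - ∑ l, S l * B (l, j) = 0 := by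
      refine eq_zero_of_eval_ne_zero fun y₀ hy₀ => ?_
      obtain ⟨y, rfl⟩ : ∃ y : kˣ, (y : k) = y₀ := ⟨Units.mk0 y₀ hy₀, rfl⟩
      have h1 : A (placeTorus m y) * A n =
          A (placeTorus m y * n * (placeTorus m y)⁻¹) * A (placeTorus m y) := by
        rw [← hAmul, ← hAmul, inv_mul_cancel_right]
      have h2 := congrFun (congrFun h1 i₀) j
      rw [Matrix.mul_apply, Matrix.mul_apply] at h2
      have h3 := congrArg (fun z => z * (y : k) ^ N) h2
      simp only [Finset.sum_mul] at h3
      have h4 : ∀ l, A (placeTorus m y) i₀ l * A n l j * (y : k) ^ N =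
          (y : k) ^ e * ((B (i₀, l)).eval (y : k) * A n l j) := by
        intro l
        rw [mul_right_comm, hAB, mul_assoc]
      have h5 : ∀ l, A (placeTorus m y * n * (placeTorus m y)⁻¹) i₀ l * A (placeTorus m y) l j *
          (y : k) ^ N = (y : k) ^ e * ((S l).eval (y : k) * (B (l, j)).eval (y : k)) := by
        intro l
        rw [mul_assoc, hAB, hS]
        ring
      simp only [h4, h5, ← Finset.mul_sum] at h3
      have h6 := mul_left_cancel₀ (pow_ne_zero e y.ne_zero) h3
      simp only [eval_sub, eval_finsetSum, eval_mul, eval_C]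
      rw [h6, sub_self]
    have h7 := congrArg (eval 0) hpol
    simp only [eval_sub, eval_finsetSum, eval_mul, eval_C, eval_zero, hS0] at h7
    rw [sub_eq_zero] at h7
    rw [h7]
    simp
  refine ⟨∑ l, (B (i₀, l)).eval 0 • b.coord l, fun h0 => hB0 ?_, fun n hn v => ?_⟩
  · have := LinearMap.congr_fun h0 (b j₀)
    simpa [Finsupp.single_apply] using this
  · suffices h : (∑ l, (B (i₀, l)).eval 0 • b.coord l) ∘ₗ ρ n =
        ∑ l, (B (i₀, l)).eval 0 • b.coord l from LinearMap.congr_fun h v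
    refine b.ext fun j => ?_
    have h1 := hinv n hn j
    rw [LinearMap.comp_apply]
    simp only [LinearMap.sum_apply, LinearMap.smul_apply, smul_eq_mul, Module.Basis.coord_apply,
      Module.Basis.repr_self]
    simpa [A, LinearMap.toMatrix_apply, Finsupp.single_apply] using h1

end LowestWeight

/-! ### Irreducible representations -/

section Irreducible

variable {k : Type*} [Field k] {V : Type*} [AddCommGroup V] [Module k V]

lemma eq_top_of_irreducible {G : Type*} [Group G] {ρ : Representation k G V}
    (hirr : Representation.IsIrreducible ρ) {W : Submodule k V}
    (h : ∀ g, ∀ v ∈ W, ρ g v ∈ W) {w : V} (hw : w ∈ W) (hw0 : w ≠ 0) : W = ⊤ := by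
  rcases hirr.eq_bot_or_eq_top ⟨W, fun g v hv => h g v hv⟩ with h1 | h1
  · have h2 : W = ⊥ := congrArg Subrepresentation.toSubmodule h1
    rw [h2, Submodule.mem_bot] at hw
    exact absurd hw hw0
  · exact congrArg Subrepresentation.toSubmodule h1

lemma eq_bot_of_irreducible {G : Type*} [Group G] {ρ : Representation k G V}
    (hirr : Representation.IsIrreducible ρ) {W : Submodule k V}
    (h : ∀ g, ∀ v ∈ W, ρ g v ∈ W) {w : V} (hw : w ∉ W) : W = ⊥ := by
  rcases hirr.eq_bot_or_eq_top ⟨W, fun g v hv => h g v hv⟩ with h1 | h1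
  · exact congrArg Subrepresentation.toSubmodule h1
  · have h2 : W = ⊤ := congrArg Subrepresentation.toSubmodule h1
    exact absurd (h2 ▸ Submodule.mem_top) hw

lemma span_orbit_eq_top {G : Type*} [Group G] {ρ : Representation k G V}
    (hirr : Representation.IsIrreducible ρ) {w : V} (hw : w ≠ 0) :
    Submodule.span k (Set.range fun g => ρ g w) = ⊤ := by
  refine eq_top_of_irreducible hirr (fun g v hv => ?_)
    (Submodule.subset_span ⟨1, by simp⟩) hw
  induction hv using Submodule.span_induction with
  | mem x hx =>
    obtain ⟨h, rfl⟩ := hx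
    exact Submodule.subset_span ⟨g * h, by simp⟩
  | zero => simp
  | add x y _ _ hx hy => simpa using add_mem hx hy
  | smul a x _ hx => simpa using Submodule.smul_mem _ a hx

end Irreducible

/-! ### Uniqueness of the representation with highest weight `e₁^∨` -/

section Uniqueness

variable {m : ℕ} {k : Type*} [Field k] [IsAlgClosed k] [CharZero k]
variable {V : Type*} [AddCommGroup V] [Module k V]

/-- On the big cell, the matrix coefficient of a highest weight vector of weight `e₁^∨` and a lowest
weight functional is a multiple of the upper left entry, and the big cell is dense. -/
theorem coefficient_eq {ρ : Representation k (GSO m k) V} (hρ : HasRegularCoefficients ρ)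
    {w : V} (hU : ∀ g : GSO m k, IsUpperUnipotent g → ρ g w = w)
    (hT : ∀ (s : kˣ) (t : Fin (m + 1) → kˣ), ρ (torus s t) w = (t 0 : k) • w)
    {φ : Module.Dual k V} (hφ : ∀ n : GSO m k, IsLowerUnipotent n → ∀ v, φ (ρ n v) = φ v)
    (g : GSO m k) : φ (ρ g w) = φ w * GSO.mat g (Sum.inl 0) (Sum.inl 0) := by
  obtain ⟨P, hP⟩ := hρ w φ
  have key := eval_coords_eq_zero_of_bigCell
    (P - MvPolynomial.C (φ w) * MvPolynomial.X (some (Sum.inl 0, Sum.inl 0))) (fun g hg => by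
      obtain ⟨n, u, s, t, hn, hu, hgu⟩ := exists_bigCell_factorization g hg
      have h1 : φ (ρ g w) = t 0 * φ w := by
        have h0 : ρ g w = ρ g (ρ u w) := by rw [hU u hu]
        rw [h0, ← Module.End.mul_apply, ← map_mul, hgu, map_mul, Module.End.mul_apply, hT,
          map_smul, map_smul, hφ n hn, smul_eq_mul]
      have h2 : GSO.mat g (Sum.inl 0) (Sum.inl 0) = t 0 := by
        have h3 := congrArg (fun x => (GSO.mat x).mulVec (Pi.single (Sum.inl 0) 1)) hgu
        simp only [GSO.mat_mul] at h3
        rw [← Matrix.mulVec_mulVec, mulVec_single_zero_of_upper hu] at h3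
        have h4 := congrFun h3 (Sum.inl 0)
        rw [Matrix.mulVec_single_one, Matrix.mulVec_single_one, Matrix.col_apply, Matrix.col_apply,
          torus_mat, Matrix.mul_diagonal, (hn _ (Sum.inl 0)).2] at h4
        simpa [torusEntry] using h4
      rw [map_sub, map_mul, MvPolynomial.eval_C, MvPolynomial.eval_X, ← hP, h1]
      change _ - φ w * GSO.mat g (Sum.inl 0) (Sum.inl 0) = 0
      rw [h2]
      ring) g
  rw [map_sub, map_mul, MvPolynomial.eval_C, MvPolynomial.eval_X, ← hP, sub_eq_zero] at key
  exact key

/-- Uniqueness of the irreducible representation of `GSO` of highest weight `e₁^∨`: a linear form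
with matrix coefficient `h ↦ h_{00}` exists, its translates yield the forms with matrix coefficients
`h ↦ h_{a0}`, and these are the coordinates of an isomorphism with the standard representation. -/
theorem exists_equiv_standard (hm : 0 < m) [Module.Finite k V]
    {ρ : Representation k (GSO m k) V} (hρ : HasRegularCoefficients ρ)
    (hirr : Representation.IsIrreducible ρ)
    {w : V} (hw : w ≠ 0) (hU : ∀ g : GSO m k, IsUpperUnipotent g → ρ g w = w)
    (hT : ∀ (s : kˣ) (t : Fin (m + 1) → kˣ), ρ (torus s t) w = (t 0 : k) • w) :
    ∃ T : V ≃ₗ[k] (Idx m → k), T w = Pi.single (Sum.inl 0) 1 ∧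
      ∀ g v, T (ρ g v) = (GSO.mat g).mulVec (T v) := by
  have : Nontrivial V := ⟨w, 0, hw⟩
  have hspan := span_orbit_eq_top hirr hw
  have hext : ∀ {E : Type _} [AddCommGroup E] [Module k E] (f f' : V →ₗ[k] E),
      (∀ g, f (ρ g w) = f' (ρ g w)) → f = f' := by
    intro E _ _ f f' h
    refine LinearMap.ext_on hspan ?_
    rintro _ ⟨g, rfl⟩
    exact h g
  obtain ⟨φ, hφ0, hφ⟩ := exists_lowerUnipotent_invariant hρ
  have hcoef := coefficient_eq hρ hU hT hφ
  have hφw : φ w ≠ 0 := by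
    intro h0
    refine hφ0 (hext φ 0 fun g => ?_)
    rw [hcoef, h0]
    simp
  -- The vectors `x` such that `h ↦ ∑ x_b h_{b0}` is a matrix coefficient of `w`.
  let R : Submodule k (Idx m → k) :=
    { carrier := {x | ∃ ψ : Module.Dual k V, ∀ h, ψ (ρ h w) = ∑ b, x b * GSO.mat h b (Sum.inl 0)}
      add_mem' := by
        rintro x y ⟨ψ, hψ⟩ ⟨ψ', hψ'⟩
        exact ⟨ψ + ψ', fun h => by simp [hψ, hψ', add_mul, Finset.sum_add_distrib]⟩
      zero_mem' := ⟨0, fun h => by simp⟩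
      smul_mem' := by
        rintro c x ⟨ψ, hψ⟩
        refine ⟨c • ψ, fun h => ?_⟩
        rw [LinearMap.smul_apply, hψ, smul_eq_mul, Finset.mul_sum]
        exact Finset.sum_congr rfl fun b _ => by rw [Pi.smul_apply, smul_eq_mul, mul_assoc] }
  have hR : R = ⊤ := by
    refine eq_top_of_vecMul_mem hm (x := Pi.single (Sum.inl 0) 1) ?_ ?_ (by simp)
    · rintro g x ⟨ψ, hψ⟩
      refine ⟨ψ ∘ₗ ρ g, fun h => ?_⟩
      rw [LinearMap.comp_apply, ← Module.End.mul_apply, ← map_mul, hψ]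
      have h1 := congrFun (Matrix.vecMul_vecMul x (GSO.mat g) (GSO.mat h)) (Sum.inl 0)
      exact h1.symm
    · refine ⟨(φ w)⁻¹ • φ, fun h => ?_⟩
      rw [LinearMap.smul_apply, hcoef, smul_eq_mul, inv_mul_cancel_left₀ hφw,
        Finset.sum_eq_single (Sum.inl 0)]
      · simp
      · intro b _ hb
        rw [Pi.single_eq_of_ne hb, zero_mul]
      · simp
  have hψ : ∀ a : Idx m, ∃ ψ : Module.Dual k V, ∀ h, ψ (ρ h w) = GSO.mat h a (Sum.inl 0) := by
    intro a
    have h1 : (Pi.single a 1 : Idx m → k) ∈ R := by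
      rw [hR]
      exact Submodule.mem_top
    obtain ⟨ψ, h2⟩ := h1
    refine ⟨ψ, fun h => ?_⟩
    rw [h2, Finset.sum_eq_single a]
    · simp
    · intro b _ hb
      rw [Pi.single_eq_of_ne hb, zero_mul]
    · simp
  choose ψ hψ using hψ
  let T : V →ₗ[k] (Idx m → k) := LinearMap.pi ψ
  have hTw : ∀ h, T (ρ h w) = (GSO.mat h).mulVec (Pi.single (Sum.inl 0) 1) := by
    intro h
    ext a
    rw [Matrix.mulVec_single_one, Matrix.col_apply]
    exact hψ a h
  have hequiv : ∀ g v, T (ρ g v) = (GSO.mat g).mulVec (T v) := by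
    intro g
    have h1 : T ∘ₗ ρ g = (GSO.mat g).mulVecLin ∘ₗ T := by
      refine LinearMap.ext_on hspan ?_
      rintro _ ⟨h, rfl⟩
      rw [LinearMap.comp_apply, LinearMap.comp_apply, ← Module.End.mul_apply, ← map_mul]
      simp only [Matrix.mulVecLin_apply]
      rw [hTw, hTw, GSO.mat_mul, Matrix.mulVec_mulVec]
    exact LinearMap.congr_fun h1
  have hT1 : T w = Pi.single (Sum.inl 0) 1 := by
    have h1 := hTw 1
    rw [map_one, GSO.mat_one, Matrix.one_mulVec] at h1
    exact h1
  have hker : LinearMap.ker T = ⊥ := by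
    refine eq_bot_of_irreducible hirr (w := w) (fun g v hv => ?_) ?_
    · rw [LinearMap.mem_ker] at hv ⊢
      rw [hequiv, hv, Matrix.mulVec_zero]
    · rw [LinearMap.mem_ker, hT1]
      simp
  have hrange : LinearMap.range T = ⊤ := by
    refine eq_top_of_mulVec_mem hm (x := Pi.single (Sum.inl 0) 1) ?_ ⟨w, hT1⟩ (by simp)
    rintro g _ ⟨v, rfl⟩
    exact ⟨ρ g v, hequiv g v⟩
  exact ⟨LinearEquiv.ofBijective T ⟨LinearMap.ker_eq_bot.mp hker, LinearMap.range_eq_top.mp hrange⟩,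
    hT1, hequiv⟩

end Uniqueness

/-! ### The extension to the L-group -/

section Extension

variable {m : ℕ} {k : Type u} [Field k] [IsAlgClosed k] [CharZero k]
variable {V : Type v} [AddCommGroup V] [Module k V] [Module.Finite k V]

/-- Every extension to the L-group with trivial action of `σ` on the highest weight line is isomorphic
to the standard representation. -/
theorem IsHighestWeightRep.exists_equiv_stdRep (hm : 0 < m) {r : Representation k (LGroup m k) V}
    (hr : IsHighestWeightRep (eVec 0) r) :
    ∃ T : V ≃ₗ[k] (Idx m → k),
      (∀ g v, T (r (SemidirectProduct.inl g) v) = (GSO.mat g).mulVec (T v)) ∧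
      ∀ g v, T (r (withFrob g) v) =
        (GSO.mat g * (swapLast m k : Matrix (Idx m) (Idx m) k)).mulVec (T v) := by
  obtain ⟨w, hw, hU, hT, hσ⟩ := hr.highest
  let ρ : Representation k (GSO m k) V := r.comp SemidirectProduct.inl
  obtain ⟨T, hTw, hTg⟩ := exists_equiv_standard hm (ρ := ρ) hr.algebraic hr.irreducible hw hU
    (fun s t => by
      have h1 := hT s t
      rw [torusChar_eVec] at h1
      exact h1)
  have hspan := span_orbit_eq_top (ρ := ρ) hr.irreducible hw
  have h0 : (swapLast m k : Matrix (Idx m) (Idx m) k).mulVec (Pi.single (Sum.inl 0) 1) =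
      Pi.single (Sum.inl 0) 1 := by
    have h1 : (Fin.last m) ≠ 0 := by
      rw [Ne, Fin.ext_iff]
      simp
      omega
    ext a
    rw [swapLast_mulVec]
    rcases a with a | a <;> by_cases ha : a = Fin.last m <;>
      simp [Equiv.swap_apply_def, Pi.single_apply, ha, h1]
  have hσT : ∀ v, T (r (withFrob 1) v) =
      (swapLast m k : Matrix (Idx m) (Idx m) k).mulVec (T v) := by
    have h1 : T.toLinearMap ∘ₗ r (withFrob 1) =
        (swapLast m k : Matrix (Idx m) (Idx m) k).mulVecLin ∘ₗ T.toLinearMap := by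
      refine LinearMap.ext_on hspan ?_
      rintro _ ⟨h, rfl⟩
      have h2 : (withFrob 1 : LGroup m k) * SemidirectProduct.inl h =
          SemidirectProduct.inl (frob m k h) * withFrob 1 := by
        ext1 <;> simp [withFrob]
      have h3 : r (withFrob 1) (ρ h w) = ρ (frob m k h) w := by
        change r (withFrob 1) (r (SemidirectProduct.inl h) w) =
          r (SemidirectProduct.inl (frob m k h)) w
        rw [← Module.End.mul_apply, ← map_mul, h2, map_mul, Module.End.mul_apply, hσ]
      have h4 : GSO.mat (frob m k h) = (swapLast m k : Matrix (Idx m) (Idx m) k) * GSO.mat h *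
          (swapLast m k : Matrix (Idx m) (Idx m) k) := rfl
      simp only [LinearMap.comp_apply, LinearEquiv.coe_coe, Matrix.mulVecLin_apply]
      rw [h3, hTg, hTg, hTw, h4, ← Matrix.mulVec_mulVec, h0, ← Matrix.mulVec_mulVec]
    exact LinearMap.congr_fun h1
  refine ⟨T, hTg, fun g v => ?_⟩
  have h1 : (withFrob g : LGroup m k) = SemidirectProduct.inl g * withFrob 1 := by
    ext1 <;> simp [withFrob]
  rw [h1, map_mul, Module.End.mul_apply, ← Matrix.mulVec_mulVec, ← hσT]
  exact hTg _ _

end Extension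

/-! ### Weights of the standard representation -/

section Weights

variable {m : ℕ}

/-- The weights of the standard representation. -/
def stdWeight (a : Idx m) : Lat (m + 1) :=
  Sum.elim (fun i => eVec i) (fun i => eZero (m + 1) - eVec i) a

lemma torusChar_stdWeight {k : Type*} [Field k] (a : Idx m) (s : kˣ) (t : Fin (m + 1) → kˣ) :
    torusChar (stdWeight a) s t = torusEntry s t a := by
  rcases a with i | i
  · exact torusChar_eVec i s t
  · simp only [stdWeight, Sum.elim_inr, torusChar, eZero, eVec, torusEntry, Prod.fst_sub,
      Prod.snd_sub, sub_zero, zpow_one, zero_sub, Pi.neg_apply]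
    rw [Finset.prod_eq_single i]
    · simp
    · intro j _ hj
      simp [hj]
    · simp

lemma torusChar_injective {k : Type*} [Field k] [CharZero k] {x y : Lat (m + 1)}
    (h : ∀ (s : kˣ) (t : Fin (m + 1) → kˣ), torusChar x s t = torusChar y s t) : x = y := by
  let z : kˣ := Units.mk0 2 two_ne_zero
  have hz : ∀ a b : ℤ, z ^ a = z ^ b → a = b := fun a b hab =>
    two_zpow_injective (F := k) (by simpa [z] using congrArg (fun u : kˣ => (u : k)) hab)
  refine Prod.ext ?_ ?_
  · exact hz _ _ (by simpa [torusChar] using h z 1)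
  · ext i
    have h1 := h 1 (Function.update 1 i z)
    have h2 : ∀ x : Lat (m + 1), torusChar x 1 (Function.update 1 i z) = z ^ x.2 i := by
      intro x
      rw [torusChar, one_zpow, one_mul, Finset.prod_eq_single i]
      · simp
      · intro j _ hj
        simp [hj]
      · simp
    rw [h2, h2] at h1
    exact hz _ _ h1

lemma stdWeight_injective : Function.Injective (stdWeight : Idx m → Lat (m + 1)) := by
  rintro (i | i) (j | j) h
  · have h1 := congrFun (congrArg Prod.snd h) i
    by_cases hij : i = j
    · rw [hij]
    · simp [stdWeight, eVec, hij] at h1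
  · have h1 := congrArg Prod.fst h
    simp [stdWeight, eVec, eZero] at h1
  · have h1 := congrArg Prod.fst h
    simp [stdWeight, eVec, eZero] at h1
  · have h1 := congrFun (congrArg Prod.snd h) i
    by_cases hij : i = j
    · rw [hij]
    · simp [stdWeight, eVec, eZero, hij] at h1

variable {k : Type u} [Field k] [CharZero k]
variable {V : Type v} [AddCommGroup V] [Module k V]
  {r : Representation k (LGroup m k) V}

lemma mem_weightSpace_iff {T : V ≃ₗ[k] (Idx m → k)}
    (hT : ∀ g v, T (r (SemidirectProduct.inl g) v) = (GSO.mat g).mulVec (T v))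
    {x : Lat (m + 1)} {v : V} :
    v ∈ weightSpace r x ↔ ∀ a, T v a ≠ 0 → x = stdWeight a := by
  have h1 : v ∈ weightSpace r x ↔ ∀ (s : kˣ) (t : Fin (m + 1) → kˣ) (a : Idx m),
      (torusEntry s t a : k) * T v a = torusChar x s t * T v a := by
    simp only [weightSpace, Submodule.mem_iInf, LinearMap.mem_ker, LinearMap.sub_apply,
      LinearMap.smul_apply, LinearMap.id_apply, sub_eq_zero]
    refine forall_congr' fun s => forall_congr' fun t => ?_
    rw [← T.injective.eq_iff, hT, torus_mat, map_smul, funext_iff]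
    simp only [Matrix.mulVec_diagonal, Pi.smul_apply, smul_eq_mul]
  rw [h1]
  constructor
  · intro h a ha
    refine torusChar_injective (k := k) fun s t => ?_
    rw [torusChar_stdWeight]
    exact Units.ext (mul_right_cancel₀ ha (h s t a)).symm
  · intro h s t a
    by_cases ha : T v a = 0
    · rw [ha, mul_zero, mul_zero]
    · rw [h a ha, torusChar_stdWeight]

lemma weightSpace_ne_bot_iff {T : V ≃ₗ[k] (Idx m → k)}
    (hT : ∀ g v, T (r (SemidirectProduct.inl g) v) = (GSO.mat g).mulVec (T v))
    (x : Lat (m + 1)) : weightSpace r x ≠ ⊥ ↔ ∃ a, x = stdWeight a := by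
  constructor
  · intro h
    obtain ⟨v, hv, hv0⟩ := Submodule.exists_mem_ne_zero_of_ne_bot h
    have h1 : T v ≠ 0 := fun h2 => hv0 (T.map_eq_zero_iff.mp h2)
    obtain ⟨a, ha⟩ := Function.ne_iff.mp h1
    exact ⟨a, (mem_weightSpace_iff hT).mp hv a ha⟩
  · rintro ⟨a, rfl⟩ h
    have h1 : T.symm (Pi.single a 1) ∈ weightSpace r (stdWeight a) := by
      rw [mem_weightSpace_iff hT]
      intro b hb
      rw [T.apply_symm_apply] at hb
      by_contra hne
      exact hb (Pi.single_eq_of_ne (fun hba => hne (by rw [hba])) _)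
    rw [h, Submodule.mem_bot, LinearEquiv.map_eq_zero_iff] at h1
    simpa using congrFun h1 a

lemma finrank_weightSpace {T : V ≃ₗ[k] (Idx m → k)}
    (hT : ∀ g v, T (r (SemidirectProduct.inl g) v) = (GSO.mat g).mulVec (T v)) (a : Idx m) :
    Module.finrank k (weightSpace r (stdWeight a)) = 1 := by
  have h1 : T.symm (Pi.single a 1) ∈ weightSpace r (stdWeight a) := by
    rw [mem_weightSpace_iff hT]
    intro b hb
    rw [T.apply_symm_apply] at hb
    by_contra hne
    exact hb (Pi.single_eq_of_ne (fun hba => hne (by rw [hba])) _)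
  refine (finrank_eq_one_iff_of_nonzero' (⟨_, h1⟩ : weightSpace r (stdWeight a)) ?_).mpr ?_
  · intro h2
    have h3 := congrArg Subtype.val h2
    simp only [Submodule.coe_zero, LinearEquiv.map_eq_zero_iff] at h3
    simpa using congrFun h3 a
  · rintro ⟨v, hv⟩
    refine ⟨T v a, Subtype.ext (T.injective ?_)⟩
    rw [Submodule.coe_smul, map_smul, T.apply_symm_apply]
    ext b
    by_cases hb : b = a
    · subst hb
      simp
    · rw [Pi.smul_apply, Pi.single_eq_of_ne hb, smul_zero]
      by_contra h4
      exact hb (stdWeight_injective ((mem_weightSpace_iff hT).mp hv b (Ne.symm h4))).symm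

end Weights

/-! ### The Hecke polynomial -/

section HeckePolynomial

variable {m : ℕ}

lemma swapLast_apply {k : Type*} [Field k] (a b : Idx m) :
    (swapLast m k : Matrix (Idx m) (Idx m) k) a b =
      if Equiv.swap (Sum.inl (Fin.last m)) (Sum.inr (Fin.last m)) a = b then 1 else 0 := by
  change (Equiv.swap (Sum.inl (Fin.last m)) (Sum.inr (Fin.last m)) :
      Equiv.Perm (Idx m)).permMatrix k a b = _
  simp [Equiv.Perm.permMatrix, PEquiv.toMatrix_apply, eq_comm]

/-- The characteristic matrix is block diagonal, with one block of size two for each pair of dual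
basis vectors. -/
lemma charpoly_diagonal_mul_swapLast {k : Type*} [Field k] (d : Idx m → k) :
    (Matrix.diagonal d * (swapLast m k : Matrix (Idx m) (Idx m) k)).charpoly =
      (X ^ 2 - C (d (Sum.inl (Fin.last m)) * d (Sum.inr (Fin.last m)))) *
        ∏ i : Fin m, ((X - C (d (Sum.inl i.castSucc))) * (X - C (d (Sum.inr i.castSucc)))) := by
  let e : Fin 2 × Fin (m + 1) ≃ Idx m :=
    (finTwoEquiv.prodCongr (Equiv.refl _)).trans (Equiv.boolProdEquivSum _)
  have he0 : ∀ i, e (0, i) = Sum.inl i := fun i => rfl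
  have he1 : ∀ i, e (1, i) = Sum.inr i := fun i => rfl
  let N : Fin (m + 1) → Matrix (Fin 2) (Fin 2) k[X] := fun i =>
    if i = Fin.last m then !![X, -C (d (Sum.inl i)); -C (d (Sum.inr i)), X]
    else !![X - C (d (Sum.inl i)), 0; 0, X - C (d (Sum.inr i))]
  have h : (Matrix.charmatrix
      (Matrix.diagonal d * (swapLast m k : Matrix (Idx m) (Idx m) k))).submatrix e e =
      Matrix.blockDiagonal N := by
    have hsw : ∀ a b : Idx m, Matrix.charmatrix
        (Matrix.diagonal d * (swapLast m k : Matrix (Idx m) (Idx m) k)) a b =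
        (if a = b then X else 0) - C (d a *
          if Equiv.swap (Sum.inl (Fin.last m)) (Sum.inr (Fin.last m)) a = b then 1 else 0) := by
      intro a b
      rw [Matrix.charmatrix_apply, Matrix.diagonal_mul, swapLast_apply, Matrix.diagonal_apply]
    ext1 ⟨x, i⟩ ⟨y, j⟩
    rw [Matrix.submatrix_apply, hsw, Matrix.blockDiagonal_apply]
    simp only [N]
    fin_cases x <;> fin_cases y <;>
      simp only [Fin.zero_eta, Fin.mk_one, he0, he1] <;>
      by_cases hi : i = Fin.last m <;> by_cases hij : i = j <;>
      simp [Equiv.swap_apply_def, hi, hij] <;> simp_all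
  rw [Matrix.charpoly, ← Matrix.det_submatrix_equiv_self e, h, Matrix.det_blockDiagonal,
    Fin.prod_univ_castSucc, mul_comm]
  congr 1
  · simp only [N, if_true, Matrix.det_fin_two_of, C_mul]
    ring
  · refine Finset.prod_congr rfl fun i _ => ?_
    simp only [N, Fin.castSucc_ne_last, if_false, Matrix.det_fin_two_of]
    ring

lemma pairing_rho_eVec_zero : pairing (rho m) (eVec 0) = m := by
  simp [pairing, rho, eVec, Pi.single_apply]

theorem heckePolyAt_torus {k : Type u} [Field k] {V : Type v} [AddCommGroup V] [Module k V]
    [Module.Finite k V] {r : Representation k (LGroup m k) V} {T : V ≃ₗ[k] (Idx m → k)}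
    (hT : ∀ g v, T (r (withFrob g) v) =
      (GSO.mat g * (swapLast m k : Matrix (Idx m) (Idx m) k)).mulVec (T v))
    (p : ℕ) (s : kˣ) (t : Fin (m + 1) → kˣ) :
    heckePolyAt p (eVec 0) r (torus s t) =
      (X ^ 2 - C ((p : k) ^ (2 * m) * (s : k))) *
        ∏ i : Fin m, ((X - C ((p : k) ^ m * (t i.castSucc : k))) *
          (X - C ((p : k) ^ m * ((s : k) * (t i.castSucc : k)⁻¹)))) := by
  have h1 : T.conj ((p : k) ^ m • r (withFrob (torus s t))) =
      Matrix.toLin' (Matrix.diagonal (fun a => (p : k) ^ m * (torusEntry s t a : k)) *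
        (swapLast m k : Matrix (Idx m) (Idx m) k)) := by
    refine LinearMap.ext fun x => ?_
    have h2 : (Matrix.diagonal fun a => (p : k) ^ m * (torusEntry s t a : k)) =
        (p : k) ^ m • GSO.mat (torus s t) := by
      rw [torus_mat]
      ext a b
      by_cases hab : a = b
      · subst hab
        simp
      · simp [hab]
    rw [h2, Matrix.smul_mul, Matrix.toLin'_apply,
      LinearEquiv.conj_apply_apply, LinearMap.smul_apply, map_smul, hT, T.apply_symm_apply, Matrix.smul_mulVec]
  rw [heckePolyAt, pairing_rho_eVec_zero, zpow_natCast, ← LinearEquiv.charpoly_conj T, h1,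
    Matrix.charpoly_toLin', charpoly_diagonal_mul_swapLast]
  congr 2
  · congr 1
    simp only [torusEntry, Sum.elim_inl, Sum.elim_inr, Units.val_mul, Units.val_inv_eq_inv_val]
    have := (t (Fin.last m)).ne_zero
    field_simp
    ring
  · simp [torusEntry]

lemma inclS_eZero : inclS (eZero m) = eZero (m + 1) := by
  refine Prod.ext rfl ?_
  ext i
  refine Fin.lastCases ?_ (fun i => ?_) i <;> simp [inclS, eZero]

lemma inclS_eVec (i : Fin m) : inclS (eVec i) = eVec i.castSucc := by
  refine Prod.ext rfl ?_
  ext j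
  refine Fin.lastCases ?_ (fun j => ?_) j
  · simp [inclS, eVec, (Fin.castSucc_ne_last i).symm]
  · simp [inclS, eVec, Pi.single_apply]

lemma inclS_sub (ν ν' : Lat m) : inclS (ν - ν') = inclS ν - inclS ν' := by
  refine Prod.ext rfl ?_
  ext j
  refine Fin.lastCases ?_ (fun j => ?_) j <;> simp [inclS]

lemma inclS_injective : Function.Injective (inclS : Lat m → Lat (m + 1)) := by
  intro ν ν' h
  refine Prod.ext (congrArg Prod.fst h :) ?_
  ext j
  simpa [inclS] using congrFun (congrArg Prod.snd h) j.castSucc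

section Evaluation

variable {k : Type*} [Field k] [CharZero k]

lemma evalTorus_smul_hMon (s : kˣ) (t : Fin (m + 1) → kˣ) (q : ℚ) (ν : Lat m) :
    evalTorus s t (q • hMon ν) = (q : k) * (torusChar (inclS ν) s t : k) := by
  rw [map_smul, Algebra.smul_def, eq_ratCast, hMon, evalTorus, AddMonoidAlgebra.lift_single,
    one_smul]
  rfl

/-- The character of the maximal torus attached to `ν`, as a monoid homomorphism. -/
def torusHom (k : Type*) [Field k] (ν : Lat m) : kˣ × (Fin (m + 1) → kˣ) →* k where
  toFun x := (torusChar (inclS ν) x.1 x.2 : k)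
  map_one' := by simp [torusChar]
  map_mul' x y := by
    rw [← Units.val_mul]
    congr 1
    simp only [torusChar, Prod.fst_mul, Prod.snd_mul, Pi.mul_apply, mul_zpow,
      Finset.prod_mul_distrib]
    exact mul_mul_mul_comm _ _ _ _

/-- The points of the torus separate the elements of the group algebra, as distinct characters are
linearly independent. -/
lemma eq_of_evalTorus_eq {a b : GroupAlg m}
    (h : ∀ (s : kˣ) (t : Fin (m + 1) → kˣ), evalTorus s t a = evalTorus s t b) : a = b := by
  have hinj : Function.Injective (torusHom k : Lat m → _) := by
    intro ν ν' hν
    refine inclS_injective (torusChar_injective (k := k) fun s t => Units.ext ?_)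
    exact DFunLike.congr_fun hν (s, t)
  have hli := (linearIndependent_monoidHom (kˣ × (Fin (m + 1) → kˣ)) k).comp _ hinj
  rw [linearIndependent_iff] at hli
  have h0 := hli ((a - b).coeff.mapRange (algebraMap ℚ k) (map_zero _)) (by
    rw [Finsupp.linearCombination_apply, Finsupp.sum_mapRange_index (by simp)]
    ext ⟨s, t⟩
    have h1 : evalTorus s t (a - b) = 0 := by rw [map_sub, h, sub_self]
    rw [evalTorus, AddMonoidAlgebra.lift_apply] at h1
    rw [Pi.zero_apply, ← h1, Finsupp.sum, Finsupp.sum, Finset.sum_apply]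
    exact Finset.sum_congr rfl fun ν _ => (Algebra.smul_def _ _).symm)
  have h1 : (a - b).coeff = 0 := by
    ext ν
    have h2 : (((a - b).coeff ν : ℚ) : k) = 0 := by simpa using DFunLike.congr_fun h0 ν
    exact Rat.cast_eq_zero.mp h2
  rw [AddMonoidAlgebra.coeff_sub, sub_eq_zero] at h1
  exact AddMonoidAlgebra.ext h1

lemma IsHeckePolynomial.unique {k : Type u} [Field k] [CharZero k] {V : Type v} [AddCommGroup V]
    [Module k V] [Module.Finite k V] {p : ℕ} {μ : Lat (m + 1)} {r : Representation k (LGroup m k) V}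
    {H H' : (GroupAlg m)[X]} (h : IsHeckePolynomial p μ r H) (h' : IsHeckePolynomial p μ r H') :
    H' = H := by
  ext1 n
  refine eq_of_evalTorus_eq (k := k) fun s t => ?_
  have h1 := congrArg (fun P => P.coeff n) ((h' s t).trans (h s t).symm)
  simp only [coeff_map] at h1
  exact h1

end Evaluation

/-- The Hecke polynomial before the twist. -/
def heckePolynomial (p m : ℕ) : (GroupAlg m)[X] :=
  (X ^ 2 - C ((p : ℚ) ^ (2 * m) • hMon (eZero m))) *
    ∏ i : Fin m, ((X - C ((p : ℚ) ^ m • hMon (eVec i))) *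
      (X - C ((p : ℚ) ^ m • hMon (eZero m - eVec i))))

theorem isHeckePolynomial_heckePolynomial {k : Type u} [Field k] [CharZero k] {V : Type v}
    [AddCommGroup V] [Module k V] [Module.Finite k V] {r : Representation k (LGroup m k) V}
    {T : V ≃ₗ[k] (Idx m → k)}
    (hT : ∀ g v, T (r (withFrob g) v) =
      (GSO.mat g * (swapLast m k : Matrix (Idx m) (Idx m) k)).mulVec (T v)) (p : ℕ) :
    IsHeckePolynomial p (eVec 0) r (heckePolynomial p m) := by
  intro s t
  have h0 : torusChar (eZero (m + 1)) s t = s := by simp [torusChar, eZero]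
  have h1 : ∀ i : Fin m, torusChar (eZero (m + 1) - eVec i.castSucc) s t =
      s * (t i.castSucc)⁻¹ := fun i => torusChar_stdWeight (Sum.inr i.castSucc) s t
  rw [heckePolyAt_torus hT, heckePolynomial]
  simp only [Polynomial.map_mul, Polynomial.map_prod, Polynomial.map_sub, Polynomial.map_pow, map_X,
    map_C, RingHom.coe_coe, evalTorus_smul_hMon, inclS_sub, inclS_eZero, inclS_eVec, torusChar_eVec,
    h0, h1, Units.val_mul, Units.val_inv_eq_inv_val, Rat.cast_pow, Rat.cast_natCast]

lemma twist_smul_hMon (p : ℕ) [Fact p.Prime] (q : ℚ) (ν : Lat m) :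
    twist p m (q • hMon ν) = (q * (p : ℚ) ^ (-pairing (rho m) (inclS ν))) • hMon ν := by
  rw [map_smul, hMon, twist, AddMonoidAlgebra.lift_single, one_smul, mul_smul]
  rfl

theorem map_twist_heckePolynomial (p : ℕ) [Fact p.Prime] :
    (heckePolynomial p m).map (twist p m : GroupAlg m →+* GroupAlg m) =
      (X ^ 2 - C ((p : ℚ) ^ (2 * m) • hMon (eZero m))) *
        ∏ i : Fin m, ((X - C ((p : ℚ) ^ (i : ℕ) • hMon (eVec i))) *
          (X - C ((p : ℚ) ^ (2 * m - (i : ℕ)) • hMon (eZero m - eVec i)))) := by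
  have hp : (p : ℚ) ≠ 0 := Nat.cast_ne_zero.mpr (Fact.out : p.Prime).ne_zero
  have h0 : pairing (rho m) (inclS (eZero m)) = 0 := by
    rw [pairing_rho_inclS]
    simp [eZero]
  have h1 : ∀ i : Fin m, pairing (rho m) (inclS (eVec i)) = m - i := by
    intro i
    rw [pairing_rho_inclS]
    simp [eVec, Pi.single_apply]
  have h2 : ∀ i : Fin m, pairing (rho m) (inclS (eZero m - eVec i)) = i - m := by
    intro i
    rw [pairing_rho_inclS]
    simp [eVec, eZero, Pi.single_apply]
  have h3 : ∀ i : Fin m, (p : ℚ) ^ m * (p : ℚ) ^ (-((m : ℤ) - i)) = (p : ℚ) ^ (i : ℕ) := by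
    intro i
    rw [← zpow_natCast, ← zpow_natCast, ← zpow_add₀ hp]
    congr 1
    ring
  have h4 : ∀ i : Fin m, (p : ℚ) ^ m * (p : ℚ) ^ (-((i : ℤ) - m)) =
      (p : ℚ) ^ (2 * m - (i : ℕ)) := by
    intro i
    rw [← zpow_natCast, ← zpow_natCast, ← zpow_add₀ hp]
    congr 1
    have := i.2
    omega
  rw [heckePolynomial]
  simp only [Polynomial.map_mul, Polynomial.map_prod, Polynomial.map_sub, Polynomial.map_pow, map_X,
    map_C, RingHom.coe_coe, twist_smul_hMon, h0, h1, h2, h3, h4, neg_zero, zpow_zero, mul_one]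

end HeckePolynomial

end GSpinHecke

end

theorem mainTheorem5 (p : ℕ) [Fact p.Prime] (hp : p ≠ 2) (m : ℕ) (hm : 0 < m)
    (ε : ℤ_[p]ˣ) (hε : ¬ IsSquare (ε : ℤ_[p]))
    (k : Type u) [Field k] [IsAlgClosed k] [CharZero k] :
    -- the Kuga-Satake cocharacter is `e₁^∨`
    (∀ (F : Type w) [Field F] [CharZero F] [Algebra ℚ_[p] F] (d : Fˣ)
        (hd : (d : F) ^ 2 = algebraMap ℚ_[p] F ((ε : ℤ_[p]) : ℚ_[p])) (x : Lat (m + 1)),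
      IsKugaSatake hm _ d hd x ↔ x = eVec 0) ∧
    -- the representation of the L-group with highest weight `e₁^∨` exists
    (∃ r : Representation k (LGroup m k) (Idx m → k), IsHighestWeightRep (eVec 0) r) ∧
    (∀ (V : Type v) [AddCommGroup V] [Module k V] [Module.Finite k V]
        (r : Representation k (LGroup m k) V), IsHighestWeightRep (eVec 0) r →
      -- its weights, all of multiplicity one
      (∀ x : Lat (m + 1), weightSpace r x ≠ ⊥ ↔
        ∃ i : Fin (m + 1), x = eVec i ∨ x = eZero (m + 1) - eVec i) ∧
      (∀ i : Fin (m + 1), Module.finrank k (weightSpace r (eVec i)) = 1 ∧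
        Module.finrank k (weightSpace r (eZero (m + 1) - eVec i)) = 1) ∧
      -- the Hecke polynomial on the maximal torus
      (∀ (s : kˣ) (t : Fin (m + 1) → kˣ),
        heckePolyAt p (eVec 0) r (torus s t) =
          (X ^ 2 - C ((p : k) ^ (2 * m) * (s : k))) *
            ∏ i : Fin m, ((X - C ((p : k) ^ m * (t i.castSucc : k))) *
              (X - C ((p : k) ^ m * ((s : k) * (t i.castSucc : k)⁻¹))))) ∧
      -- the Hecke polynomial over `ℚ[X_*(S)]`, in the normalization of the twisted Satake transform
      (∃ H : (GroupAlg m)[X], IsHeckePolynomial p (eVec 0) r H ∧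
        (∀ H' : (GroupAlg m)[X], IsHeckePolynomial p (eVec 0) r H' → H' = H) ∧
        H.map (twist p m : GroupAlg m →+* GroupAlg m) =
          (X ^ 2 - C ((p : ℚ) ^ (2 * m) • hMon (eZero m))) *
            ∏ i : Fin m, ((X - C ((p : ℚ) ^ (i : ℕ) • hMon (eVec i))) *
              (X - C ((p : ℚ) ^ (2 * m - (i : ℕ)) • hMon (eZero m - eVec i)))))) ∧
    -- `s = h_{e₀^∨}` is the twisted Satake transform of `K_p p K_p`
    (∀ ν : Lat m, satake p m ε (heckeOp p m ε (scalar (formQ p m ε) (pUnit p))) ν =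
      (hMon (eZero m)).coeff ν) := by
  refine ⟨fun F _ _ _ d hd x => isKugaSatake_iff hm _ d hd x,
    ⟨stdRep m k, isHighestWeightRep_stdRep hm⟩, ?_, fun ν => satake_heckeOp_scalar hp ν⟩
  intro V _ _ _ r hr
  obtain ⟨T, hT, hTσ⟩ := hr.exists_equiv_stdRep hm
  refine ⟨fun x => ?_, fun i => ⟨finrank_weightSpace hT (Sum.inl i),
    finrank_weightSpace hT (Sum.inr i)⟩, heckePolyAt_torus hTσ p,
    heckePolynomial p m, isHeckePolynomial_heckePolynomial hTσ p,
    fun H' hH' => (isHeckePolynomial_heckePolynomial hTσ p).unique hH',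
    map_twist_heckePolynomial p⟩
  rw [weightSpace_ne_bot_iff hT]
  constructor
  · rintro ⟨i | i, rfl⟩
    · exact ⟨i, Or.inl rfl⟩
    · exact ⟨i, Or.inr rfl⟩
  · rintro ⟨i, rfl | rfl⟩
    · exact ⟨Sum.inl i, rfl⟩
    · exact ⟨Sum.inr i, rfl⟩
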